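/- Let $G$ be a group generated by a finite set $\Sigma\subseteq G\setminus\{1\}$, let $\Gamma=\Sigma\cup\Sigma^{-1}\subseteq G$ with involution $\overline a=a^{-1}$, let $\Gamma^*$ be the free monoid on $\Gamma$ with the induced involution $\overline{a_1\cdots a_n}=\overline{a_n}\cdots\overline{a_1}$, and let $\pi:\Gamma^*\to G$ be the canonical homomorphism. Let $A=\mathbb Z[t]$ as an ordered abelian group, where $\alpha>0$ iff the leading coefficient of $\alpha$ is positive, and let $\deg$ be the polynomial degree, $\deg 0=-\infty$. A closed word over $\Gamma$ is a map $x:[1,\alpha]\to\Gamma$ with $0\le\alpha\in A$ and $[1,\alpha]=\{\beta\in A: 1\le\beta\le\alpha\}$; put $|x|=\alpha$ and $\deg(x)=\deg(\alpha)$. Closed words form a monoid $W(A,\Gamma)$ under concatenation, with involution $\overline{x}(\beta)=\overline{x(\alpha+1-\beta)}$, and $\Gamma^*\subseteq W(A,\Gamma)$ is the submonoid of finite words. A closed word is $G$-reduced if no non-empty finite factor $f\in\Gamma^*$ of it satisfies $\pi(f)=1$. For a rewriting system $T\subseteq M\times M$ over a monoid $M$ write $x\to_T y$ if $x=p\ell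 q$ and $y=prq$ for some $p,q\in M$ and $(\ell,r)\in T$; $\to_T^*$ is the reflexive-transitive closure and $\leftrightarrow_T^*$ the generated equivalence relation. Let $S_0\subseteq\Gamma^*\times\Gamma^*$ be any rewriting system such that: (1) $u\leftrightarrow_{S_0}^*v$ iff $\pi(u)=\pi(v)$; (2) $(a\overline a,1)\in S_0$ for all $a\in\Gamma$; (3) $(\ell,r)\in S_0$ implies $(\overline\ell,\overline r)\in S_0$; (4) no rule of $S_0$ applies to the empty word $1$; (5) $S_0$ is confluent. Define on $W(A,\Gamma)$ $$S=S_0\cup\{u\overline u\to 1 : u\in W(A,\Gamma)\text{ infinite and } G\text{-reduced}\},\qquad \operatorname{rdeg}(x)=\min\{\deg(y): x\to_S^*y\}.$$ Suppose that for each $v\in\Gamma^*$ there is an algorithm (which may depend on $v$) that decides on input $u\in\Gamma^*$ whether $\pi(u)$ lies in the subgroup of $G$ generated by $\pi(v)$. Then for each finite set $\Delta\subseteq W(A,\Gamma)$ of $G$-reduced words there is an algorithm which computes, on input $w=g_1\cdots g_n\in\Delta^*$ (given as the sequence $g_1,\dots,g_n$ of elements of $\Delta$), the reduced degree $\operatorname{rdeg}(w)\in\mathbb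 N\cup\{-\infty\}$ and some $w'\in W(A,\Gamma)$ such that $w\leftrightarrow_S^*w'$ and $\deg(w')=\operatorname{rdeg}(w)$. Here $w'$ is output as a sequence $h_1,\dots,h_m$ of elements, with $w'=h_1\cdots h_m$, of a finite set $\Delta'$ of $G$-reduced words that is fixed in advance and does not depend on the input $w$. -/

import Mathlib

open Polynomial

namespace NonArch

/-! ## The ordered abelian group `ℤ[t]`

`α ≤ β` iff `α = β` or `β - α` has positive leading coefficient. The degree of an element is
`Polynomial.degree`, with values in `WithBot ℕ` and `degree 0 = ⊥` (that is, `-∞`). -/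

theorem leadingCoeff_add_pos {p q : ℤ[X]} (hp : 0 < p.leadingCoeff) (hq : 0 < q.leadingCoeff) :
    0 < (p + q).leadingCoeff := by
  rcases lt_trichotomy p.degree q.degree with h | h | h
  · rwa [leadingCoeff_add_of_degree_lt h]
  · rw [leadingCoeff_add_of_degree_eq h (by omega)]; omega
  · rwa [leadingCoeff_add_of_degree_lt' h]

noncomputable instance instLinearOrderZT : LinearOrder ℤ[X] where
  le p q := p = q ∨ 0 < (q - p).leadingCoeff
  le_refl p := Or.inl rfl
  le_trans p q r := by
    rintro (rfl | h1) (rfl | h2)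
    · exact Or.inl rfl
    · exact Or.inr h2
    · exact Or.inr h1
    · right
      have := leadingCoeff_add_pos h2 h1
      rwa [sub_add_sub_cancel] at this
  le_antisymm p q := by
    rintro (rfl | h1) (h2 | h2)
    · rfl
    · rfl
    · exact h2.symm
    · exfalso
      rw [← neg_sub, leadingCoeff_neg] at h2
      omega
  le_total p q := by
    by_cases h : p = q
    · exact Or.inl (Or.inl h)
    · have h0 : (q - p).leadingCoeff ≠ 0 := by
        rw [Ne, leadingCoeff_eq_zero, sub_eq_zero]
        exact fun h' => h h'.symm
      rcases lt_or_gt_of_ne h0 with h1 | h1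
      · right; right
        rw [← neg_sub, leadingCoeff_neg]
        omega
      · left; right; exact h1
  toDecidableLE := Classical.decRel _

theorem zt_le_def (p q : ℤ[X]) : p ≤ q ↔ p = q ∨ 0 < (q - p).leadingCoeff := Iff.rfl

instance instIsOrderedAddMonoidZT : IsOrderedAddMonoid ℤ[X] where
  add_le_add_left p q h r := by
    rw [zt_le_def] at h ⊢
    rcases h with rfl | h
    · exact Or.inl rfl
    · right
      rwa [add_sub_add_right_eq_sub]

theorem zt_lt_def (p q : ℤ[X]) : p < q ↔ 0 < (q - p).leadingCoeff := by
  rw [lt_iff_le_and_ne, zt_le_def]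
  constructor
  · rintro ⟨h | h, h'⟩
    · exact absurd h h'
    · exact h
  · intro h
    refine ⟨Or.inr h, ?_⟩
    rintro rfl
    simp at h

/-- The order is discrete: `1` is the least positive element. -/
theorem zt_one_le_iff (p : ℤ[X]) : 1 ≤ p ↔ 0 < p := by
  constructor
  · intro h
    refine lt_of_lt_of_le ?_ h
    rw [zt_lt_def]
    simp
  · intro h
    rw [zt_lt_def, sub_zero] at h
    rw [zt_le_def]
    by_cases hd : p.degree ≤ 0
    · rw [eq_C_of_degree_le_zero hd] at h ⊢
      rw [leadingCoeff_C] at h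
      have h1 : (C (p.coeff 0) - 1 : ℤ[X]) = C (p.coeff 0 - 1) := by simp
      rw [h1, leadingCoeff_C]
      by_cases h2 : p.coeff 0 = 1
      · left; rw [h2]; simp
      · right; omega
    · right
      rw [leadingCoeff_sub_of_degree_lt]
      · exact h
      · rw [degree_one]; exact lt_of_not_ge hd

/-! ## Closed words -/

/-- A closed word over the alphabet `Γ` in its standard representation `[1, α] → Γ`, where
`α = len ≥ 0`: a partial map `ℤ[t] → Γ` whose domain is exactly the closed interval `[1, len]`. -/
@[ext] structure AWord (Γ : Type*) where
  len : ℤ[X]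
  val : ℤ[X] → Option Γ
  len_nonneg : 0 ≤ len
  dom : ∀ β, (val β).isSome ↔ 1 ≤ β ∧ β ≤ len

namespace AWord

variable {Γ : Type*}

theorem val_eq_none (p : AWord Γ) {β : ℤ[X]} (h : ¬ (1 ≤ β ∧ β ≤ p.len)) : p.val β = none := by
  rw [← p.dom] at h
  simpa using h

/-- The empty word, which is nowhere defined. -/
noncomputable instance : One (AWord Γ) where
  one :=
    { len := 0
      val := fun _ => none
      len_nonneg := le_rfl
      dom := fun β => by
        simp only [Option.isSome_none, Bool.false_eq_true, false_iff, not_and, not_le]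
        intro h
        exact (zt_one_le_iff β).1 h }

open Classical in
/-- Concatenation: `q` is shifted so that it starts right after the end of `p`. -/
noncomputable instance : Mul (AWord Γ) where
  mul p q :=
    { len := p.len + q.len
      val := fun β => if β ≤ p.len then p.val β else q.val (β - p.len)
      len_nonneg := add_nonneg p.len_nonneg q.len_nonneg
      dom := fun β => by
        by_cases h : β ≤ p.len
        · rw [if_pos h, p.dom]
          have : β ≤ p.len + q.len := h.trans (le_add_of_nonneg_right q.len_nonneg)
          tauto
        · rw [if_neg h, q.dom, sub_le_iff_le_add']
          have h1 : 1 ≤ β - p.len := (zt_one_le_iff _).2 (sub_pos.2 (lt_of_not_ge h))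
          have h2 : 1 ≤ β := (zt_one_le_iff _).2 (lt_of_le_of_lt p.len_nonneg (lt_of_not_ge h))
          tauto }

@[simp] theorem one_len : (1 : AWord Γ).len = 0 := rfl

@[simp] theorem one_val (β : ℤ[X]) : (1 : AWord Γ).val β = none := rfl

@[simp] theorem mul_len (p q : AWord Γ) : (p * q).len = p.len + q.len := rfl

open Classical in
theorem mul_val (p q : AWord Γ) (β : ℤ[X]) :
    (p * q).val β = if β ≤ p.len then p.val β else q.val (β - p.len) := rfl

/-- The closed words over `Γ` form a monoid under concatenation. -/
noncomputable instance : Monoid (AWord Γ) where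
  mul_assoc p q r := by
    ext1
    · simp [add_assoc]
    · funext β
      simp only [mul_val, mul_len]
      by_cases h1 : β ≤ p.len
      · have h2 : β ≤ p.len + q.len := h1.trans (le_add_of_nonneg_right q.len_nonneg)
        simp [h1, h2]
      · by_cases h2 : β ≤ p.len + q.len
        · have h3 : β - p.len ≤ q.len := by rwa [sub_le_iff_le_add']
          simp [h1, h2, h3]
        · have h3 : ¬ β - p.len ≤ q.len := by rwa [sub_le_iff_le_add']
          simp only [h1, h2, h3, if_false]
          rw [sub_sub]
  one_mul p := by
    ext1
    · simp
    · funext β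
      simp only [mul_val, one_len, one_val, sub_zero]
      split_ifs with h
      · refine (p.val_eq_none fun h' => ?_).symm
        exact absurd ((zt_one_le_iff β).1 h'.1) (not_lt.2 h)
      · rfl
  mul_one p := by
    ext1
    · simp
    · funext β
      simp only [mul_val, one_val]
      split_ifs with h
      · rfl
      · exact (p.val_eq_none fun h' => h h'.2).symm

/-- The degree (height) of a word is the degree of its length; the empty word has degree `⊥`. -/
noncomputable def deg (p : AWord Γ) : WithBot ℕ := p.len.degree

/-- A word is finite if the interval on which it is defined is finite. -/
def IsFinite (p : AWord Γ) : Prop := (Set.Icc 1 p.len).Finite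

/-- The involution on words: read from right to left and invert each letter. -/
noncomputable def bar [InvolutiveInv Γ] (p : AWord Γ) : AWord Γ where
  len := p.len
  val := fun β => (p.val (p.len + 1 - β)).map fun a => a⁻¹
  len_nonneg := p.len_nonneg
  dom := fun β => by
    rw [Option.isSome_map, p.dom, sub_le_iff_le_add, le_sub_iff_add_le, add_comm 1 β,
      add_le_add_iff_right, add_le_add_iff_left]
    tauto

open Classical in
/-- The word of length one consisting of the letter `a`. -/
noncomputable def letter (a : Γ) : AWord Γ where
  len := 1
  val := fun β => if β = 1 then some a else none
  len_nonneg := ((zt_one_le_iff 1).1 le_rfl).le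
  dom := fun β => by
    by_cases h : β = 1
    · simp [h]
    · simp only [h, if_false, Option.isSome_none, Bool.false_eq_true, false_iff]
      exact fun h' => h (le_antisymm h'.2 h'.1)

/-- Finite words, i.e. elements of the free monoid `Γ*`, as closed words. -/
noncomputable def ofFinite : FreeMonoid Γ →* AWord Γ := FreeMonoid.lift letter

end AWord

/-! ## Rewriting systems over a monoid -/

section Rewriting

variable {M : Type*} [Monoid M]

/-- The one-step rewriting relation of the system `S ⊆ M × M`. -/
def Step (S : Set (M × M)) (x y : M) : Prop :=
  ∃ p q l r : M, (l, r) ∈ S ∧ x = p * l * q ∧ y = p * r * q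

/-- The reflexive and transitive closure of the rewriting relation. -/
def Reduces (S : Set (M × M)) : M → M → Prop := Relation.ReflTransGen (Step S)

/-- The symmetric, reflexive and transitive closure of the rewriting relation. -/
def Equivalent (S : Set (M × M)) : M → M → Prop := Relation.EqvGen (Step S)

/-- No rule of `S` can be applied to `x`. -/
def IsIrreducible (S : Set (M × M)) (x : M) : Prop := ∀ y, ¬ Step S x y

def IsConfluent (S : Set (M × M)) : Prop :=
  ∀ x y z : M, Reduces S x y → Reduces S x z → ∃ w, Reduces S y w ∧ Reduces S z w

end Rewriting

/-! ## Words over a group -/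

section OverGroup

variable {G : Type*} [Group G]

/-- The alphabet `Γ = Σ ∪ Σ⁻¹`, as a subset of the group. -/
def Letter (Sig : Set G) : Type _ := {a : G // a ∈ Sig ∨ a⁻¹ ∈ Sig}

instance (Sig : Set G) : InvolutiveInv (Letter Sig) where
  inv a := ⟨a.1⁻¹, by rw [inv_inv]; exact a.2.symm⟩
  inv_inv a := Subtype.ext (inv_inv a.1)

variable {Sig : Set G}

/-- The canonical homomorphism `π : Γ* → G`. -/
def toGroup : FreeMonoid (Letter Sig) →* G := FreeMonoid.lift fun a => a.1

/-- The involution on `Γ*`. -/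
def barFinite (u : FreeMonoid (Letter Sig)) : FreeMonoid (Letter Sig) :=
  FreeMonoid.ofList ((u.toList.map fun a => a⁻¹).reverse)

/-- A word is `G`-reduced if no non-empty finite factor of it is the identity of `G`. -/
def IsGReduced (x : AWord (Letter Sig)) : Prop :=
  ∀ (p q : AWord (Letter Sig)) (f : FreeMonoid (Letter Sig)),
    x = p * AWord.ofFinite f * q → toGroup f = 1 → f = 1

/-- The conditions imposed on the rewriting system `S₀ ⊆ Γ* × Γ*` for `G`. -/
structure IsBaseSystem (S₀ : Set (FreeMonoid (Letter Sig) × FreeMonoid (Letter Sig))) : Prop where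
  presents : ∀ u v, Equivalent S₀ u v ↔ toGroup u = toGroup v
  cancel : ∀ a : Letter Sig, (FreeMonoid.of a * FreeMonoid.of a⁻¹, 1) ∈ S₀
  bar : ∀ l r, (l, r) ∈ S₀ → (barFinite l, barFinite r) ∈ S₀
  one_irreducible : IsIrreducible S₀ 1
  confluent : IsConfluent S₀

/-- The system `S = S₀ ∪ {u ū → 1 | u is G-reduced and infinite}` over closed words. -/
def bigSystem (S₀ : Set (FreeMonoid (Letter Sig) × FreeMonoid (Letter Sig))) :
    Set (AWord (Letter Sig) × AWord (Letter Sig)) :=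
  {e | (∃ l r, (l, r) ∈ S₀ ∧ e = (AWord.ofFinite l, AWord.ofFinite r)) ∨
    ∃ u, IsGReduced u ∧ ¬ u.IsFinite ∧ e = (u * u.bar, 1)}

/-- The reduced degree `min {deg y | x →* y}` with respect to a rewriting system on words. -/
noncomputable def rdeg {Γ : Type*} (S : Set (AWord Γ × AWord Γ)) (x : AWord Γ) : WithBot ℕ :=
  (wellFounded_lt : WellFounded ((· < ·) : WithBot ℕ → WithBot ℕ → Prop)).min
    {d | ∃ y, Reduces S x y ∧ y.deg = d} ⟨x.deg, x, Relation.ReflTransGen.refl, rfl⟩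

/-- The closed word that is the product of a finite sequence of elements of `Δ`. -/
noncomputable def eval {Γ : Type*} {Δ : Finset (AWord Γ)} (w : List Δ) : AWord Γ :=
  (w.map fun g => (g : AWord Γ)).prod

end OverGroup

/-! ## Algorithms on words over finite alphabets

The letters of a finite alphabet are numbered; which numbering is used does not matter. -/

/-- There is an algorithm that decides `P` on words over the finite alphabet `α`. -/
def IsDecidable {α : Type*} (P : List α → Prop) : Prop :=
  ∃ (k : ℕ) (e : α ≃ Fin k), ComputablePred fun w : List (Fin k) => P (w.map e.symm)

/-- There is an algorithm that, given a word `w` over the finite alphabet `α`, computes both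
`d w` (where `none` encodes `⊥`) and the word `f w` over the finite alphabet `β`. -/
def IsComputable {α β : Type*} (d : List α → WithBot ℕ) (f : List α → List β) : Prop :=
  ∃ (k m : ℕ) (e : α ≃ Fin k) (e' : β ≃ Fin m),
    Computable fun w : List (Fin k) =>
      ((WithBot.recBotCoe none some (d (w.map e.symm)) : Option ℕ), (f (w.map e.symm)).map e')

end NonArch

open Polynomial
namespace NonArch

/-! ## Degrees and coefficients in the ordered group `ℤ[t]` -/

/-! Let `E n` be the group generated by the `G`-reduced words of degree at most `n`, with the
relations given by concatenation, by `u * u.bar = 1`, and by multiplication in `G` of finite words.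
Every product of such words has a class in `E n` (`Rep`), and the rewriting problem is translated
into questions about the chain `E 0 → E 1 → ⋯`, where `E 0` is `G`.

The step from `E n` to `E (n + 1)` behaves like an HNN extension whose stable letters are the
reduced words with leading term `t ^ (n + 1)`. Two-sided multiplication by `E n` makes classes of
such words a biset. Its right action is free because nonempty reduced words are nontrivial in `E n`
(`Faithful`). Then `E (n + 1)` acts on normal forms over the biset, which gives a Britton lemma: a
product of stable letters without a `Pinch` has as many syllables as letters (`syl_stackProd`).
Neighbouring pieces of a reduced word never pinch (`not_pinch_one`), so `Faithful` passes to `n +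
1`, and the maps between the groups are injective.

Rewriting preserves classes (`Rep.step`). Conversely, each pinch can be carried out by rules of the
system. Hence a word reduces to degree at most `m` exactly when its class lies in the image of `E m`
(`Rep.rdeg_le_iff`), and words with the same class are equivalent (`Rep.equivalent`).

It remains to decide membership in these images. Britton reduction does so, provided that for each
stable letter `u` the group of those `b` in `E n` with `u * b * u⁻¹` in `E n` is finitely generated
and decidable. Its elements are the quotients of two suffixes of `u` that are preceded by the same
word of degree `n + 1`, that is, they come from periods of `u` (`exists_period_iff`). The
coefficient of `t ^ e` embeds the periods of degree at most `e`, modulo those of smaller degree,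
into `ℤ`. So there is a finite tower with cyclic layers (`periodSet_succ`), which gives finite
generation. Conjugation by a long suffix of `u` turns the generator of a layer into a word all of
whose powers are reduced, and sends the lower layers to lower degree. A syllable count then reveals
the exponent up to sign (`LocDec.zpow_mul`, `locDec_periodSet`). At the bottom, membership in a
cyclic subgroup of `G` remains, which is the hypothesis. Once everything is decidable, the output
word is found by unbounded search over a finite alphabet. -/

theorem leadingCoeff_nonneg_of_nonneg {p : ℤ[X]} (h : 0 ≤ p) : 0 ≤ p.leadingCoeff := by
  rcases h.eq_or_lt with rfl | h
  · simp
  · rw [zt_lt_def, sub_zero] at h; exact h.le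

theorem coeff_nonneg_of_degree_le {p : ℤ[X]} (h : 0 ≤ p) {n : ℕ} (hd : p.degree ≤ n) :
    0 ≤ p.coeff n := by
  rcases hd.lt_or_eq with hd | hd
  · rw [coeff_eq_zero_of_degree_lt hd]
  · rw [← natDegree_eq_of_degree_eq_some hd]; exact leadingCoeff_nonneg_of_nonneg h

theorem degree_le_of_coeff_eq_zero {p : ℤ[X]} {n : ℕ} (hd : p.degree ≤ (n + 1 : ℕ))
    (h : p.coeff (n + 1) = 0) : p.degree ≤ n := by
  rw [degree_le_iff_coeff_zero] at hd ⊢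
  intro m hm
  rcases eq_or_ne m (n + 1) with rfl | hne
  · exact h
  · refine hd m ?_
    have : n < m := by exact_mod_cast hm
    exact_mod_cast (by omega : n + 1 < m)

theorem coeff_eq_zero_of_degree_le {p : ℤ[X]} {n : ℕ} (hd : p.degree ≤ n) :
    p.coeff (n + 1) = 0 :=
  coeff_eq_zero_of_degree_lt (hd.trans_lt (by exact_mod_cast n.lt_succ_self))

/-- The leading coefficient of `q - p` is that of `q`. This is what allows a prefix or suffix of
degree `n` to be cut off a word of degree `n + 1`, whatever its exact length. -/
theorem le_of_coeff_pos {p q : ℤ[X]} {n : ℕ} (hp : p.degree ≤ n) (hq : q.degree ≤ (n + 1 : ℕ))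
    (h : 0 < q.coeff (n + 1)) : p ≤ q := by
  right
  have h1 : (q - p).degree = (n + 1 : ℕ) := by
    rw [degree_sub_eq_left_of_degree_lt]
    · refine le_antisymm hq (le_degree_of_ne_zero h.ne')
    · refine hp.trans_lt (lt_of_lt_of_le ?_ (le_degree_of_ne_zero h.ne'))
      exact_mod_cast n.lt_succ_self
  rw [leadingCoeff, natDegree_eq_of_degree_eq_some h1, coeff_sub, coeff_eq_zero_of_degree_le hp]
  simpa using h

theorem degree_mono {p q : ℤ[X]} (hp : 0 ≤ p) (h : p ≤ q) : p.degree ≤ q.degree := by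
  by_contra! hlt
  have h1 : 0 < p := by
    refine lt_of_le_of_ne hp ?_
    rintro rfl
    simp at hlt
  rw [zt_lt_def, sub_zero] at h1
  rcases h with rfl | h
  · exact lt_irrefl _ hlt
  · rw [← neg_sub, leadingCoeff_neg, leadingCoeff_sub_of_degree_lt hlt] at h
    omega

theorem degree_le_zero_of_le_natCast {p : ℤ[X]} {n : ℕ} (hp : 0 ≤ p) (h : p ≤ (n : ℤ[X])) :
    p.degree ≤ 0 :=
  (degree_mono hp h).trans (degree_natCast_le n)

theorem exists_natCast_of_degree_le_zero {p : ℤ[X]} (hp : 0 ≤ p) (h : p.degree ≤ 0) :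
    ∃ n : ℕ, p = n := by
  have h1 := coeff_nonneg_of_degree_le hp (n := 0) h
  obtain ⟨n, hn⟩ := Int.eq_ofNat_of_zero_le h1
  refine ⟨n, ?_⟩
  rw [eq_C_of_degree_le_zero h, hn]
  simp

/-- A nonnegative element of positive degree exceeds every natural number. Below a constant there
are only constants. -/
theorem finite_Icc_iff {p : ℤ[X]} (hp : 0 ≤ p) : (Set.Icc 1 p).Finite ↔ p.degree ≤ 0 := by
  constructor
  · intro hf
    by_contra! hd
    refine Set.infinite_of_injective_forall_mem (f := fun n : ℕ => ((n + 1 : ℕ) : ℤ[X])) ?_ ?_ hf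
    · intro a b hab
      simpa using hab
    · intro a
      have hpos : 0 < p.leadingCoeff := by
        refine lt_of_le_of_ne (leadingCoeff_nonneg_of_nonneg hp) (Ne.symm ?_)
        rw [Ne, leadingCoeff_eq_zero]
        rintro rfl
        simp at hd
      refine ⟨?_, ?_⟩
      · rw [zt_one_le_iff, zt_lt_def, sub_zero]
        have : ((a + 1 : ℕ) : ℤ[X]) = C ((a : ℤ) + 1) := by simp
        rw [this, leadingCoeff_C]
        omega
      · right
        rwa [leadingCoeff_sub_of_degree_lt]
        exact (degree_natCast_le _).trans_lt hd
  · intro hd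
    obtain ⟨n, rfl⟩ := exists_natCast_of_degree_le_zero hp hd
    refine Set.Finite.subset (Set.finite_range fun i : Fin (n + 1) => ((i : ℕ) : ℤ[X])) ?_
    rintro q ⟨h1, h2⟩
    have hq : 0 ≤ q := ((zt_one_le_iff q).1 h1).le
    obtain ⟨m, rfl⟩ := exists_natCast_of_degree_le_zero hq (degree_le_zero_of_le_natCast hq h2)
    have hmn : m ≤ n := by
      by_contra! hlt
      have h3 : (n : ℤ[X]) < m := by
        rw [zt_lt_def]
        have : (m : ℤ[X]) - n = C ((m : ℤ) - n) := by simp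
        rw [this, leadingCoeff_C]
        omega
      exact absurd h2 (not_le.2 h3)
    exact ⟨⟨m, by omega⟩, rfl⟩

/-! ## Combinatorics of closed words -/

namespace AWord

variable {Γ : Type*}

theorem len_eq_zero {p : AWord Γ} : p.len = 0 ↔ p = 1 := by
  constructor
  · intro h
    ext1
    · exact h
    · funext β
      refine p.val_eq_none fun h' => ?_
      rw [h] at h'
      exact absurd ((zt_one_le_iff β).1 h'.1) (not_lt.2 h'.2)
  · rintro rfl; rfl

theorem mul_eq_one {p q : AWord Γ} (h : p * q = 1) : p = 1 ∧ q = 1 := by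
  have h1 : p.len + q.len = 0 := by rw [← mul_len, h, one_len]
  have := (add_eq_zero_iff_of_nonneg p.len_nonneg q.len_nonneg).1 h1
  exact ⟨len_eq_zero.1 this.1, len_eq_zero.1 this.2⟩

/-- Every `γ` with `0 ≤ γ ≤ |x|` is the length of a prefix of `x`. -/
theorem exists_mul_eq (x : AWord Γ) {γ : ℤ[X]} (h0 : 0 ≤ γ) (h1 : γ ≤ x.len) :
    ∃ p q, x = p * q ∧ p.len = γ := by
  classical
  refine ⟨⟨γ, fun β => if β ≤ γ then x.val β else none, h0, fun β => ?_⟩,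
    ⟨x.len - γ, fun β => if 1 ≤ β then x.val (β + γ) else none, sub_nonneg.2 h1, fun β => ?_⟩,
    ?_, rfl⟩
  · by_cases h : β ≤ γ
    · rw [if_pos h, x.dom]
      have := h.trans h1
      tauto
    · simp [h]
  · by_cases h : 1 ≤ β
    · rw [if_pos h, x.dom, le_sub_iff_add_le]
      have : 1 ≤ β + γ := h.trans (le_add_of_nonneg_right h0)
      tauto
    · simp [h]
  · ext1
    · simp
    · funext β
      rw [mul_val]
      by_cases h : β ≤ γ
      · simp [h]
      · have : 1 ≤ β - γ := (zt_one_le_iff _).2 (sub_pos.2 (lt_of_not_ge h))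
        simp [h, this]

theorem mul_left_cancel' {p q q' : AWord Γ} (h : p * q = p * q') : q = q' := by
  ext1
  · have := congrArg AWord.len h
    simpa using this
  · funext β
    by_cases hβ : 1 ≤ β
    · have := congrFun (congrArg AWord.val h) (β + p.len)
      have h2 : ¬ β + p.len ≤ p.len := by
        rw [add_le_iff_nonpos_left, not_le]
        exact (zt_one_le_iff β).1 hβ
      rw [mul_val, mul_val, if_neg h2, if_neg h2] at this
      simpa using this
    · rw [q.val_eq_none fun h' => hβ h'.1, q'.val_eq_none fun h' => hβ h'.1]

theorem eq_of_mul_eq_mul {p q p' q' : AWord Γ} (h : p * q = p' * q') (hl : p.len = p'.len) :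
    p = p' ∧ q = q' := by
  have hp : p = p' := by
    ext1
    · exact hl
    · funext β
      by_cases hβ : β ≤ p.len
      · have := congrFun (congrArg AWord.val h) β
        rwa [mul_val, mul_val, if_pos hβ, if_pos (hl ▸ hβ)] at this
      · rw [p.val_eq_none fun h' => hβ h'.2, p'.val_eq_none fun h' => hβ (hl ▸ h'.2)]
  subst hp
  exact ⟨rfl, mul_left_cancel' h⟩

theorem eq_of_mul_eq_mul_right {p q p' q' : AWord Γ} (h : p * q = p' * q')
    (hl : q.len = q'.len) : p = p' ∧ q = q' := by
  refine eq_of_mul_eq_mul h ?_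
  have := congrArg AWord.len h
  rw [mul_len, mul_len, hl] at this
  exact add_right_cancel this

theorem mul_right_cancel' {p p' q : AWord Γ} (h : p * q = p' * q) : p = p' :=
  (eq_of_mul_eq_mul_right h rfl).1

/-- Levi's lemma for closed words. -/
theorem levi {p q p' q' : AWord Γ} (h : p * q = p' * q') (hl : p.len ≤ p'.len) :
    ∃ z, p' = p * z ∧ q = z * q' := by
  obtain ⟨a, z, rfl, ha⟩ := p'.exists_mul_eq p.len_nonneg hl
  rw [mul_assoc] at h
  obtain ⟨rfl, rfl⟩ := eq_of_mul_eq_mul h ha.symm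
  exact ⟨z, rfl, rfl⟩

theorem levi_right {p q p' q' : AWord Γ} (h : p * q = p' * q') (hl : q.len ≤ q'.len) :
    ∃ z, q' = z * q ∧ p = p' * z := by
  have h1 := congrArg AWord.len h
  rw [mul_len, mul_len] at h1
  have h2 : p'.len ≤ p.len := by
    by_contra! hlt
    exact absurd h1 (add_lt_add_of_lt_of_le hlt hl).ne
  obtain ⟨z, h3, h4⟩ := levi h.symm h2
  exact ⟨z, h4, h3⟩

/-! ### The involution -/

section Bar

variable [InvolutiveInv Γ]

@[simp] theorem bar_len (p : AWord Γ) : p.bar.len = p.len := rfl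

theorem bar_val (p : AWord Γ) (β : ℤ[X]) :
    p.bar.val β = (p.val (p.len + 1 - β)).map fun a => a⁻¹ := rfl

@[simp] theorem bar_bar (p : AWord Γ) : p.bar.bar = p := by
  ext1
  · rfl
  · funext β
    rw [bar_val, bar_val, bar_len, Option.map_map]
    simp

theorem le_iff_succ_sub_not_le {α β γ : ℤ[X]} : α + γ + 1 - β ≤ γ ↔ ¬ β ≤ α := by
  rw [not_le, ← sub_pos (b := α), ← zt_one_le_iff, le_sub_iff_add_le, sub_le_iff_le_add]
  constructor <;> intro h
  · have h2 : γ + (1 + α) ≤ γ + β := by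
      convert h using 1; ring
    exact le_of_add_le_add_left h2
  · convert add_le_add_right h γ using 1; ring

@[simp] theorem bar_mul (p q : AWord Γ) : (p * q).bar = q.bar * p.bar := by
  ext1
  · simp [add_comm]
  · funext β
    rw [bar_val, mul_val, mul_val, mul_len, bar_len]
    by_cases h : β ≤ q.len
    · have h2 : ¬ p.len + q.len + 1 - β ≤ p.len := by
        rw [add_comm p.len, le_iff_succ_sub_not_le]; simpa using h
      rw [if_pos h, if_neg h2, bar_val]
      congr 2
      ring
    · have h2 : p.len + q.len + 1 - β ≤ p.len := by
        rw [add_comm p.len, le_iff_succ_sub_not_le]; exact h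
      rw [if_neg h, if_pos h2, bar_val]
      congr 2
      ring

@[simp] theorem bar_one : (1 : AWord Γ).bar = 1 := by
  rw [← len_eq_zero]; rfl

@[simp] theorem bar_letter (a : Γ) : (letter a).bar = letter a⁻¹ := by
  classical
  ext1
  · rfl
  · funext β
    have h : (letter a).len = 1 := rfl
    rw [bar_val, h]
    by_cases hβ : β = 1
    · simp [letter, hβ]
    · have : ¬ (1 + 1 - β = 1) := fun h' => hβ (by linear_combination -h')
      simp [letter, hβ, this]

theorem bar_list_prod (L : List (AWord Γ)) : L.prod.bar = (L.reverse.map bar).prod := by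
  induction L with
  | nil => simp
  | cons a L ih => simp [ih]

end Bar

/-! ### Finite words -/

@[simp] theorem letter_len (a : Γ) : (letter a).len = 1 := rfl

theorem letter_injective : Function.Injective (letter : Γ → AWord Γ) := by
  intro a b h
  have := congrFun (congrArg AWord.val h) 1
  simpa [letter] using this

theorem exists_eq_letter {p : AWord Γ} (h : p.len = 1) : ∃ a, p = letter a := by
  classical
  have h1 : (p.val 1).isSome := (p.dom 1).2 ⟨le_rfl, h.ge⟩
  obtain ⟨a, ha⟩ := Option.isSome_iff_exists.1 h1
  refine ⟨a, ?_⟩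
  ext1
  · exact h
  · funext β
    by_cases hβ : β = 1
    · simp [letter, hβ, ha]
    · simp only [letter, hβ, if_false]
      refine p.val_eq_none fun h' => hβ (le_antisymm (h ▸ h'.2) h'.1)

@[simp] theorem ofFinite_of (a : Γ) : ofFinite (FreeMonoid.of a) = letter a := by
  simp [ofFinite]

theorem ofFinite_len (f : FreeMonoid Γ) : (ofFinite f).len = (f.length : ℤ[X]) := by
  induction f using FreeMonoid.recOn with
  | one => simp
  | of_mul a f h =>
    rw [map_mul, mul_len, h, ofFinite_of, letter_len, FreeMonoid.length_mul,
      FreeMonoid.length_of]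
    push_cast; rfl

theorem exists_eq_letter_mul {p : AWord Γ} (h : p ≠ 1) : ∃ a q, p = letter a * q := by
  have h1 : 1 ≤ p.len := by
    rw [zt_one_le_iff]
    exact lt_of_le_of_ne p.len_nonneg fun h' => h (len_eq_zero.1 h'.symm)
  obtain ⟨a, q, rfl, ha⟩ := p.exists_mul_eq ((zt_one_le_iff 1).1 le_rfl).le h1
  obtain ⟨a, rfl⟩ := exists_eq_letter ha
  exact ⟨a, q, rfl⟩

theorem exists_ofFinite_of_len {p : AWord Γ} {n : ℕ} (h : p.len = n) :
    ∃ f, p = ofFinite f := by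
  induction n generalizing p with
  | zero => exact ⟨1, by rw [map_one]; exact len_eq_zero.1 (by simpa using h)⟩
  | succ n ih =>
    have hp : p ≠ 1 := by
      rintro rfl
      rw [one_len] at h
      exact (Nat.cast_ne_zero.2 n.succ_ne_zero) h.symm
    obtain ⟨a, q, rfl⟩ := exists_eq_letter_mul hp
    obtain ⟨f, rfl⟩ := ih (p := q) (by
      rw [mul_len, letter_len] at h
      push_cast at h
      linear_combination h)
    exact ⟨FreeMonoid.of a * f, by simp⟩

theorem deg_le_zero_iff {p : AWord Γ} : p.deg ≤ 0 ↔ ∃ f, p = ofFinite f := by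
  constructor
  · intro h
    obtain ⟨n, hn⟩ := exists_natCast_of_degree_le_zero p.len_nonneg h
    exact exists_ofFinite_of_len hn
  · rintro ⟨f, rfl⟩
    rw [deg, ofFinite_len]
    exact degree_natCast_le _

theorem isFinite_iff {p : AWord Γ} : p.IsFinite ↔ p.deg ≤ 0 := finite_Icc_iff p.len_nonneg

theorem ofFinite_injective : Function.Injective (ofFinite : FreeMonoid Γ → AWord Γ) := by
  intro f g h
  induction f using FreeMonoid.recOn generalizing g with
  | one =>
    cases g using FreeMonoid.casesOn with
    | one => rfl
    | of_mul b g =>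
      rw [map_one, map_mul] at h
      have h1 := (mul_eq_one h.symm).1
      rw [ofFinite_of, ← len_eq_zero, letter_len] at h1
      exact absurd h1 one_ne_zero
  | of_mul a f ih =>
    cases g using FreeMonoid.casesOn with
    | one =>
      rw [map_one, map_mul] at h
      have h1 := (mul_eq_one h).1
      rw [ofFinite_of, ← len_eq_zero, letter_len] at h1
      exact absurd h1 one_ne_zero
    | of_mul b g =>
      rw [map_mul, map_mul, ofFinite_of, ofFinite_of] at h
      obtain ⟨h1, h2⟩ := eq_of_mul_eq_mul h rfl
      rw [letter_injective h1, ih h2]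

/-! ### Degrees of words -/

theorem len_le_mul_left (p q : AWord Γ) : p.len ≤ (p * q).len :=
  le_add_of_nonneg_right q.len_nonneg

theorem len_le_mul_right (p q : AWord Γ) : q.len ≤ (p * q).len :=
  le_add_of_nonneg_left p.len_nonneg

theorem deg_le_mul_left (p q : AWord Γ) : p.deg ≤ (p * q).deg :=
  degree_mono p.len_nonneg (len_le_mul_left p q)

theorem deg_le_mul_right (p q : AWord Γ) : q.deg ≤ (p * q).deg :=
  degree_mono q.len_nonneg (len_le_mul_right p q)

theorem deg_mul_le {p q : AWord Γ} {n : WithBot ℕ} (hp : p.deg ≤ n) (hq : q.deg ≤ n) :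
    (p * q).deg ≤ n :=
  (degree_add_le _ _).trans (max_le hp hq)

theorem deg_of_mul_le {p q : AWord Γ} {n : WithBot ℕ} (h : (p * q).deg ≤ n) :
    p.deg ≤ n ∧ q.deg ≤ n :=
  ⟨(deg_le_mul_left p q).trans h, (deg_le_mul_right p q).trans h⟩

@[simp] theorem deg_one : (1 : AWord Γ).deg = ⊥ := by simp [deg]

theorem deg_eq_bot {p : AWord Γ} : p.deg = ⊥ ↔ p = 1 := by
  rw [deg, degree_eq_bot, len_eq_zero]

theorem deg_prod_le {L : List (AWord Γ)} {n : WithBot ℕ} (h : ∀ x ∈ L, x.deg ≤ n) :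
    L.prod.deg ≤ n := by
  induction L with
  | nil => simp
  | cons a L ih =>
    rw [List.prod_cons]
    simp only [List.mem_cons, forall_eq_or_imp] at h
    exact deg_mul_le h.1 (ih h.2)

theorem coeff_len_nonneg {p : AWord Γ} {n : ℕ} (h : p.deg ≤ n) : 0 ≤ p.len.coeff n :=
  coeff_nonneg_of_degree_le p.len_nonneg h

/-! ### Lists of words -/

/-- The cut falls inside one of the factors, by Levi's lemma, and both halves of that factor stay in
the class. -/
theorem exists_split_of_prod_eq_mul {C : AWord Γ → Prop} (hl : ∀ x y, C (x * y) → C x)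
    (hr : ∀ x y, C (x * y) → C y) {L : List (AWord Γ)} (hL : ∀ x ∈ L, C x) {p q : AWord Γ}
    (h : L.prod = p * q) :
    ∃ L₁ L₂ : List (AWord Γ), (∀ x ∈ L₁, C x) ∧ (∀ x ∈ L₂, C x) ∧ L₁.prod = p ∧
      L₂.prod = q := by
  induction L generalizing p with
  | nil =>
    obtain ⟨rfl, rfl⟩ := mul_eq_one h.symm
    exact ⟨[], [], by simp, by simp, rfl, rfl⟩
  | cons a L ih =>
    simp only [List.mem_cons, forall_eq_or_imp] at hL
    rw [List.prod_cons] at h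
    rcases le_total a.len p.len with hle | hle
    · obtain ⟨z, rfl, h2⟩ := levi h hle
      obtain ⟨L₁, L₂, h3, h4, rfl, h6⟩ := ih hL.2 h2
      exact ⟨a :: L₁, L₂, by simpa [hL.1] using h3, h4, by simp, h6⟩
    · obtain ⟨z, rfl, h2⟩ := levi h.symm hle
      exact ⟨[p], z :: L, by simpa using hl _ _ hL.1, by simpa [hr _ _ hL.1] using hL.2,
        by simp, by simp [h2]⟩

/-- A partial homomorphism on a class of words closed under factors has the same product along
any two factorizations of a word. -/
theorem map_prod_eq_of_prod_eq {H : Type*} [Group H] {C : AWord Γ → Prop}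
    (hr : ∀ x y, C (x * y) → C y) (ψ : AWord Γ → H)
    (h1 : ψ 1 = 1) (hmul : ∀ x y, C (x * y) → ψ (x * y) = ψ x * ψ y)
    {L₁ L₂ : List (AWord Γ)} (hL₁ : ∀ x ∈ L₁, C x) (hL₂ : ∀ x ∈ L₂, C x)
    (h : L₁.prod = L₂.prod) : (L₁.map ψ).prod = (L₂.map ψ).prod := by
  have hone : ∀ L : List (AWord Γ), L.prod = 1 → (L.map ψ).prod = 1 := by
    intro L hL
    induction L with
    | nil => rfl
    | cons a L ih =>
      rw [List.prod_cons] at hL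
      obtain ⟨rfl, h2⟩ := mul_eq_one hL
      simp [h1, ih h2]
  induction hn : L₁.length + L₂.length using Nat.strong_induction_on generalizing L₁ L₂ with
  | _ n ih =>
  match L₁, L₂ with
  | [], L₂ => rw [hone L₂ h.symm]; rfl
  | a :: L₁, [] => rw [hone (a :: L₁) h]; rfl
  | a :: L₁, b :: L₂ =>
    simp only [List.mem_cons, forall_eq_or_imp, List.prod_cons, List.map_cons,
      List.length_cons] at *
    rcases le_total a.len b.len with hle | hle
    · obtain ⟨z, rfl, h2⟩ := levi h hle
      have := ih (L₁.length + (L₂.length + 1)) (by omega) (L₁ := L₁) (L₂ := z :: L₂) hL₁.2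
        (by simpa [hr _ _ hL₂.1] using hL₂.2) (by simpa using h2) (by simp)
      rw [this, hmul _ _ hL₂.1]
      simp [mul_assoc]
    · obtain ⟨z, rfl, h2⟩ := levi h.symm hle
      have := ih ((L₁.length + 1) + L₂.length) (by omega) (L₁ := z :: L₁) (L₂ := L₂)
        (by simpa [hr _ _ hL₁.1] using hL₁.2) hL₂.2 (by simpa using h2.symm) (by simp)
      rw [← this, hmul _ _ hL₁.1]
      simp [mul_assoc]

end AWord

/-! ## `G`-reduced words -/

section Reduced

variable {G : Type*} [Group G] {Sig : Set G}

theorem IsGReduced.left {x y : AWord (Letter Sig)} (h : IsGReduced (x * y)) : IsGReduced x :=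
  fun p q f hx => h p (q * y) f (by rw [hx]; simp [mul_assoc])

theorem IsGReduced.right {x y : AWord (Letter Sig)} (h : IsGReduced (x * y)) : IsGReduced y :=
  fun p q f hx => h (x * p) q f (by rw [hx]; simp [mul_assoc])

theorem isGReduced_one : IsGReduced (1 : AWord (Letter Sig)) := by
  intro p q f h _
  have := (AWord.mul_eq_one (AWord.mul_eq_one h.symm).1).2
  exact AWord.ofFinite_injective (this.trans (map_one _).symm)

theorem isGReduced_letter (hone : (1 : G) ∉ Sig) (a : Letter Sig) :
    IsGReduced (AWord.letter a) := by
  intro p q f h hf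
  by_contra hne
  cases f using FreeMonoid.casesOn with
  | one => exact hne rfl
  | of_mul b g =>
    have hlen := congrArg AWord.len h
    have hpq : p * AWord.ofFinite (FreeMonoid.of b * g) * q =
        (p * AWord.letter b) * (AWord.ofFinite g * q) := by simp [mul_assoc]
    rw [hpq] at h
    have h0 : p.len + (AWord.ofFinite g).len = 0 := by
      refine le_antisymm ?_ (add_nonneg p.len_nonneg (AWord.len_nonneg _))
      have hlen := congrArg AWord.len h
      simp only [AWord.mul_len, AWord.letter_len] at hlen
      have : p.len + (AWord.ofFinite g).len = - q.len := by linear_combination -hlen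
      rw [this]
      exact neg_nonpos.2 q.len_nonneg
    have hg := ((add_eq_zero_iff_of_nonneg p.len_nonneg (AWord.len_nonneg _)).1 h0).2
    rw [AWord.len_eq_zero] at hg
    have hg1 : g = 1 := AWord.ofFinite_injective (hg.trans (map_one _).symm)
    subst hg1
    have hb : b.1 = 1 := by simpa [toGroup] using hf
    rcases b.2 with h2 | h2
    · exact hone (hb ▸ h2)
    · rw [hb, inv_one] at h2; exact hone h2

theorem bar_ofFinite (f : FreeMonoid (Letter Sig)) :
    (AWord.ofFinite f).bar = AWord.ofFinite (barFinite f) := by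
  induction f using FreeMonoid.recOn with
  | one => rw [barFinite]; simp
  | of_mul a f ih =>
    have : barFinite (FreeMonoid.of a * f) = barFinite f * FreeMonoid.of a⁻¹ := by
      simp [barFinite]
    rw [this, map_mul, map_mul, AWord.bar_mul, ih]
    simp

theorem toGroup_barFinite (f : FreeMonoid (Letter Sig)) :
    toGroup (barFinite f) = (toGroup f)⁻¹ := by
  induction f using FreeMonoid.recOn with
  | one => simp [barFinite]
  | of_mul a f ih =>
    have : barFinite (FreeMonoid.of a * f) = barFinite f * FreeMonoid.of a⁻¹ := by
      simp [barFinite]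
    rw [this, map_mul, map_mul, ih, mul_inv_rev]
    congr 1

@[simp] theorem barFinite_barFinite (f : FreeMonoid (Letter Sig)) :
    barFinite (barFinite f) = f := by
  apply AWord.ofFinite_injective
  rw [← bar_ofFinite, ← bar_ofFinite, AWord.bar_bar]

theorem IsGReduced.bar {x : AWord (Letter Sig)} (h : IsGReduced x) : IsGReduced x.bar := by
  intro p q f hx hf
  have h1 : barFinite f = 1 := by
    refine h q.bar p.bar (barFinite f) ?_ (by rw [toGroup_barFinite, hf, inv_one])
    rw [← AWord.bar_bar x, hx]
    simp [bar_ofFinite, mul_assoc]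
  rw [← barFinite_barFinite f, h1]
  rfl

/-- If `w` began with a letter `a`, the factor `a⁻¹ a` would appear where the two halves meet. -/
theorem eq_one_of_isGReduced_bar_mul {w : AWord (Letter Sig)} (h : IsGReduced (w.bar * w)) :
    w = 1 := by
  by_contra hne
  obtain ⟨a, v, rfl⟩ := AWord.exists_eq_letter_mul hne
  have := h v.bar v (FreeMonoid.of a⁻¹ * FreeMonoid.of a) (by simp [mul_assoc]) (by
    simp only [toGroup, map_mul, FreeMonoid.lift_eval_of]
    exact inv_mul_cancel a.1)
  have := congrArg FreeMonoid.length this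
  simp at this

theorem toGroup_surjective (hgen : Subgroup.closure Sig = ⊤) :
    Function.Surjective (toGroup : FreeMonoid (Letter Sig) →* G) := by
  intro g
  have hg : g ∈ Subgroup.closure Sig := hgen ▸ Subgroup.mem_top g
  induction hg using Subgroup.closure_induction with
  | mem x hx => exact ⟨FreeMonoid.of ⟨x, Or.inl hx⟩, FreeMonoid.lift_eval_of _ _⟩
  | one => exact ⟨1, map_one _⟩
  | mul x y _ _ hx hy =>
    obtain ⟨f, rfl⟩ := hx
    obtain ⟨g, rfl⟩ := hy
    exact ⟨f * g, map_mul _ _ _⟩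
  | inv x _ hx =>
    obtain ⟨f, rfl⟩ := hx
    exact ⟨barFinite f, toGroup_barFinite f⟩

/-- Every element of `G` is represented by a finite `G`-reduced word. -/
theorem exists_isGReduced_toGroup_eq (hgen : Subgroup.closure Sig = ⊤) (g : G) :
    ∃ f : FreeMonoid (Letter Sig), IsGReduced (AWord.ofFinite f) ∧ toGroup f = g := by
  classical
  have hex : ∃ n, ∃ f : FreeMonoid (Letter Sig), toGroup f = g ∧ f.length = n := by
    obtain ⟨f, hf⟩ := toGroup_surjective hgen g
    exact ⟨_, f, hf, rfl⟩
  -- A shortest representative is reduced, since deleting a trivial factor would shorten it.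
  obtain ⟨f, hf, hlen⟩ := Nat.find_spec hex
  refine ⟨f, ?_, hf⟩
  intro p q e hx he
  have hp : p.deg ≤ 0 ∧ q.deg ≤ 0 := by
    have h0 : (p * AWord.ofFinite e * q).deg ≤ 0 := AWord.deg_le_zero_iff.2 ⟨f, hx.symm⟩
    exact ⟨(AWord.deg_of_mul_le (AWord.deg_of_mul_le h0).1).1, (AWord.deg_of_mul_le h0).2⟩
  obtain ⟨⟨a, rfl⟩, ⟨b, rfl⟩⟩ := hp.imp AWord.deg_le_zero_iff.1 AWord.deg_le_zero_iff.1
  rw [← map_mul, ← map_mul] at hx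
  have hx := AWord.ofFinite_injective hx
  subst hx
  have hm : toGroup (a * b) = g := by
    rw [← hf]; simp [he]
  have := Nat.find_min' hex ⟨a * b, hm, rfl⟩
  rw [← hlen] at this
  simp only [FreeMonoid.length_mul] at this
  exact FreeMonoid.length_eq_zero.1 (by omega)

end Reduced

/-! ## Normal forms over a biset

A biset `U` over a group `B`, with an anti-involution and a free right action, gives rise to a
group generated by `B` and `U` in which `u * inv u = 1`. It acts faithfully on normal forms. -/

structure FreeBiset (B : Type*) [Group B] (U : Type*) where
  lmul : B → U → U
  rmul : U → B → U
  inv : U → U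
  one_lmul : ∀ u, lmul 1 u = u
  mul_lmul : ∀ a b u, lmul (a * b) u = lmul a (lmul b u)
  rmul_one : ∀ u, rmul u 1 = u
  rmul_mul : ∀ u a b, rmul u (a * b) = rmul (rmul u a) b
  lmul_rmul : ∀ a u b, lmul a (rmul u b) = rmul (lmul a u) b
  inv_inv : ∀ u, inv (inv u) = u
  inv_lmul : ∀ b u, inv (lmul b u) = rmul (inv u) b⁻¹
  free : ∀ u b, rmul u b = u → b = 1

namespace FreeBiset

variable {B U : Type*} [Group B] (S : FreeBiset B U)

theorem inv_rmul (u : U) (b : B) : S.inv (S.rmul u b) = S.lmul b⁻¹ (S.inv u) := by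
  have h : S.inv (S.lmul b⁻¹ (S.inv u)) = S.rmul u b := by
    rw [S.inv_lmul, S.inv_inv, _root_.inv_inv]
  rw [← h, S.inv_inv]

theorem rmul_left_cancel {u : U} {a b : B} (h : S.rmul u a = S.rmul u b) : a = b := by
  have : S.rmul u (a * b⁻¹) = u := by
    rw [S.rmul_mul, h, ← S.rmul_mul, mul_inv_cancel, S.rmul_one]
  exact mul_inv_eq_one.1 (S.free _ _ this)

def orbitSetoid : Setoid U where
  r u v := ∃ b, v = S.rmul u b
  iseqv :=
    { refl := fun u => ⟨1, (S.rmul_one u).symm⟩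
      symm := by
        rintro u v ⟨b, rfl⟩
        exact ⟨b⁻¹, by rw [← S.rmul_mul, mul_inv_cancel, S.rmul_one]⟩
      trans := by
        rintro u v w ⟨b, rfl⟩ ⟨c, rfl⟩
        exact ⟨b * c, by rw [S.rmul_mul]⟩ }

/-- The set of right orbits. -/
def Orbit : Type _ := Quotient S.orbitSetoid

def orb (u : U) : S.Orbit := Quotient.mk S.orbitSetoid u

noncomputable def rep (k : S.Orbit) : U := Quotient.out k

@[simp] theorem orb_rep (k : S.Orbit) : S.orb (S.rep k) = k := Quotient.out_eq k

theorem orb_eq_iff {u v : U} : S.orb u = S.orb v ↔ ∃ b, v = S.rmul u b :=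
  Quotient.eq (r := S.orbitSetoid)

theorem exists_tail (u : U) : ∃ b, u = S.rmul (S.rep (S.orb u)) b :=
  S.orb_eq_iff.1 (S.orb_rep _)

/-- The element `b` of the group with `u = rep (orb u) * b`. -/
noncomputable def tail (u : U) : B := (S.exists_tail u).choose

theorem rep_tail (u : U) : S.rmul (S.rep (S.orb u)) (S.tail u) = u :=
  (S.exists_tail u).choose_spec.symm

@[simp] theorem orb_rmul (u : U) (b : B) : S.orb (S.rmul u b) = S.orb u :=
  (S.orb_eq_iff.2 ⟨b, rfl⟩).symm

@[simp] theorem tail_rmul (u : U) (b : B) : S.tail (S.rmul u b) = S.tail u * b := by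
  apply S.rmul_left_cancel (u := S.rep (S.orb u))
  rw [S.rmul_mul, S.rep_tail, ← S.orb_rmul u b, S.rep_tail]

@[simp] theorem tail_rep (k : S.Orbit) : S.tail (S.rep k) = 1 := by
  apply S.rmul_left_cancel (u := S.rep k)
  have h := S.rep_tail (S.rep k)
  rw [orb_rep] at h
  rw [h, S.rmul_one]

theorem rep_orb (u : U) : S.rep (S.orb u) = S.rmul u (S.tail u)⁻¹ :=
  calc S.rep (S.orb u) = S.rmul (S.rmul (S.rep (S.orb u)) (S.tail u)) (S.tail u)⁻¹ := by
        rw [← S.rmul_mul, mul_inv_cancel, S.rmul_one]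
    _ = _ := by rw [S.rep_tail]

theorem lmul_eq (b : B) (u : U) :
    S.lmul b u = S.rmul (S.lmul b (S.rep (S.orb u))) (S.tail u) := by
  rw [← S.lmul_rmul, S.rep_tail]

theorem orb_lmul (b : B) (u : U) : S.orb (S.lmul b u) = S.orb (S.lmul b (S.rep (S.orb u))) := by
  rw [S.lmul_eq, orb_rmul]

theorem tail_lmul (b : B) (u : U) :
    S.tail (S.lmul b u) = S.tail (S.lmul b (S.rep (S.orb u))) * S.tail u := by
  rw [S.lmul_eq, tail_rmul]

/-! ### The action of the group on sequences of orbits -/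

/-- Writing `b * rep k = rep k₁ * b₁`, the orbit `k₁` is recorded and `b₁` is carried on to the next
entry. The companion `actT` returns what comes out at the right end. -/
noncomputable def actL : B → List S.Orbit → List S.Orbit
  | _, [] => []
  | b, k :: L => S.orb (S.lmul b (S.rep k)) :: actL (S.tail (S.lmul b (S.rep k))) L

noncomputable def actT : B → List S.Orbit → B
  | b, [] => b
  | b, k :: L => actT (S.tail (S.lmul b (S.rep k))) L

theorem actL_one (L : List S.Orbit) : S.actL 1 L = L := by
  induction L with
  | nil => rfl
  | cons k L ih => rw [actL, S.one_lmul, tail_rep, ih, orb_rep]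

theorem actT_one (L : List S.Orbit) : S.actT 1 L = 1 := by
  induction L with
  | nil => rfl
  | cons k L ih => rw [actT, S.one_lmul, tail_rep, ih]

theorem actL_mul (a b : B) (L : List S.Orbit) :
    S.actL (a * b) L = S.actL a (S.actL b L) := by
  induction L generalizing a b with
  | nil => rfl
  | cons k L ih =>
    simp only [actL]
    rw [S.mul_lmul, ← orb_lmul, tail_lmul, ih]

theorem actT_mul (a b : B) (L : List S.Orbit) :
    S.actT (a * b) L = S.actT a (S.actL b L) * S.actT b L := by
  induction L generalizing a b with
  | nil => rfl
  | cons k L ih =>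
    simp only [actL, actT]
    rw [S.mul_lmul, tail_lmul, ih]

/-- No two neighbouring orbits cancel. -/
def RedList (L : List S.Orbit) : Prop :=
  L.IsChain fun k k' => k' ≠ S.orb (S.inv (S.rep k))

variable {S} in
theorem RedList.tail {k : S.Orbit} {L : List S.Orbit} (h : S.RedList (k :: L)) : S.RedList L :=
  List.IsChain.tail h

theorem orb_lmul_inj {b : B} {u v : U} (h : S.orb (S.lmul b u) = S.orb (S.lmul b v)) :
    S.orb u = S.orb v := by
  obtain ⟨c, hc⟩ := S.orb_eq_iff.1 h
  rw [S.orb_eq_iff]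
  refine ⟨c, ?_⟩
  have := congrArg (S.lmul b⁻¹) hc
  rwa [← S.mul_lmul, S.lmul_rmul, ← S.mul_lmul, inv_mul_cancel, S.one_lmul, S.one_lmul] at this

theorem inv_rep_lmul (b : B) (u : U) :
    S.inv (S.rep (S.orb (S.lmul b u))) =
      S.rmul (S.lmul (S.tail (S.lmul b u)) (S.inv u)) b⁻¹ := by
  rw [rep_orb, S.inv_rmul, S.inv_lmul, _root_.inv_inv, S.lmul_rmul]

/-- The group element carried past `rep k` also translates the inverse of the new representative, up
to a right factor. Both sides of the cancellation condition are thus moved by the same element, so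
the action keeps lists reduced. -/
theorem cancel_iff (b : B) (k k' : S.Orbit) :
    S.orb (S.lmul (S.tail (S.lmul b (S.rep k))) (S.rep k')) =
      S.orb (S.inv (S.rep (S.orb (S.lmul b (S.rep k))))) ↔ k' = S.orb (S.inv (S.rep k)) := by
  rw [S.inv_rep_lmul, orb_rmul]
  constructor
  · intro h
    have := S.orb_lmul_inj h
    rwa [orb_rep] at this
  · rintro rfl
    rw [← orb_lmul]

theorem redList_actL {L : List S.Orbit} (h : S.RedList L) (b : B) : S.RedList (S.actL b L) := by
  induction L generalizing b with
  | nil => exact h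
  | cons k L ih =>
    cases L with
    | nil => exact List.isChain_singleton _
    | cons k' L =>
      rw [RedList, List.isChain_cons_cons] at h
      have h2 := ih h.2 (S.tail (S.lmul b (S.rep k)))
      simp only [actL] at h2 ⊢
      rw [RedList, List.isChain_cons_cons]
      exact ⟨fun h' => h.1 ((S.cancel_iff b k k').1 h'), h2⟩

/-- Normal forms. -/
abbrev NF : Type _ := {L : List S.Orbit // S.RedList L} × B

noncomputable instance : MulAction B S.NF where
  smul b x := (⟨S.actL b x.1.1, S.redList_actL x.1.2 b⟩, S.actT b x.1.1 * x.2)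
  one_smul x := by
    refine Prod.ext (Subtype.ext (S.actL_one _)) ?_
    change S.actT 1 _ * _ = _
    rw [actT_one, one_mul]
  mul_smul a b x := by
    refine Prod.ext (Subtype.ext (S.actL_mul _ _ _)) ?_
    change S.actT (a * b) _ * _ = S.actT a _ * (S.actT b _ * _)
    rw [actT_mul, mul_assoc]
    rfl

theorem smul_fst (b : B) (x : S.NF) : (b • x).1.1 = S.actL b x.1.1 := rfl

theorem smul_nil (b c : B) :
    b • ((⟨[], List.isChain_nil⟩, c) : S.NF) = (⟨[], List.isChain_nil⟩, b * c) := rfl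

theorem redList_smul_cons (b : B) (k : S.Orbit) (L : List S.Orbit) (h : S.RedList (k :: L))
    (c : B) : S.RedList (S.orb (S.lmul b (S.rep k)) ::
      (S.tail (S.lmul b (S.rep k)) • ((⟨L, h.tail⟩, c) : S.NF)).1.1) :=
  S.redList_actL h b

theorem smul_cons (b : B) (k : S.Orbit) (L : List S.Orbit) (h : S.RedList (k :: L)) (c : B) :
    b • ((⟨k :: L, h⟩, c) : S.NF) =
      (⟨S.orb (S.lmul b (S.rep k)) ::
          (S.tail (S.lmul b (S.rep k)) • ((⟨L, h.tail⟩, c) : S.NF)).1.1,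
        S.redList_smul_cons b k L h c⟩,
        (S.tail (S.lmul b (S.rep k)) • ((⟨L, h.tail⟩, c) : S.NF)).2) := rfl

/-! ### Multiplication of normal forms by elements of the biset. -/

open Classical in
/-- Multiplication of a normal form by the representative of an orbit. -/
noncomputable def push (k : S.Orbit) : S.NF → S.NF
  | (⟨[], _⟩, c) => (⟨[k], List.isChain_singleton _⟩, c)
  | (⟨k' :: L, h⟩, c) =>
    if hk : k' = S.orb (S.inv (S.rep k)) then
      (S.tail (S.inv (S.rep k)))⁻¹ • ((⟨L, h.tail⟩, c) : S.NF)
    else (⟨k :: k' :: L, List.isChain_cons_cons.2 ⟨hk, h⟩⟩, c)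

theorem push_nil (k : S.Orbit) (h : S.RedList []) (c : B) :
    S.push k (⟨[], h⟩, c) = (⟨[k], List.isChain_singleton _⟩, c) := rfl

theorem push_cancel (k : S.Orbit) (L : List S.Orbit) (c : B)
    (h : S.RedList (S.orb (S.inv (S.rep k)) :: L)) :
    S.push k (⟨S.orb (S.inv (S.rep k)) :: L, h⟩, c) =
      (S.tail (S.inv (S.rep k)))⁻¹ • ((⟨L, h.tail⟩, c) : S.NF) := by
  rw [push, dif_pos rfl]

theorem push_cons {k k' : S.Orbit} {L : List S.Orbit} {c : B} {h : S.RedList (k' :: L)}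
    (hk : k' ≠ S.orb (S.inv (S.rep k))) :
    S.push k (⟨k' :: L, h⟩, c) = (⟨k :: k' :: L, List.isChain_cons_cons.2 ⟨hk, h⟩⟩, c) := by
  rw [push, dif_neg hk]

/-- Multiplication of a normal form by an element of the biset. -/
noncomputable def mulNF (u : U) (x : S.NF) : S.NF := S.push (S.orb u) (S.tail u • x)

theorem mulNF_rmul (u : U) (b : B) (x : S.NF) : S.mulNF (S.rmul u b) x = S.mulNF u (b • x) := by
  rw [mulNF, mulNF, orb_rmul, tail_rmul, mul_smul]

theorem mulNF_lmul_rep (b : B) (k : S.Orbit) (x : S.NF) :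
    S.mulNF (S.lmul b (S.rep k)) x = b • S.push k x := by
  obtain ⟨⟨L, hL⟩, c⟩ := x
  cases L with
  | nil => rfl
  | cons k' L =>
    rw [mulNF, smul_cons]
    by_cases hk : k' = S.orb (S.inv (S.rep k))
    · subst hk
      rw [push_cancel, ← mul_smul]
      have h1 := (S.cancel_iff b k _).2 rfl
      have h2 : S.tail (S.lmul (S.tail (S.lmul b (S.rep k)))
          (S.rep (S.orb (S.inv (S.rep k))))) =
          S.tail (S.inv (S.rep (S.orb (S.lmul b (S.rep k))))) *
            (b * (S.tail (S.inv (S.rep k)))⁻¹) := by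
        rw [S.inv_rep_lmul, tail_rmul, S.tail_lmul _ (S.inv _)]
        group
      simp only [h1, h2]
      rw [push_cancel]
      refine (mul_smul _ _ ((⟨L, hL.tail⟩, c) : S.NF)).symm.trans ?_
      rw [inv_mul_cancel_left]
    · rw [S.push_cons hk, S.push_cons (fun h => hk ((S.cancel_iff b k k').1 h))]
      rfl

theorem mulNF_lmul (b : B) (u : U) (x : S.NF) : S.mulNF (S.lmul b u) x = b • S.mulNF u x := by
  rw [S.lmul_eq, mulNF_rmul, mulNF_lmul_rep]
  rfl

/-- With `m` the orbit and `s` the tail of `inv (rep k)`, the relation `rep k * rep m * s = 1`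
holds, so the two pushes should together act as `s⁻¹`. Since `inv (rep m) = s * rep k`, either the
second push undoes the first, or the first push cancels the head and the second restores it. -/
theorem push_push (k : S.Orbit) (x : S.NF) :
    S.push k (S.push (S.orb (S.inv (S.rep k))) x) = (S.tail (S.inv (S.rep k)))⁻¹ • x := by
  set s := S.tail (S.inv (S.rep k)) with hs
  set m := S.orb (S.inv (S.rep k)) with hm
  have hinv : S.inv (S.rep m) = S.lmul s (S.rep k) := by
    have h := S.rep_tail (S.inv (S.rep k))
    rw [← hs, ← hm] at h
    have h2 := congrArg S.inv h
    rw [S.inv_inv, S.inv_rmul] at h2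
    rw [← h2, ← S.mul_lmul, mul_inv_cancel, S.one_lmul]
  obtain ⟨⟨L, hL⟩, c⟩ := x
  cases L with
  | nil => rw [push_nil]; exact S.push_cancel k [] c _
  | cons k' L =>
    by_cases hk : k' = S.orb (S.inv (S.rep m))
    · subst hk
      rw [push_cancel]
      -- The head was removed by the push of `m`. The push of `k` puts it back without a further
      -- cancellation because the original list was reduced.
      have hsm : s⁻¹ • ((⟨S.orb (S.inv (S.rep m)) :: L, hL⟩, c) : S.NF) =
          S.push k ((S.tail (S.inv (S.rep m)))⁻¹ • ((⟨L, hL.tail⟩, c) : S.NF)) := by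
        have h1 : S.lmul s⁻¹ (S.rep (S.orb (S.inv (S.rep m)))) =
            S.rmul (S.rep k) (S.tail (S.inv (S.rep m)))⁻¹ := by
          rw [rep_orb, S.lmul_rmul, hinv, ← S.mul_lmul, inv_mul_cancel, S.one_lmul]
        rw [smul_cons]
        simp only [h1, orb_rmul, tail_rmul, orb_rep, tail_rep, one_mul]
        cases L with
        | nil => rfl
        | cons k'' L =>
          refine (S.push_cons ?_).symm
          · have h3 := (List.isChain_cons_cons.1 hL).1
            intro h4
            apply h3
            rw [← S.orb_rep k'']
            apply S.orb_lmul_inj (b := (S.tail (S.inv (S.rep m)))⁻¹)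
            rw [h4]
            conv_lhs => rw [← S.orb_rep k, ← S.orb_rmul (S.rep k) (S.tail (S.inv (S.rep m)))⁻¹]
            rw [← h1, S.inv_rep_lmul, h1, tail_rmul, tail_rep, one_mul, orb_rmul]
      rw [hsm]
    · rw [S.push_cons hk]
      exact S.push_cancel k (k' :: L) c _

theorem mulNF_inv (u : U) (x : S.NF) : S.mulNF u (S.mulNF (S.inv u) x) = x := by
  have h : S.inv u = S.lmul (S.tail u)⁻¹ (S.inv (S.rep (S.orb u))) := by
    conv_lhs => rw [← S.rep_tail u, S.inv_rmul]
  rw [h, mulNF_lmul]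
  conv_lhs => rw [mulNF]
  rw [← mul_smul, mul_inv_cancel, one_smul, mulNF, push_push, ← mul_smul, inv_mul_cancel,
    one_smul]

/-- The permutation of the normal forms given by an element of the biset. -/
noncomputable def perm (u : U) : Equiv.Perm S.NF where
  toFun := S.mulNF u
  invFun := S.mulNF (S.inv u)
  left_inv x := by
    have h := S.mulNF_inv (S.inv u) x
    rwa [S.inv_inv] at h
  right_inv x := S.mulNF_inv u x

noncomputable def permB : B →* Equiv.Perm S.NF := MulAction.toPermHom B S.NF

theorem perm_lmul (b : B) (u : U) : S.perm (S.lmul b u) = S.permB b * S.perm u :=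
  Equiv.ext (S.mulNF_lmul b u)

theorem perm_rmul (u : U) (b : B) : S.perm (S.rmul u b) = S.perm u * S.permB b :=
  Equiv.ext (S.mulNF_rmul u b)

theorem perm_mul_inv (u : U) : S.perm u * S.perm (S.inv u) = 1 :=
  Equiv.ext (S.mulNF_inv u)

/-- The trivial normal form. -/
def nfOne : S.NF := (⟨[], List.isChain_nil⟩, 1)

theorem permB_nfOne (b : B) : S.permB b S.nfOne = (⟨[], List.isChain_nil⟩, b) := by
  change b • S.nfOne = _
  rw [nfOne, smul_nil, mul_one]

theorem permB_injective : Function.Injective S.permB := by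
  intro a b h
  have := congrArg (fun σ : Equiv.Perm S.NF => (σ S.nfOne).2) h
  simpa [permB_nfOne] using this

theorem length_smul (b : B) (x : S.NF) : (b • x).1.1.length = x.1.1.length := by
  rw [smul_fst]
  generalize x.1.1 = L
  induction L generalizing b with
  | nil => rfl
  | cons k L ih => simp only [actL, List.length_cons] at ih ⊢; rw [ih]

/-- The element `St * b` of the permutation group, for a stack `St`. -/
noncomputable def stackPerm : List (B × U) → Equiv.Perm S.NF
  | [] => 1
  | (f, u) :: St => stackPerm St * (S.permB f * S.perm u)

/-- No two neighbouring elements of the stack cancel, up to elements of `B`. -/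
def RedStack (St : List (B × U)) : Prop :=
  St.IsChain fun p q => S.orb (S.lmul p.1 p.2) ≠ S.orb (S.inv q.2)

/-- Britton's lemma. If the head of `x` does not cancel against the top `(f, u)`, multiplication
puts the single orbit of `f * u` in front. The condition on the stack says exactly that this new
head does not cancel against the next entry, so the induction continues. -/
theorem length_stackPerm {St : List (B × U)} (h : S.RedStack St) (x : S.NF)
    (hx : ∀ p ∈ St.head?, ∀ k ∈ x.1.1.head?, k ≠ S.orb (S.inv p.2)) :
    (S.stackPerm St x).1.1.length = St.length + x.1.1.length := by
  induction St generalizing x with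
  | nil => simp [stackPerm]
  | cons p St ih =>
    obtain ⟨f, u⟩ := p
    have key : ((S.permB f * S.perm u) x).1.1.head? = some (S.orb (S.lmul f u)) ∧
        ((S.permB f * S.perm u) x).1.1.length = x.1.1.length + 1 := by
      rw [← perm_lmul]
      change (S.mulNF _ x).1.1.head? = _ ∧ (S.mulNF _ x).1.1.length = _
      obtain ⟨⟨L, hL⟩, c⟩ := x
      cases L with
      | nil => exact ⟨rfl, rfl⟩
      | cons k L =>
        have hk : k ≠ S.orb (S.inv u) := hx _ rfl _ rfl
        have hk2 : S.orb (S.lmul (S.tail (S.lmul f u)) (S.rep k)) ≠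
            S.orb (S.inv (S.rep (S.orb (S.lmul f u)))) := by
          rw [S.inv_rep_lmul, orb_rmul]
          intro h'
          have := S.orb_lmul_inj h'
          rw [orb_rep] at this
          exact hk this
        rw [mulNF, smul_cons, S.push_cons hk2]
        refine ⟨rfl, ?_⟩
        simp only [List.length_cons]
        rw [S.length_smul]
    rw [stackPerm, Equiv.Perm.mul_apply, ih h.tail, key.2, List.length_cons]
    · omega
    · intro q hq k hk
      rw [key.1, Option.mem_some_iff] at hk
      subst hk
      cases St with
      | nil => simp at hq
      | cons r St =>
        rw [List.head?_cons, Option.mem_some_iff] at hq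
        subst hq
        exact (List.isChain_cons_cons.1 h).1

theorem length_stackPerm_nfOne {St : List (B × U)} (h : S.RedStack St) (b : B) :
    ((S.stackPerm St * S.permB b) S.nfOne).1.1.length = St.length := by
  rw [Equiv.Perm.mul_apply, S.length_stackPerm h]
  · rw [permB_nfOne]; rfl
  · rw [permB_nfOne]; simp

end FreeBiset

/-! ## The groups generated by `G`-reduced words of bounded degree -/

section Tower

variable {G : Type*} [Group G] {Sig : Set G}

/-- The `G`-reduced words of degree at most `n`. -/
def Good (n : ℕ) (u : AWord (Letter Sig)) : Prop := IsGReduced u ∧ u.deg ≤ n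

theorem Good.left {n : ℕ} {x y : AWord (Letter Sig)} (h : Good n (x * y)) : Good n x :=
  ⟨h.1.left, (AWord.deg_of_mul_le h.2).1⟩

theorem Good.right {n : ℕ} {x y : AWord (Letter Sig)} (h : Good n (x * y)) : Good n y :=
  ⟨h.1.right, (AWord.deg_of_mul_le h.2).2⟩

theorem Good.bar {n : ℕ} {x : AWord (Letter Sig)} (h : Good n x) : Good n x.bar :=
  ⟨h.1.bar, h.2⟩

theorem good_one (n : ℕ) : Good n (1 : AWord (Letter Sig)) := ⟨isGReduced_one, by simp⟩

theorem Good.mono {m n : ℕ} (h : m ≤ n) {x : AWord (Letter Sig)} (hx : Good m x) : Good n x :=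
  ⟨hx.1, hx.2.trans (by exact_mod_cast h)⟩

/-- The defining relations `u * v = w`. -/
def WordRel (u v w : AWord (Letter Sig)) : Prop :=
  w = u * v ∨ (v = u.bar ∧ w = 1) ∨
    ∃ f g h : FreeMonoid (Letter Sig), u = AWord.ofFinite f ∧ v = AWord.ofFinite g ∧
      w = AWord.ofFinite h ∧ toGroup f * toGroup g = toGroup h

variable (Sig) in
def rels (n : ℕ) : Set (FreeGroup {u : AWord (Letter Sig) // Good n u}) :=
  {r | ∃ u v w, WordRel u.1 v.1 w.1 ∧ r = FreeGroup.of u * FreeGroup.of v * (FreeGroup.of w)⁻¹}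

variable (Sig) in
/-- The group generated by the `G`-reduced words of degree at most `n`. -/
abbrev E (n : ℕ) : Type _ := PresentedGroup (rels Sig n)

open Classical in
/-- The class of a word; it is trivial unless the word is `G`-reduced of degree at most `n`. -/
noncomputable def cl (n : ℕ) (u : AWord (Letter Sig)) : E Sig n :=
  if h : Good n u then PresentedGroup.of ⟨u, h⟩ else 1

theorem cl_rel {n : ℕ} {u v w : AWord (Letter Sig)} (hu : Good n u) (hv : Good n v)
    (hw : Good n w) (h : WordRel u v w) : cl n u * cl n v = cl n w := by
  rw [cl, cl, cl, dif_pos hu, dif_pos hv, dif_pos hw, ← mul_inv_eq_one]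
  have := PresentedGroup.one_of_mem (rels := rels Sig n)
    (x := FreeGroup.of ⟨u, hu⟩ * FreeGroup.of ⟨v, hv⟩ * (FreeGroup.of ⟨w, hw⟩)⁻¹)
    ⟨⟨u, hu⟩, ⟨v, hv⟩, ⟨w, hw⟩, h, rfl⟩
  rw [map_mul, map_mul, map_inv] at this
  exact this

theorem cl_mul {n : ℕ} {u v : AWord (Letter Sig)} (h : Good n (u * v)) :
    cl n (u * v) = cl n u * cl n v :=
  (cl_rel h.left h.right h (Or.inl rfl)).symm

@[simp] theorem cl_one (n : ℕ) : cl n (1 : AWord (Letter Sig)) = 1 := by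
  have := cl_mul (n := n) (u := (1 : AWord (Letter Sig))) (v := 1) (by
    rw [mul_one]; exact good_one n)
  rw [mul_one] at this
  exact left_eq_mul.1 this

theorem cl_mul_bar {n : ℕ} {u : AWord (Letter Sig)} (h : Good n u) :
    cl n u * cl n u.bar = 1 := by
  rw [cl_rel h h.bar (good_one n) (Or.inr (Or.inl ⟨rfl, rfl⟩)), cl_one]

theorem cl_bar {n : ℕ} {u : AWord (Letter Sig)} (h : Good n u) :
    cl n u.bar = (cl n u)⁻¹ :=
  eq_inv_of_mul_eq_one_right (cl_mul_bar h)

/-- The homomorphism defined by images of words that satisfy the relations. -/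
noncomputable def liftE {H : Type*} [Group H] (n : ℕ) (φ : AWord (Letter Sig) → H)
    (hφ : ∀ u v w, Good n u → Good n v → Good n w → WordRel u v w → φ u * φ v = φ w) :
    E Sig n →* H :=
  PresentedGroup.toGroup (f := fun u => φ u.1) (by
    rintro r ⟨u, v, w, h, rfl⟩
    simp [hφ _ _ _ u.2 v.2 w.2 h])

theorem liftE_cl {H : Type*} [Group H] (n : ℕ) (φ : AWord (Letter Sig) → H)
    (hφ : ∀ u v w, Good n u → Good n v → Good n w → WordRel u v w → φ u * φ v = φ w)
    {u : AWord (Letter Sig)} (hu : Good n u) : liftE n φ hφ (cl n u) = φ u := by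
  rw [cl, dif_pos hu]
  exact PresentedGroup.toGroup.of _

theorem exists_list_eq {n : ℕ} (g : E Sig n) :
    ∃ L : List (AWord (Letter Sig)), (∀ u ∈ L, Good n u) ∧ (L.map (cl n)).prod = g := by
  have hg : g ∈ Subgroup.closure (Set.range (PresentedGroup.of (rels := rels Sig n))) := by
    rw [PresentedGroup.closure_range_of]; trivial
  induction hg using Subgroup.closure_induction with
  | mem x hx =>
    obtain ⟨u, rfl⟩ := hx
    exact ⟨[u.1], by simpa using u.2, by simp [cl, u.2]⟩
  | one => exact ⟨[], by simp, rfl⟩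
  | mul x y _ _ hx hy =>
    obtain ⟨L, hL, rfl⟩ := hx
    obtain ⟨M, hM, rfl⟩ := hy
    refine ⟨L ++ M, ?_, by simp⟩
    intro u hu
    rcases List.mem_append.1 hu with hu | hu
    exacts [hL u hu, hM u hu]
  | inv x _ hx =>
    obtain ⟨L, hL, rfl⟩ := hx
    refine ⟨(L.map AWord.bar).reverse, ?_, ?_⟩
    · intro u hu
      simp only [List.mem_reverse, List.mem_map] at hu
      obtain ⟨v, hv, rfl⟩ := hu
      exact (hL v hv).bar
    · clear * - hL
      induction L with
      | nil => simp
      | cons a L ih =>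
        simp only [List.mem_cons, forall_eq_or_imp] at hL
        have := ih hL.2
        simp only [List.map_cons, List.reverse_cons, List.map_append, List.prod_append,
          List.prod_cons, mul_inv_rev] at this ⊢
        rw [this, List.map_nil, List.prod_nil, mul_one, cl_bar hL.1]

/-- The canonical homomorphism from words of degree at most `m` to words of degree at most `n`,
for `m ≤ n`. -/
noncomputable def upTo {m n : ℕ} (h : m ≤ n) : E Sig m →* E Sig n :=
  liftE m (cl n) fun _ _ _ hu hv hw => cl_rel (hu.mono h) (hv.mono h) (hw.mono h)

theorem upTo_cl {m n : ℕ} (h : m ≤ n) {u : AWord (Letter Sig)} (hu : Good m u) :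
    upTo h (cl m u) = cl n u :=
  liftE_cl _ _ _ hu

theorem hom_ext {H : Type*} [Group H] {n : ℕ} {f g : E Sig n →* H}
    (h : ∀ u, Good n u → f (cl n u) = g (cl n u)) : f = g := by
  refine PresentedGroup.ext fun u => ?_
  have := h u.1 u.2
  rwa [cl, dif_pos u.2] at this

theorem upTo_upTo {l m n : ℕ} (h : l ≤ m) (h' : m ≤ n) (g : E Sig l) :
    upTo h' (upTo h g) = upTo (h.trans h') g := by
  have : (upTo h').comp (upTo h) = upTo (Sig := Sig) (h.trans h') :=
    hom_ext fun u hu => by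
      rw [MonoidHom.comp_apply, upTo_cl h hu, upTo_cl h' (hu.mono h), upTo_cl _ hu]
  exact DFunLike.congr_fun this g

theorem upTo_refl {n : ℕ} (g : E Sig n) : upTo le_rfl g = g := by
  have : upTo (Sig := Sig) (le_refl n) = MonoidHom.id _ :=
    hom_ext fun u hu => by rw [upTo_cl _ hu]; rfl
  exact DFunLike.congr_fun this g

/-! ### Degree zero -/

theorem good_zero_iff {u : AWord (Letter Sig)} :
    Good 0 u ↔ ∃ f, u = AWord.ofFinite f ∧ IsGReduced (AWord.ofFinite f) := by
  constructor
  · rintro ⟨h1, h2⟩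
    obtain ⟨f, rfl⟩ := AWord.deg_le_zero_iff.1 h2
    exact ⟨f, rfl, h1⟩
  · rintro ⟨f, rfl, h⟩
    exact ⟨h, AWord.deg_le_zero_iff.2 ⟨f, rfl⟩⟩

open Classical in
/-- The value in `G` of a finite word. -/
noncomputable def finValue (u : AWord (Letter Sig)) : G :=
  if h : ∃ f, u = AWord.ofFinite f then toGroup h.choose else 1

@[simp] theorem finValue_ofFinite (f : FreeMonoid (Letter Sig)) :
    finValue (AWord.ofFinite f) = toGroup f := by
  have h : ∃ g, AWord.ofFinite f = AWord.ofFinite g := ⟨f, rfl⟩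
  rw [finValue, dif_pos h, ← AWord.ofFinite_injective h.choose_spec]

variable (Sig) in
noncomputable def zeroToG : E Sig 0 →* G :=
  liftE 0 finValue (by
    intro u v w hu hv hw h
    obtain ⟨f, rfl, -⟩ := good_zero_iff.1 hu
    obtain ⟨g, rfl, -⟩ := good_zero_iff.1 hv
    obtain ⟨k, rfl, -⟩ := good_zero_iff.1 hw
    simp only [finValue_ofFinite]
    rcases h with h | ⟨h1, h2⟩ | ⟨f', g', k', h1, h2, h3, h4⟩
    · rw [← map_mul] at h
      rw [AWord.ofFinite_injective h, map_mul]
    · rw [bar_ofFinite] at h1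
      rw [AWord.ofFinite_injective h1, AWord.ofFinite_injective (h2.trans (map_one _).symm),
        toGroup_barFinite, map_one, mul_inv_cancel]
    · rw [AWord.ofFinite_injective h1, AWord.ofFinite_injective h2, AWord.ofFinite_injective h3,
        h4])

theorem zeroToG_cl {f : FreeMonoid (Letter Sig)} (h : IsGReduced (AWord.ofFinite f)) :
    zeroToG Sig (cl 0 (AWord.ofFinite f)) = toGroup f := by
  rw [zeroToG, liftE_cl _ _ _ (good_zero_iff.2 ⟨f, rfl, h⟩), finValue_ofFinite]

/-- The relations taken from `G` merge any two finite reduced words into a single one, so `E 0`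
contains nothing but classes of words. -/
theorem exists_eq_cl_zero (hgen : Subgroup.closure Sig = ⊤) (g : E Sig 0) :
    ∃ f : FreeMonoid (Letter Sig), IsGReduced (AWord.ofFinite f) ∧
      g = cl 0 (AWord.ofFinite f) := by
  obtain ⟨L, hL, rfl⟩ := exists_list_eq g
  induction L with
  | nil => exact ⟨1, by rw [map_one]; exact isGReduced_one, by simp⟩
  | cons u L ih =>
    simp only [List.mem_cons, forall_eq_or_imp] at hL
    obtain ⟨f, hf, h1⟩ := ih hL.2
    obtain ⟨e, rfl, he⟩ := good_zero_iff.1 hL.1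
    obtain ⟨k, hk, h2⟩ := exists_isGReduced_toGroup_eq hgen (toGroup e * toGroup f)
    refine ⟨k, hk, ?_⟩
    rw [List.map_cons, List.prod_cons, h1]
    exact cl_rel (good_zero_iff.2 ⟨_, rfl, he⟩) (good_zero_iff.2 ⟨_, rfl, hf⟩)
      (good_zero_iff.2 ⟨_, rfl, hk⟩) (Or.inr (Or.inr ⟨e, f, k, rfl, rfl, rfl, h2.symm⟩))

theorem zeroToG_injective (hgen : Subgroup.closure Sig = ⊤) :
    Function.Injective (zeroToG Sig) := by
  rw [injective_iff_map_eq_one]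
  intro g hg
  obtain ⟨f, hf, rfl⟩ := exists_eq_cl_zero hgen g
  rw [zeroToG_cl hf] at hg
  rw [hf 1 1 f (by simp) hg]
  simp

/-- No nonempty `G`-reduced word of degree at most `n` is trivial. -/
def Faithful (Sig : Set G) (n : ℕ) : Prop :=
  ∀ u : AWord (Letter Sig), Good n u → cl n u = 1 → u = 1

theorem faithful_zero : Faithful Sig 0 := by
  intro u hu h
  obtain ⟨f, rfl, hf⟩ := good_zero_iff.1 hu
  have h2 := congrArg (zeroToG Sig) h
  rw [zeroToG_cl hf, map_one] at h2
  rw [hf 1 1 f (by simp) h2]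
  simp

/-! ### Words with leading coefficient one -/

/-- The coefficient of `t ^ (n + 1)` in the length of a word. -/
noncomputable def lc (n : ℕ) (u : AWord (Letter Sig)) : ℤ := u.len.coeff (n + 1)

theorem lc_mul (n : ℕ) (x y : AWord (Letter Sig)) : lc n (x * y) = lc n x + lc n y := by
  simp [lc]

theorem lc_nonneg {n : ℕ} {x : AWord (Letter Sig)} (h : x.deg ≤ (n + 1 : ℕ)) : 0 ≤ lc n x :=
  AWord.coeff_len_nonneg h

theorem lc_eq_zero {n : ℕ} {x : AWord (Letter Sig)} (h : x.deg ≤ n) : lc n x = 0 :=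
  coeff_eq_zero_of_degree_le h

theorem deg_le_of_lc_eq_zero {n : ℕ} {x : AWord (Letter Sig)} (h : x.deg ≤ (n + 1 : ℕ))
    (h0 : lc n x = 0) : x.deg ≤ n :=
  degree_le_of_coeff_eq_zero h h0

theorem len_le_of_lc_pos {n : ℕ} {x y : AWord (Letter Sig)} (hx : x.deg ≤ n)
    (hy : y.deg ≤ (n + 1 : ℕ)) (h : 0 < lc n y) : x.len ≤ y.len :=
  le_of_coeff_pos hx hy h

@[simp] theorem lc_bar (n : ℕ) (x : AWord (Letter Sig)) : lc n x.bar = lc n x := rfl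

/-- The `G`-reduced words of degree `n + 1` with leading coefficient one. -/
def Lead (n : ℕ) (u : AWord (Letter Sig)) : Prop := Good (n + 1) u ∧ lc n u = 1

theorem Lead.bar {n : ℕ} {u : AWord (Letter Sig)} (h : Lead n u) : Lead n u.bar :=
  ⟨h.1.bar, h.2⟩

/-- Leading coefficients are nonnegative and additive. A core that uses up the whole coefficient
leaves only degree `n` on both sides. -/
theorem Lead.outer {n : ℕ} {x w y : AWord (Letter Sig)} (h : Lead n (x * w * y))
    (hw : lc n w = 1) : Good n x ∧ Lead n w ∧ Good n y := by
  have hx := h.1.left.left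
  have hy := h.1.right
  have h1 := h.2
  rw [lc_mul, lc_mul, hw] at h1
  have h2 := lc_nonneg hx.2
  have h3 := lc_nonneg hy.2
  exact ⟨⟨hx.1, deg_le_of_lc_eq_zero hx.2 (by omega)⟩, ⟨h.1.left.right, hw⟩,
    ⟨hy.1, deg_le_of_lc_eq_zero hy.2 (by omega)⟩⟩

theorem exists_prefix {n : ℕ} {x w q z : AWord (Letter Sig)} (hw : Lead n w) (hx : x.deg ≤ n)
    (h : w * q = x * z) : ∃ v, w = x * v ∧ z = v * q ∧ lc n v = 1 := by
  obtain ⟨v, rfl, h2⟩ := AWord.levi h.symm (len_le_of_lc_pos hx hw.1.2 (by rw [hw.2]; decide))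
  refine ⟨v, rfl, h2, ?_⟩
  have := hw.2
  rwa [lc_mul, lc_eq_zero hx, zero_add] at this

theorem exists_suffix {n : ℕ} {x w q z : AWord (Letter Sig)} (hw : Lead n w) (hx : x.deg ≤ n)
    (h : q * w = z * x) : ∃ v, w = v * x ∧ z = q * v ∧ lc n v = 1 := by
  obtain ⟨v, rfl, h2⟩ :=
    AWord.levi_right h.symm (len_le_of_lc_pos hx hw.1.2 (by rw [hw.2]; decide))
  refine ⟨v, rfl, h2, ?_⟩
  have := hw.2
  rwa [lc_mul, lc_eq_zero hx, add_zero] at this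

/-- Two cores of the same word have a common core. -/
theorem exists_common_core {n : ℕ} {x w y x' w' y' : AWord (Letter Sig)}
    (h : Lead n (x * w * y)) (hw : lc n w = 1) (hw' : lc n w' = 1)
    (he : x * w * y = x' * w' * y') :
    ∃ p q p' q' v, w = p * v * q ∧ w' = p' * v * q' ∧ x * p = x' * p' ∧ q * y = q' * y' ∧
      lc n v = 1 := by
  have h' := he ▸ h
  -- The left ends are aligned first and the right ends afterwards. Only words of degree at most `n`
  -- are cut off, so the intersection of the cores keeps leading coefficient one.
  have key : ∃ p p' v v', w = p * v ∧ w' = p' * v' ∧ x * p = x' * p' ∧ v * y = v' * y' ∧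
      lc n v = 1 ∧ lc n v' = 1 := by
    obtain ⟨hx, hW, hy⟩ := h.outer hw
    obtain ⟨hx', hW', hy'⟩ := h'.outer hw'
    rw [mul_assoc, mul_assoc] at he
    rcases le_total x.len x'.len with hl | hl
    · obtain ⟨z, rfl, h2⟩ := AWord.levi he hl
      obtain ⟨v, rfl, h3, h4⟩ := exists_prefix hW hx'.right.2 h2
      exact ⟨z, 1, v, w', rfl, (one_mul _).symm, (mul_one _).symm, h3.symm, h4, hw'⟩
    · obtain ⟨z, rfl, h2⟩ := AWord.levi he.symm hl
      obtain ⟨v, rfl, h3, h4⟩ := exists_prefix hW' hx.right.2 h2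
      exact ⟨1, z, w, v, (one_mul _).symm, rfl, mul_one _, h3, hw, h4⟩
  obtain ⟨p, p', v, v', rfl, rfl, h1, h2, hv, hv'⟩ := key
  obtain ⟨hx, hW, hy⟩ := Lead.outer (x := x * p) (w := v) (y := y)
    (by simpa only [mul_assoc] using h) hv
  obtain ⟨hx', hW', hy'⟩ := Lead.outer (x := x' * p') (w := v') (y := y')
    (by simpa only [mul_assoc] using h') hv'
  rcases le_total y.len y'.len with hl | hl
  · obtain ⟨z, rfl, rfl⟩ := AWord.levi_right h2 hl
    exact ⟨p, z, p', 1, v', by simp [mul_assoc], by simp, h1, by simp, hv'⟩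
  · obtain ⟨z, rfl, rfl⟩ := AWord.levi_right h2.symm hl
    exact ⟨p, 1, p', z, v, by simp, by simp [mul_assoc], h1, by simp, hv⟩

/-- A `G`-reduced word of degree at most `n + 1` is cut into pieces with leading coefficient one
and a rest of smaller degree. -/
theorem exists_lead_factorization {n : ℕ} {u : AWord (Letter Sig)} (hu : Good (n + 1) u) :
    ∃ (L : List (AWord (Letter Sig))) (y : AWord (Letter Sig)), (∀ x ∈ L, Lead n x) ∧
      Good n y ∧ u = L.prod * y ∧ (L.length : ℤ) = lc n u := by
  obtain ⟨k, hk⟩ := Int.eq_ofNat_of_zero_le (lc_nonneg hu.2)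
  induction k generalizing u with
  | zero =>
    exact ⟨[], u, by simp, ⟨hu.1, deg_le_of_lc_eq_zero hu.2 (by simpa using hk)⟩, by simp,
      by simp [hk]⟩
  | succ k ih =>
    -- With leading coefficient one the whole word is taken as a piece: it may be shorter than `t ^
    -- (n + 1)`, so no prefix of that length need exist.
    rcases Nat.eq_zero_or_pos k with rfl | hpos
    · exact ⟨[u], 1, by simpa using ⟨hu, hk⟩, good_one n, by simp, by simp [hk]⟩
    · have hX : (0 : ℤ[X]) ≤ X ^ (n + 1) := by
        right; simp
      have hle : X ^ (n + 1) ≤ u.len := by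
        rw [← sub_nonneg]
        refine le_of_coeff_pos (n := n) (by simp) ?_ ?_
        · refine (degree_sub_le _ _).trans (max_le hu.2 ?_)
          rw [degree_X_pow]
        · rw [coeff_sub, coeff_X_pow, if_pos rfl]
          change 0 < lc n u - 1
          rw [hk]
          push_cast
          omega
      obtain ⟨x, v, rfl, hx⟩ := u.exists_mul_eq hX hle
      have hlx : lc n x = 1 := by rw [lc, hx]; simp
      have hlv : lc n v = k := by
        rw [lc_mul, hlx] at hk
        push_cast at hk
        omega
      obtain ⟨L, y, h1, h2, rfl, h4⟩ := ih hu.right hlv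
      refine ⟨x :: L, y, ?_, h2, by simp [mul_assoc], ?_⟩
      · simpa using ⟨⟨hu.left, hlx⟩, h1⟩
      · rw [lc_mul, hlx, ← h4]
        simp [add_comm]

/-! ### The biset of words with leading coefficient one -/

variable (Sig) in
abbrev PreBiset (n : ℕ) : Type _ := E Sig n × {u : AWord (Letter Sig) // Lead n u} × E Sig n

/-- Two triples are equivalent if they have a common core. -/
def CoreRel (n : ℕ) (p q : PreBiset Sig n) : Prop :=
  ∃ x w y x' y', p.2.1.1 = x * w * y ∧ q.2.1.1 = x' * w * y' ∧ lc n w = 1 ∧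
    p.1 * cl n x = q.1 * cl n x' ∧ cl n y * p.2.2 = cl n y' * q.2.2

theorem coreRel_refl (n : ℕ) (p : PreBiset Sig n) : CoreRel n p p :=
  ⟨1, p.2.1.1, 1, 1, 1, by simp, by simp, p.2.1.2.2, rfl, rfl⟩

theorem CoreRel.symm {n : ℕ} {p q : PreBiset Sig n} (h : CoreRel n p q) : CoreRel n q p := by
  obtain ⟨x, w, y, x', y', h1, h2, h3, h4, h5⟩ := h
  exact ⟨x', w, y', x, y, h2, h1, h3, h4.symm, h5.symm⟩

/-- The middle word carries two cores. Both relations can be restricted to the common core, and the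
parts cut off are absorbed into the group elements. -/
theorem CoreRel.trans {n : ℕ} {p q r : PreBiset Sig n} (h : CoreRel n p q)
    (h' : CoreRel n q r) : CoreRel n p r := by
  obtain ⟨x, w, y, x', y', h1, h2, h3, h4, h5⟩ := h
  obtain ⟨x₂, w₂, y₂, x₃, y₃, k1, k2, k3, k4, k5⟩ := h'
  have hq := q.2.1.2
  rw [h2] at hq
  obtain ⟨a, b, a', b', v, rfl, rfl, e1, e2, hv⟩ := exists_common_core hq h3 k3 (h2.symm.trans k1)
  have hp := p.2.1.2
  have hr := r.2.1.2
  have hq' := q.2.1.2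
  rw [h1] at hp
  rw [k2] at hr
  rw [k1] at hq'
  have hp2 : Lead n (x * a * v * (b * y)) := by simpa only [mul_assoc] using hp
  have hr2 : Lead n (x₃ * a' * v * (b' * y₃)) := by simpa only [mul_assoc] using hr
  have hq2 : Lead n (x' * a * v * (b * y')) := by simpa only [mul_assoc] using hq
  have hq2' : Lead n (x₂ * a' * v * (b' * y₂)) := by simpa only [mul_assoc] using hq'
  refine ⟨x * a, v, b * y, x₃ * a', b' * y₃, by rw [h1]; simp only [mul_assoc],
    by rw [k2]; simp only [mul_assoc], hv, ?_, ?_⟩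
  · rw [cl_mul (hp2.outer hv).1, cl_mul (hr2.outer hv).1, ← mul_assoc, h4, mul_assoc,
      ← cl_mul (hq2.outer hv).1, e1, cl_mul (hq2'.outer hv).1, ← mul_assoc, k4, mul_assoc]
  · rw [cl_mul (hp2.outer hv).2.2, cl_mul (hr2.outer hv).2.2, mul_assoc, h5, ← mul_assoc,
      ← cl_mul (hq2.outer hv).2.2, e2, cl_mul (hq2'.outer hv).2.2, mul_assoc, k5, mul_assoc]

def coreSetoid (n : ℕ) : Setoid (PreBiset Sig n) where
  r := CoreRel n
  iseqv := ⟨coreRel_refl n, CoreRel.symm, CoreRel.trans⟩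

variable (Sig) in
def WBiset (n : ℕ) : Type _ := Quotient (coreSetoid (Sig := Sig) n)

/-- Two prefixes of the same word with the same class differ by a reduced word of trivial class,
which faithfulness makes empty. The two decompositions then coincide, which leaves `c * e = c`. -/
theorem coreRel_free {n : ℕ} (hF : Faithful Sig n) {b c e : E Sig n}
    {u : {u : AWord (Letter Sig) // Lead n u}} (h : CoreRel n (b, u, c * e) (b, u, c)) :
    e = 1 := by
  obtain ⟨x, w, y, x', y', h1, h2, h3, h4, h5⟩ := h
  dsimp only at h1 h2 h4 h5
  have hu := u.2
  have hu' := u.2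
  rw [h1] at hu
  rw [h2] at hu'
  have h4 := mul_left_cancel h4
  have he := h1.symm.trans h2
  have key : ∀ {x x' : AWord (Letter Sig)} {q q' : AWord (Letter Sig)}, x * q = x' * q' →
      Good n x' → cl n x = cl n x' → x.len ≤ x'.len → x = x' := by
    intro x x' q q' he hx hcl hle
    obtain ⟨z, rfl, -⟩ := AWord.levi he hle
    rw [cl_mul hx] at hcl
    rw [hF z hx.right (left_eq_mul.1 hcl), mul_one]
  have hxx : x = x' := by
    rw [mul_assoc, mul_assoc] at he
    rcases le_total x.len x'.len with hl | hl
    · exact key he (hu'.outer h3).1 h4 hl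
    · exact (key he.symm (hu.outer h3).1 h4.symm hl).symm
  subst hxx
  have hyy := AWord.mul_left_cancel' he
  subst hyy
  have h6 : c * e = c := mul_left_cancel h5
  exact mul_eq_left.1 h6

/-- The biset formed by the words of degree `n + 1` with leading coefficient one. -/
noncomputable def biset {n : ℕ} (hF : Faithful Sig n) : FreeBiset (E Sig n) (WBiset Sig n) where
  lmul a := Quotient.map (fun p => (a * p.1, p.2)) (by
    rintro p q ⟨x, w, y, x', y', h1, h2, h3, h4, h5⟩
    exact ⟨x, w, y, x', y', h1, h2, h3, by simp only [mul_assoc, h4], h5⟩)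
  rmul := fun u a => Quotient.map (fun p => (p.1, p.2.1, p.2.2 * a)) (by
    rintro p q ⟨x, w, y, x', y', h1, h2, h3, h4, h5⟩
    exact ⟨x, w, y, x', y', h1, h2, h3, h4, by simp only [← mul_assoc, h5]⟩) u
  inv := Quotient.map (fun p => (p.2.2⁻¹, ⟨p.2.1.1.bar, p.2.1.2.bar⟩, p.1⁻¹)) (by
    rintro p q ⟨x, w, y, x', y', h1, h2, h3, h4, h5⟩
    have hp := p.2.1.2
    have hq := q.2.1.2
    rw [h1] at hp
    rw [h2] at hq
    refine ⟨y.bar, w.bar, x.bar, y'.bar, x'.bar, by simp [h1, mul_assoc],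
      by simp [h2, mul_assoc], h3, ?_, ?_⟩
    · rw [cl_bar (hp.outer h3).2.2, cl_bar (hq.outer h3).2.2, ← mul_inv_rev, ← mul_inv_rev, h5]
    · rw [cl_bar (hp.outer h3).1, cl_bar (hq.outer h3).1, ← mul_inv_rev, ← mul_inv_rev, h4])
  one_lmul := by rintro ⟨p⟩; exact congrArg (Quotient.mk _) (by simp)
  mul_lmul := by rintro a b ⟨p⟩; exact congrArg (Quotient.mk _) (by simp [mul_assoc])
  rmul_one := by rintro ⟨p⟩; exact congrArg (Quotient.mk _) (by simp)
  rmul_mul := by rintro ⟨p⟩ a b; exact congrArg (Quotient.mk _) (by simp [mul_assoc])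
  lmul_rmul := by rintro a ⟨p⟩ b; rfl
  inv_inv := by rintro ⟨p⟩; exact congrArg (Quotient.mk _) (by simp)
  inv_lmul := by rintro b ⟨p⟩; exact congrArg (Quotient.mk _) (by simp)
  free := by
    rintro ⟨⟨b, u, c⟩⟩ e h
    exact coreRel_free hF (Quotient.exact h)

/-- The element of the biset given by a word. -/
def wcl {n : ℕ} (u : AWord (Letter Sig)) (h : Lead n u) : WBiset Sig n :=
  Quotient.mk (coreSetoid n) (1, ⟨u, h⟩, 1)

theorem inv_wcl {n : ℕ} (hF : Faithful Sig n) {u : AWord (Letter Sig)} (h : Lead n u) :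
    (biset hF).inv (wcl u h) = wcl u.bar h.bar :=
  congrArg (Quotient.mk _) (by simp)

theorem wcl_mul_left {n : ℕ} (hF : Faithful Sig n) {x y : AWord (Letter Sig)}
    (h : Lead n (x * y)) (hy : Lead n y) :
    wcl (x * y) h = (biset hF).lmul (cl n x) (wcl y hy) := by
  refine Quotient.sound ⟨x, y, 1, 1, 1, by simp, by simp, hy.2, by simp, by simp⟩

theorem wcl_mul_right {n : ℕ} (hF : Faithful Sig n) {x y : AWord (Letter Sig)}
    (h : Lead n (x * y)) (hx : Lead n x) :
    wcl (x * y) h = (biset hF).rmul (wcl x hx) (cl n y) := by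
  refine Quotient.sound ⟨1, x, y, 1, 1, by simp, by simp, hx.2, by simp, by simp⟩

/-- A cancellation of the words `u` and `v` with the group element `f` in between. -/
def Pinch (n : ℕ) (u : AWord (Letter Sig)) (f : E Sig n) (v : AWord (Letter Sig)) : Prop :=
  ∃ a w x x' y, u = a * w.bar * x ∧ v = x' * w * y ∧ lc n w = 1 ∧ cl n x * f * cl n x' = 1

theorem orb_eq_iff_pinch {n : ℕ} (hF : Faithful Sig n) {u v : AWord (Letter Sig)}
    (hu : Lead n u) (hv : Lead n v) (f : E Sig n) :
    (biset hF).orb ((biset hF).lmul f (wcl v hv)) = (biset hF).orb ((biset hF).inv (wcl u hu)) ↔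
      Pinch n u f v := by
  rw [inv_wcl, eq_comm, FreeBiset.orb_eq_iff]
  constructor
  · rintro ⟨e, he⟩
    obtain ⟨x, w, y, x', y', h1, h2, h3, h4, h5⟩ := Quotient.exact he
    dsimp only at h1 h2 h4 h5
    refine ⟨y'.bar, w, x'.bar, x, y, ?_, h1, h3, ?_⟩
    · rw [← AWord.bar_bar u, h2]; simp [mul_assoc]
    · have hu' := hu.bar
      rw [h2] at hu'
      rw [cl_bar (hu'.outer h3).1, mul_assoc]
      simp only [mul_one, one_mul] at h4
      rw [h4, inv_mul_cancel]
  · rintro ⟨a, w, x, x', y, rfl, rfl, h3, h4⟩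
    have ha := hu.outer h3
    have hb := hv.outer h3
    refine ⟨(cl n a.bar)⁻¹ * cl n y,
      Quotient.sound ⟨x', w, y, x.bar, a.bar, rfl, by simp [mul_assoc], h3, ?_, ?_⟩⟩
    · rw [cl_bar ha.2.2, one_mul, eq_inv_iff_mul_eq_one]
      simp only [mul_one]
      rw [mul_assoc] at h4
      exact mul_eq_one_comm.1 h4
    · simp

end Tower

section Representation

variable {G : Type*} [Group G] {Sig : Set G}

/-! ### The action of `E (n + 1)` on normal forms -/

section

variable {n : ℕ} (hF : Faithful Sig n)

/-- `G`-reduced words of degree at most `n + 1` with leading coefficient at most one. -/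
def Piece (n : ℕ) (u : AWord (Letter Sig)) : Prop := Good (n + 1) u ∧ lc n u ≤ 1

theorem Piece.left {x y : AWord (Letter Sig)} (h : Piece n (x * y)) : Piece n x :=
  ⟨h.1.left, by have := h.2; rw [lc_mul] at this; have := lc_nonneg h.1.right.2; omega⟩

theorem Piece.right {x y : AWord (Letter Sig)} (h : Piece n (x * y)) : Piece n y :=
  ⟨h.1.right, by have := h.2; rw [lc_mul] at this; have := lc_nonneg h.1.left.2; omega⟩

theorem Lead.piece {u : AWord (Letter Sig)} (h : Lead n u) : Piece n u := ⟨h.1, h.2.le⟩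

theorem Good.piece {u : AWord (Letter Sig)} (h : Good n u) : Piece n u :=
  ⟨h.mono n.le_succ, by rw [lc_eq_zero h.2]; decide⟩

theorem Piece.good_or_lead {u : AWord (Letter Sig)} (h : Piece n u) : Good n u ∨ Lead n u := by
  have h1 := lc_nonneg h.1.2
  have h2 := h.2
  rcases (by omega : lc n u = 0 ∨ lc n u = 1) with h3 | h3
  · exact Or.inl ⟨h.1.1, deg_le_of_lc_eq_zero h.1.2 h3⟩
  · exact Or.inr ⟨h.1, h3⟩

theorem not_lead_of_good {u : AWord (Letter Sig)} (h : Good n u) : ¬ Lead n u := fun h' => by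
  have := h'.2
  rw [lc_eq_zero h.2] at this
  exact absurd this (by decide)

open Classical in
noncomputable def piecePerm (u : AWord (Letter Sig)) : Equiv.Perm (biset hF).NF :=
  if h : Lead n u then (biset hF).perm (wcl u h) else (biset hF).permB (cl n u)

theorem piecePerm_lead {u : AWord (Letter Sig)} (h : Lead n u) :
    piecePerm hF u = (biset hF).perm (wcl u h) := dif_pos h

theorem piecePerm_good {u : AWord (Letter Sig)} (h : Good n u) :
    piecePerm hF u = (biset hF).permB (cl n u) := dif_neg (not_lead_of_good h)

theorem piecePerm_one : piecePerm hF 1 = 1 := by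
  rw [piecePerm_good hF (good_one n), cl_one, map_one]

/-- At most one factor can have leading coefficient one. The mixed cases are the left and right
actions on the biset. -/
theorem piecePerm_mul (x y : AWord (Letter Sig)) (h : Piece n (x * y)) :
    piecePerm hF (x * y) = piecePerm hF x * piecePerm hF y := by
  rcases h.left.good_or_lead with hx | hx <;> rcases h.right.good_or_lead with hy | hy
  · have hxy : Good n (x * y) := ⟨h.1.1, AWord.deg_mul_le hx.2 hy.2⟩
    rw [piecePerm_good hF hx, piecePerm_good hF hy, piecePerm_good hF hxy, cl_mul hxy, map_mul]
  · have hxy : Lead n (x * y) := ⟨h.1, by rw [lc_mul, lc_eq_zero hx.2, hy.2, zero_add]⟩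
    rw [piecePerm_good hF hx, piecePerm_lead hF hy, piecePerm_lead hF hxy,
      wcl_mul_left hF hxy hy, FreeBiset.perm_lmul]
  · have hxy : Lead n (x * y) := ⟨h.1, by rw [lc_mul, lc_eq_zero hy.2, hx.2, add_zero]⟩
    rw [piecePerm_lead hF hx, piecePerm_good hF hy, piecePerm_lead hF hxy,
      wcl_mul_right hF hxy hx, FreeBiset.perm_rmul]
  · have := h.2
    rw [lc_mul, hx.2, hy.2] at this
    exact absurd this (by decide)

theorem piecePerm_bar {x : AWord (Letter Sig)} (h : Piece n x) :
    piecePerm hF x.bar = (piecePerm hF x)⁻¹ := by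
  rcases h.good_or_lead with h | h
  · rw [piecePerm_good hF h, piecePerm_good hF h.bar, cl_bar h, map_inv]
  · rw [piecePerm_lead hF h, piecePerm_lead hF h.bar, ← inv_wcl hF h]
    exact eq_inv_of_mul_eq_one_right (FreeBiset.perm_mul_inv _ _)

theorem exists_piece_factorization {u : AWord (Letter Sig)} (hu : Good (n + 1) u) :
    ∃ L : List (AWord (Letter Sig)), (∀ x ∈ L, Piece n x) ∧ L.prod = u := by
  obtain ⟨L, y, h1, h2, rfl, -⟩ := exists_lead_factorization hu
  refine ⟨L ++ [y], ?_, by simp⟩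
  intro x hx
  rcases List.mem_append.1 hx with hx | hx
  · exact (h1 x hx).piece
  · rw [List.mem_singleton] at hx
    exact hx ▸ h2.piece

open Classical in
noncomputable def wordPerm (u : AWord (Letter Sig)) : Equiv.Perm (biset hF).NF :=
  if h : Good (n + 1) u then
    ((exists_piece_factorization h).choose.map (piecePerm hF)).prod else 1

/-- Two factorizations into pieces are compared by cutting the longer first factor, and `piecePerm`
is multiplicative on pieces. The chosen factorization is therefore irrelevant. -/
theorem wordPerm_eq {u : AWord (Letter Sig)} (hu : Good (n + 1) u) {L : List (AWord (Letter Sig))}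
    (hL : ∀ x ∈ L, Piece n x) (h : L.prod = u) :
    wordPerm hF u = (L.map (piecePerm hF)).prod := by
  rw [wordPerm, dif_pos hu]
  have hs := (exists_piece_factorization hu).choose_spec
  exact AWord.map_prod_eq_of_prod_eq (C := Piece n) (fun _ _ h => h.right) _ (piecePerm_one hF)
    (piecePerm_mul hF) hs.1 hL (hs.2.trans h.symm)

theorem wordPerm_piece {u : AWord (Letter Sig)} (hu : Piece n u) :
    wordPerm hF u = piecePerm hF u := by
  rw [wordPerm_eq hF hu.1 (L := [u]) (by simpa using hu) (by simp)]
  simp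

/-- Concatenation joins factorizations and inversion reverses them. Finite words have degree at most
`n`, so the relations from `G` already hold in `E n`. -/
theorem wordPerm_rel (u v w : AWord (Letter Sig)) (hu : Good (n + 1) u) (hv : Good (n + 1) v)
    (hw : Good (n + 1) w) (h : WordRel u v w) :
    wordPerm hF u * wordPerm hF v = wordPerm hF w := by
  obtain ⟨L, hL, hLu⟩ := exists_piece_factorization hu
  obtain ⟨M, hM, hMv⟩ := exists_piece_factorization hv
  rcases h with rfl | ⟨rfl, rfl⟩ | ⟨f, g, k, rfl, rfl, rfl, h⟩
  · rw [wordPerm_eq hF hu hL hLu, wordPerm_eq hF hv hM hMv,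
      wordPerm_eq hF hw (L := L ++ M) ?_ (by simp [hLu, hMv])]
    · simp
    · intro x hx
      rcases List.mem_append.1 hx with hx | hx
      exacts [hL x hx, hM x hx]
  · rw [wordPerm_eq hF hu hL hLu, wordPerm_piece hF (good_one n).piece, piecePerm_one,
      wordPerm_eq hF hv (L := L.reverse.map AWord.bar) ?_ ?_]
    · clear * - hL
      induction L with
      | nil => simp
      | cons a L ih =>
        simp only [List.mem_cons, forall_eq_or_imp] at hL
        have := ih hL.2
        simp only [List.map_cons, List.prod_cons, List.reverse_cons, List.map_append,
          List.prod_append, List.map_nil, List.prod_nil, mul_one] at this ⊢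
        rw [mul_assoc, ← mul_assoc _ _ (piecePerm hF a.bar), this, one_mul,
          piecePerm_bar hF hL.1, mul_inv_cancel]
    · intro x hx
      simp only [List.mem_map, List.mem_reverse] at hx
      obtain ⟨y, hy, rfl⟩ := hx
      exact ⟨(hL y hy).1.bar, (hL y hy).2⟩
    · rw [← AWord.bar_list_prod, hLu]
  · have key : ∀ {e : FreeMonoid (Letter Sig)}, Good (n + 1) (AWord.ofFinite e) →
        Good n (AWord.ofFinite e) := fun {e} he =>
      ⟨he.1, (AWord.deg_le_zero_iff.2 ⟨e, rfl⟩).trans (by exact_mod_cast n.zero_le)⟩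
    rw [wordPerm_piece hF (key hu).piece, wordPerm_piece hF (key hv).piece,
      wordPerm_piece hF (key hw).piece, piecePerm_good hF (key hu), piecePerm_good hF (key hv),
      piecePerm_good hF (key hw), ← map_mul,
      cl_rel (key hu) (key hv) (key hw) (Or.inr (Or.inr ⟨f, g, k, rfl, rfl, rfl, h⟩))]

/-- The action of the group of words of degree at most `n + 1` on normal forms. -/
noncomputable def act : E Sig (n + 1) →* Equiv.Perm (biset hF).NF :=
  liftE (n + 1) (wordPerm hF) (wordPerm_rel hF)

theorem act_cl {u : AWord (Letter Sig)} (hu : Good (n + 1) u) :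
    act hF (cl (n + 1) u) = wordPerm hF u :=
  liftE_cl _ _ _ hu

theorem act_lead {u : AWord (Letter Sig)} (hu : Lead n u) :
    act hF (cl (n + 1) u) = (biset hF).perm (wcl u hu) := by
  rw [act_cl hF hu.1, wordPerm_piece hF hu.piece, piecePerm_lead hF hu]

/-- The canonical homomorphism into the next group. -/
noncomputable abbrev up (n : ℕ) : E Sig n →* E Sig (n + 1) := upTo n.le_succ

theorem act_up (b : E Sig n) : act hF (up n b) = (biset hF).permB b := by
  have : (act hF).comp (up n) = (biset hF).permB := hom_ext fun u hu => by
    rw [MonoidHom.comp_apply, upTo_cl _ hu, act_cl hF (hu.mono n.le_succ),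
      wordPerm_piece hF hu.piece, piecePerm_good hF hu]
  exact DFunLike.congr_fun this b

theorem up_injective {n : ℕ} (hF : Faithful Sig n) : Function.Injective (up (Sig := Sig) n) := by
  intro a b h
  apply (biset hF).permB_injective
  rw [← act_up, ← act_up, h]

/-- The number of syllables of the normal form. -/
noncomputable def syl (g : E Sig (n + 1)) : ℕ := (act hF g (biset hF).nfOne).1.1.length

theorem syl_up (b : E Sig n) : syl hF (up n b) = 0 := by
  rw [syl, act_up, FreeBiset.permB_nfOne]; rfl

/-- The product of a stack of group elements; the top of the stack is the last factor. -/
def stackProd {H : Type*} [Group H] : List (H × H) → H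
  | [] => 1
  | p :: St => stackProd St * (p.1 * p.2)

theorem act_stackProd (St : List (E Sig n × {u : AWord (Letter Sig) // Lead n u})) :
    act hF (stackProd (St.map fun p => (up n p.1, cl (n + 1) p.2.1))) =
      (biset hF).stackPerm (St.map fun p => (p.1, wcl p.2.1 p.2.2)) := by
  induction St with
  | nil => exact map_one _
  | cons p St ih =>
    rw [List.map_cons, List.map_cons, stackProd, FreeBiset.stackPerm, map_mul, ih, map_mul,
      act_up, act_lead hF p.2.2]

theorem syl_stackProd {St : List (E Sig n × {u : AWord (Letter Sig) // Lead n u})}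
    (hSt : St.IsChain fun p q => ¬ Pinch n q.2.1 p.1 p.2.1) (b : E Sig n) :
    syl hF (stackProd (St.map fun p => (up n p.1, cl (n + 1) p.2.1)) * up n b) = St.length := by
  rw [syl, map_mul, act_stackProd, act_up, FreeBiset.length_stackPerm_nfOne, List.length_map]
  rw [FreeBiset.RedStack, List.isChain_map]
  refine hSt.imp fun p q h => ?_
  rwa [Ne, orb_eq_iff_pinch hF]

end

theorem Pinch.mul_eq {n : ℕ} {u v : AWord (Letter Sig)} {f : E Sig n} (hu : Lead n u)
    (hv : Lead n v) (h : Pinch n u f v) :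
    cl (n + 1) u * up n f * cl (n + 1) v ∈ (up (Sig := Sig) n).range := by
  obtain ⟨a, w, x, x', y, rfl, rfl, h3, h4⟩ := h
  have ha := hu.outer h3
  have hb := hv.outer h3
  refine ⟨cl n a * cl n y, ?_⟩
  have h5 : cl (n + 1) x * up n f * cl (n + 1) x' = 1 := by
    rw [← upTo_cl n.le_succ ha.2.2, ← upTo_cl n.le_succ hb.1, ← map_mul, ← map_mul, h4, map_one]
  rw [cl_mul hu.1, cl_mul hu.1.left, cl_mul hv.1, cl_mul hv.1.left, map_mul,
    upTo_cl _ ha.1, upTo_cl _ hb.2.2, cl_bar hb.2.1.1]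
  calc cl (n + 1) a * cl (n + 1) y = cl (n + 1) a * ((cl (n + 1) w)⁻¹ * 1 * cl (n + 1) w) *
      cl (n + 1) y := by group
    _ = _ := by rw [← h5]; group

/-- Without a pinch the product would have two syllables, whereas elements of `E n` have none. -/
theorem pinch_of_mem {n : ℕ} (hF : Faithful Sig n) {u v : AWord (Letter Sig)} {f : E Sig n}
    (hu : Lead n u) (hv : Lead n v)
    (h : cl (n + 1) u * up n f * cl (n + 1) v ∈ (up (Sig := Sig) n).range) : Pinch n u f v := by
  by_contra hp
  obtain ⟨b, hb⟩ := h
  have h1 := syl_stackProd hF (St := [(f, ⟨v, hv⟩), (1, ⟨u, hu⟩)])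
    (List.isChain_cons_cons.2 ⟨hp, List.isChain_singleton _⟩) 1
  have h2 := syl_up hF b
  simp only [List.map_cons, List.map_nil, stackProd, map_one, one_mul, mul_one,
    ← mul_assoc] at h1
  rw [← hb, h2] at h1
  simp at h1

/-- A pinch would place `w.bar * (x * x') * w` inside a reduced word, with `x * x'` trivial in `E n`
and hence empty by faithfulness. Then `w.bar * w` is reduced, which forces `w = 1`, against its
leading coefficient. -/
theorem not_pinch_one {n : ℕ} (hF : Faithful Sig n) {u v : AWord (Letter Sig)} (hu : Lead n u)
    (hv : Lead n v) (h : IsGReduced (u * v)) : ¬ Pinch n u 1 v := by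
  rintro ⟨a, w, x, x', y, rfl, rfl, h3, h4⟩
  have ha := hu.outer h3
  have hb := hv.outer h3
  have hr : IsGReduced (w.bar * (x * x') * w) := by
    have h5 : IsGReduced (a * (w.bar * (x * x') * w) * y) := by
      simpa only [mul_assoc] using h
    exact h5.left.right
  have hxx : Good n (x * x') := ⟨hr.left.right, AWord.deg_mul_le ha.2.2.2 hb.1.2⟩
  rw [mul_one, ← cl_mul hxx] at h4
  rw [hF _ hxx h4, mul_one] at hr
  have hw := eq_one_of_isGReduced_bar_mul hr
  rw [hw] at h3
  simp [lc] at h3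

theorem isChain_of_isGReduced_prod {L : List (AWord (Letter Sig))} (h : IsGReduced L.prod) :
    L.IsChain fun a b => IsGReduced (a * b) := by
  induction L with
  | nil => exact List.isChain_nil
  | cons a L ih =>
    rw [List.prod_cons] at h
    cases L with
    | nil => exact List.isChain_singleton _
    | cons b L =>
      rw [List.isChain_cons_cons]
      refine ⟨?_, ih h.right⟩
      rw [List.prod_cons, ← mul_assoc] at h
      exact h.left

theorem stackProd_append {H : Type*} [Group H] (A B : List (H × H)) :
    stackProd (A ++ B) = stackProd B * stackProd A := by
  induction A with
  | nil => simp [stackProd]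
  | cons p A ih => simp [stackProd, ih, mul_assoc]

theorem cl_prod {n : ℕ} {L : List (AWord (Letter Sig))} (h : Good n L.prod) :
    cl n L.prod = (L.map (cl n)).prod := by
  induction L with
  | nil => simp
  | cons a L ih =>
    rw [List.prod_cons] at h
    rw [List.prod_cons, cl_mul h, ih h.right, List.map_cons, List.prod_cons]

/-- The number of syllables of a `G`-reduced word is its leading coefficient. -/
theorem syl_cl_mul {n : ℕ} (hF : Faithful Sig n) {z : AWord (Letter Sig)} (hz : Good (n + 1) z)
    (b : E Sig n) : (syl hF (cl (n + 1) z * up n b) : ℤ) = lc n z := by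
  obtain ⟨L, y, hL, hy, rfl, hlen⟩ := exists_lead_factorization hz
  rw [← hlen]
  lift L to List {u : AWord (Letter Sig) // Lead n u} using hL
  have h1 := syl_stackProd hF (St := (L.map fun u => ((1 : E Sig n), u)).reverse) ?_ (cl n y * b)
  · have h2 : ∀ M : List {u : AWord (Letter Sig) // Lead n u},
        stackProd (((M.map fun u => ((1 : E Sig n), u)).reverse).map
          fun p => (up n p.1, cl (n + 1) p.2.1)) =
        ((M.map Subtype.val).map (cl (n + 1))).prod := by
      intro M
      induction M with
      | nil => rfl
      | cons a M ih =>
        simp only [List.map_cons, List.reverse_cons, List.map_append, List.map_nil,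
          stackProd_append, ih, List.prod_cons]
        simp [stackProd]
    rw [h2, ← cl_prod hz.left, map_mul, upTo_cl _ hy, ← mul_assoc, ← cl_mul hz] at h1
    rw [h1]
    simp
  · rw [List.isChain_reverse, List.isChain_map]
    have h3 := isChain_of_isGReduced_prod hz.1.left
    rw [List.isChain_map] at h3
    exact h3.imp fun a b hab => not_pinch_one hF a.2 b.2 hab

/-- A trivial class has no syllables, so the word has leading coefficient zero and comes from `E n`,
which embeds. -/
theorem faithful_succ {n : ℕ} (hF : Faithful Sig n) : Faithful Sig (n + 1) := by
  intro u hu h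
  have h1 := syl_cl_mul hF hu 1
  have h2 := syl_up hF (Sig := Sig) (1 : E Sig n)
  rw [map_one] at h2
  rw [h, map_one, mul_one, h2] at h1
  have hg : Good n u := ⟨hu.1, deg_le_of_lc_eq_zero hu.2 h1.symm⟩
  rw [← upTo_cl n.le_succ hg, ← map_one (up (Sig := Sig) n)] at h
  exact hF u hg (up_injective hF h)

theorem faithful (n : ℕ) : Faithful Sig n := by
  induction n with
  | zero => exact faithful_zero
  | succ n ih => exact faithful_succ ih

theorem upTo_injective {m n : ℕ} (h : m ≤ n) : Function.Injective (upTo (Sig := Sig) h) := by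
  induction n, h using Nat.le_induction with
  | base =>
    intro a b hab
    rwa [upTo_refl, upTo_refl] at hab
  | succ n h ih =>
    intro a b hab
    rw [← upTo_upTo h n.le_succ, ← upTo_upTo h n.le_succ] at hab
    exact ih (up_injective (faithful n) hab)

end Representation

/-! ## Rewriting and the classes of words -/

section Rewriting

variable {M : Type*} [Monoid M] {S : Set (M × M)}

theorem Step.mul (a b : M) {x y : M} (h : Step S x y) : Step S (a * x * b) (a * y * b) := by
  obtain ⟨p, q, l, r, h, rfl, rfl⟩ := h
  exact ⟨a * p, q * b, l, r, h, by simp only [mul_assoc], by simp only [mul_assoc]⟩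

theorem Reduces.mul (a b : M) {x y : M} (h : Reduces S x y) :
    Reduces S (a * x * b) (a * y * b) := by
  induction h with
  | refl => exact .refl
  | tail _ h ih => exact ih.tail (h.mul a b)

theorem Equivalent.mul (a b : M) {x y : M} (h : Equivalent S x y) :
    Equivalent S (a * x * b) (a * y * b) := by
  induction h with
  | rel x y h => exact .rel _ _ (h.mul a b)
  | refl x => exact .refl _
  | symm x y _ ih => exact .symm _ _ ih
  | trans x y z _ _ ih ih' => exact .trans _ _ _ ih ih'

variable (S) in
/-- The congruence generated by a rewriting system. -/
def congruence : Con M where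
  r := Equivalent S
  iseqv := Relation.EqvGen.is_equivalence _
  mul' := by
    intro a b c d h h'
    have h1 := Equivalent.mul 1 c h
    have h2 := Equivalent.mul b 1 h'
    simp only [one_mul, mul_one] at h1 h2
    exact .trans _ _ _ h1 h2

theorem Reduces.map {N : Type*} [Monoid N] {T : Set (N × N)} (φ : M →* N)
    (h : ∀ l r, (l, r) ∈ S → (φ l, φ r) ∈ T) {x y : M} (hxy : Reduces S x y) :
    Reduces T (φ x) (φ y) := by
  refine Relation.ReflTransGen.lift φ ?_ _ _ hxy
  rintro a b ⟨p, q, l, r, hlr, rfl, rfl⟩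
  exact ⟨φ p, φ q, φ l, φ r, h _ _ hlr, by simp, by simp⟩

theorem Equivalent.map {N : Type*} [Monoid N] {T : Set (N × N)} (φ : M →* N)
    (h : ∀ l r, (l, r) ∈ S → (φ l, φ r) ∈ T) {x y : M} (hxy : Equivalent S x y) :
    Equivalent T (φ x) (φ y) := by
  induction hxy with
  | rel x y hxy =>
    obtain ⟨p, q, l, r, hlr, rfl, rfl⟩ := hxy
    exact .rel _ _ ⟨φ p, φ q, φ l, φ r, h _ _ hlr, by simp, by simp⟩
  | refl x => exact .refl _
  | symm x y _ ih => exact .symm _ _ ih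
  | trans x y z _ _ ih ih' => exact .trans _ _ _ ih ih'

/-- The Church–Rosser property: confluence removes the peaks of a zigzag one after the other. -/
theorem reduces_of_irreducible (hS : IsConfluent S) {x y : M} (h : Equivalent S x y) :
    ∃ z, Reduces S x z ∧ Reduces S y z := by
  induction h with
  | rel x y h => exact ⟨y, .single h, .refl⟩
  | refl x => exact ⟨x, .refl, .refl⟩
  | symm x y _ ih => obtain ⟨z, h1, h2⟩ := ih; exact ⟨z, h2, h1⟩
  | trans x y z _ _ ih ih' =>
    obtain ⟨a, h1, h2⟩ := ih
    obtain ⟨b, h3, h4⟩ := ih'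
    obtain ⟨c, h5, h6⟩ := hS y a b h2 h3
    exact ⟨c, h1.trans h5, h4.trans h6⟩

theorem reduces_one_of_equivalent (hS : IsConfluent S) (h1 : IsIrreducible S 1) {x : M}
    (h : Equivalent S x 1) : Reduces S x 1 := by
  obtain ⟨z, h2, h3⟩ := reduces_of_irreducible hS h
  rcases h3.cases_head with rfl | ⟨y, h4, -⟩
  · exact h2
  · exact absurd h4 (h1 y)

end Rewriting

/-! ### Classes of products of reduced words and their behaviour under rewriting. -/

section Classes

variable {G : Type*} [Group G] {Sig : Set G}

/-- `x` is a product of `G`-reduced words of degree at most `n` and has the class `g`. -/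
def Rep (n : ℕ) (x : AWord (Letter Sig)) (g : E Sig n) : Prop :=
  ∃ L : List (AWord (Letter Sig)), (∀ u ∈ L, Good n u) ∧ L.prod = x ∧ (L.map (cl n)).prod = g

/-- Cutting two factorizations against each other changes neither product of classes, so the class
belongs to the word itself. -/
theorem Rep.unique {n : ℕ} {x : AWord (Letter Sig)} {g g' : E Sig n} (h : Rep n x g)
    (h' : Rep n x g') : g = g' := by
  obtain ⟨L, hL, h1, rfl⟩ := h
  obtain ⟨M, hM, h2, rfl⟩ := h'
  exact AWord.map_prod_eq_of_prod_eq (C := Good n) (fun _ _ h => h.right) _ (cl_one n)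
    (fun _ _ h => cl_mul h) hL hM (h1.trans h2.symm)

theorem Rep.mul {n : ℕ} {x y : AWord (Letter Sig)} {g h : E Sig n} (hx : Rep n x g)
    (hy : Rep n y h) : Rep n (x * y) (g * h) := by
  obtain ⟨L, hL, rfl, rfl⟩ := hx
  obtain ⟨M, hM, rfl, rfl⟩ := hy
  refine ⟨L ++ M, ?_, by simp, by simp⟩
  intro u hu
  rcases List.mem_append.1 hu with hu | hu
  exacts [hL u hu, hM u hu]

theorem Good.rep {n : ℕ} {x : AWord (Letter Sig)} (h : Good n x) : Rep n x (cl n x) :=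
  ⟨[x], by simpa using h, by simp, by simp⟩

theorem rep_one (n : ℕ) : Rep n (1 : AWord (Letter Sig)) 1 := ⟨[], by simp, rfl, rfl⟩

theorem Rep.split {n : ℕ} {x y : AWord (Letter Sig)} {g : E Sig n} (h : Rep n (x * y) g) :
    ∃ a b, Rep n x a ∧ Rep n y b ∧ g = a * b := by
  have h' := h
  obtain ⟨L, hL, h1, -⟩ := h
  obtain ⟨L₁, L₂, h2, h3, h4, h5⟩ := AWord.exists_split_of_prod_eq_mul (C := Good n)
    (fun _ _ h => h.left) (fun _ _ h => h.right) hL h1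
  have hx : Rep n x _ := ⟨L₁, h2, h4, rfl⟩
  have hy : Rep n y _ := ⟨L₂, h3, h5, rfl⟩
  exact ⟨_, _, hx, hy, h'.unique (hx.mul hy)⟩

theorem Rep.upTo {m n : ℕ} (hmn : m ≤ n) {x : AWord (Letter Sig)} {g : E Sig m}
    (h : Rep m x g) : Rep n x (upTo hmn g) := by
  obtain ⟨L, hL, rfl, rfl⟩ := h
  refine ⟨L, fun u hu => (hL u hu).mono hmn, rfl, ?_⟩
  rw [map_list_prod, List.map_map]
  congr 1
  exact List.map_congr_left fun u hu => (upTo_cl hmn (hL u hu)).symm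

theorem Rep.deg_le {n : ℕ} {x : AWord (Letter Sig)} {g : E Sig n} (h : Rep n x g) :
    x.deg ≤ n := by
  obtain ⟨L, hL, rfl, -⟩ := h
  exact AWord.deg_prod_le fun u hu => (hL u hu).2

theorem Rep.mem_range {m n : ℕ} (hmn : m ≤ n) {x : AWord (Letter Sig)} {g : E Sig n}
    (h : Rep n x g) (hx : x.deg ≤ m) : ∃ b, Rep m x b ∧ NonArch.upTo hmn b = g := by
  have h' := h
  obtain ⟨L, hL, rfl, rfl⟩ := h
  have : Rep m L.prod (L.map (cl m)).prod := by
    refine ⟨L, fun u hu => ⟨(hL u hu).1, ?_⟩, rfl, rfl⟩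
    obtain ⟨A, B, rfl⟩ := List.append_of_mem hu
    rw [List.prod_append, List.prod_cons] at hx
    exact (AWord.deg_of_mul_le (AWord.deg_of_mul_le hx).2).1
  exact ⟨_, this, (this.upTo hmn).unique h'⟩

theorem exists_rep_ofFinite (hone : (1 : G) ∉ Sig) (f : FreeMonoid (Letter Sig)) :
    ∃ g : E Sig 0, Rep 0 (AWord.ofFinite f) g ∧ zeroToG Sig g = toGroup f := by
  induction f using FreeMonoid.recOn with
  | one => exact ⟨1, by rw [map_one]; exact rep_one 0, by simp⟩
  | of_mul a f ih =>
    obtain ⟨g, h1, h2⟩ := ih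
    have ha : IsGReduced (AWord.ofFinite (FreeMonoid.of a)) := by
      rw [AWord.ofFinite_of]; exact isGReduced_letter hone a
    refine ⟨cl 0 (AWord.ofFinite (FreeMonoid.of a)) * g, ?_, ?_⟩
    · rw [map_mul]
      exact (good_zero_iff.2 ⟨_, rfl, ha⟩).rep.mul h1
    · rw [map_mul, map_mul, h2, zeroToG_cl ha]

/-- Letters are reduced because `1 ∉ Sig`, so finite words already have classes in `E 0`, and `E 0`
embeds into `G`. -/
theorem Rep.ofFinite_congr (hone : (1 : G) ∉ Sig) (hgen : Subgroup.closure Sig = ⊤) {n : ℕ}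
    {f f' : FreeMonoid (Letter Sig)} (hf : toGroup f = toGroup f') {g : E Sig n}
    (h : Rep n (AWord.ofFinite f) g) : Rep n (AWord.ofFinite f') g := by
  obtain ⟨a, h1, h2⟩ := exists_rep_ofFinite hone f
  obtain ⟨b, h3, h4⟩ := exists_rep_ofFinite hone f'
  have : a = b := zeroToG_injective hgen (by rw [h2, h4, hf])
  subst this
  rw [h.unique (h1.upTo n.zero_le)]
  exact h3.upTo n.zero_le

variable (S₀ : Set (FreeMonoid (Letter Sig) × FreeMonoid (Letter Sig)))

/-- Rewriting does not change the class. -/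
theorem Rep.step (hone : (1 : G) ∉ Sig) (hgen : Subgroup.closure Sig = ⊤)
    (hS₀ : IsBaseSystem S₀) {n : ℕ} {x y : AWord (Letter Sig)} {g : E Sig n} (h : Rep n x g)
    (hxy : Step (bigSystem S₀) x y) : Rep n y g := by
  obtain ⟨p, q, l, r, hlr, rfl, rfl⟩ := hxy
  obtain ⟨a, b, h1, h2, rfl⟩ := h.split
  obtain ⟨a, c, h3, h4, rfl⟩ := h1.split
  refine (h3.mul ?_).mul h2
  rcases hlr with ⟨l, r, hlr, he⟩ | ⟨u, hu, -, he⟩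
  · rw [Prod.mk.injEq] at he
    obtain ⟨rfl, rfl⟩ := he
    refine h4.ofFinite_congr hone hgen ((hS₀.presents l r).1 ?_)
    exact .rel _ _ ⟨1, 1, l, r, hlr, by simp, by simp⟩
  · rw [Prod.mk.injEq] at he
    obtain ⟨rfl, rfl⟩ := he
    have hg : Good n u := ⟨hu, (AWord.deg_of_mul_le h4.deg_le).1⟩
    rw [h4.unique (hg.rep.mul hg.bar.rep), cl_mul_bar hg]
    exact rep_one n

theorem Rep.reduces (hone : (1 : G) ∉ Sig) (hgen : Subgroup.closure Sig = ⊤)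
    (hS₀ : IsBaseSystem S₀) {n : ℕ} {x y : AWord (Letter Sig)} {g : E Sig n} (h : Rep n x g)
    (hxy : Reduces (bigSystem S₀) x y) : Rep n y g := by
  induction hxy with
  | refl => exact h
  | tail _ h2 ih => exact ih.step S₀ hone hgen hS₀ h2

theorem ofFinite_mem_bigSystem (l r : FreeMonoid (Letter Sig)) (h : (l, r) ∈ S₀) :
    (AWord.ofFinite l, AWord.ofFinite r) ∈ bigSystem S₀ :=
  Or.inl ⟨l, r, h, rfl⟩

/-- For infinite words this is a rule of the system. For finite words it follows because the base
system presents `G`. -/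
theorem equivalent_mul_bar (hS₀ : IsBaseSystem S₀) {u : AWord (Letter Sig)}
    (hu : IsGReduced u) : Equivalent (bigSystem S₀) (u * u.bar) 1 := by
  by_cases hf : u.IsFinite
  · obtain ⟨f, rfl⟩ := AWord.deg_le_zero_iff.1 (AWord.isFinite_iff.1 hf)
    rw [bar_ofFinite, ← map_mul, ← map_one AWord.ofFinite]
    refine Equivalent.map _ (ofFinite_mem_bigSystem S₀) ((hS₀.presents _ _).2 ?_)
    rw [map_mul, toGroup_barFinite, mul_inv_cancel, map_one]
  · exact .rel _ _ ⟨1, 1, _, _, Or.inr ⟨u, hu, hf, rfl⟩, by simp, by simp⟩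

open Classical in
noncomputable def unitClass (hS₀ : IsBaseSystem S₀) (u : AWord (Letter Sig)) :
    (congruence (bigSystem S₀)).Quotientˣ :=
  if hu : IsGReduced u then
    { val := (u : (congruence (bigSystem S₀)).Quotient)
      inv := (u.bar : (congruence (bigSystem S₀)).Quotient)
      val_inv := by
        rw [← Con.coe_mul, ← Con.coe_one]
        exact (Con.eq _).2 (equivalent_mul_bar S₀ hS₀ hu)
      inv_val := by
        rw [← Con.coe_mul, ← Con.coe_one]
        have := equivalent_mul_bar S₀ hS₀ hu.bar
        rw [AWord.bar_bar] at this
        exact (Con.eq _).2 this }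
  else 1

theorem unitClass_val (hS₀ : IsBaseSystem S₀) {u : AWord (Letter Sig)} (hu : IsGReduced u) :
    (unitClass S₀ hS₀ u : (congruence (bigSystem S₀)).Quotient) = u := by
  rw [unitClass, dif_pos hu]

/-- Modulo the congruence reduced words become invertible and satisfy the defining relations of `E
n`. Equality of classes therefore implies equivalence of words. -/
noncomputable def toUnits (hS₀ : IsBaseSystem S₀) (n : ℕ) :
    E Sig n →* (congruence (bigSystem S₀)).Quotientˣ :=
  liftE n (unitClass S₀ hS₀) (by
    intro u v w hu hv hw h
    ext1
    rw [Units.val_mul, unitClass_val S₀ hS₀ hu.1, unitClass_val S₀ hS₀ hv.1,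
      unitClass_val S₀ hS₀ hw.1, ← Con.coe_mul]
    refine (Con.eq _).2 ?_
    rcases h with rfl | ⟨rfl, rfl⟩ | ⟨f, g, k, rfl, rfl, rfl, h⟩
    · exact .refl _
    · exact equivalent_mul_bar S₀ hS₀ hu.1
    · rw [← map_mul]
      exact Equivalent.map _ (ofFinite_mem_bigSystem S₀)
        ((hS₀.presents _ _).2 (by rw [map_mul, h])))

theorem Rep.toUnits_eq (hS₀ : IsBaseSystem S₀) {n : ℕ} {x : AWord (Letter Sig)} {g : E Sig n}
    (h : Rep n x g) : (toUnits S₀ hS₀ n g : (congruence (bigSystem S₀)).Quotient) = x := by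
  obtain ⟨L, hL, rfl, rfl⟩ := h
  induction L with
  | nil => simp
  | cons a L ih =>
    simp only [List.mem_cons, forall_eq_or_imp] at hL
    rw [List.map_cons, List.prod_cons, List.prod_cons, map_mul, Units.val_mul, ih hL.2,
      toUnits, liftE_cl _ _ _ hL.1, unitClass_val S₀ hS₀ hL.1.1, Con.coe_mul]

/-- Words with the same class are equivalent. -/
theorem Rep.equivalent (hS₀ : IsBaseSystem S₀) {n : ℕ} {x y : AWord (Letter Sig)} {g : E Sig n}
    (hx : Rep n x g) (hy : Rep n y g) : Equivalent (bigSystem S₀) x y := by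
  have := (hx.toUnits_eq S₀ hS₀).symm.trans (hy.toUnits_eq S₀ hS₀)
  exact (Con.eq _).1 this

/-! ### Reduction to smaller degree -/

/-- The word `y` is the product of the elements of a stack and a word of class `b`. -/
def StackRep {n : ℕ} : AWord (Letter Sig) → List (E Sig n × {u : AWord (Letter Sig) // Lead n u}) →
    E Sig n → Prop
  | y, [], b => Rep n y b
  | y, p :: St, b => ∃ x z, y = x * p.2.1 * z ∧ StackRep x St p.1 ∧ Rep n z b

theorem StackRep.mul {n : ℕ} {y z : AWord (Letter Sig)}
    {St : List (E Sig n × {u : AWord (Letter Sig) // Lead n u})} {b c : E Sig n}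
    (h : StackRep y St b) (hz : Rep n z c) : StackRep (y * z) St (b * c) := by
  cases St with
  | nil => exact Rep.mul h hz
  | cons p St =>
    obtain ⟨x, w, rfl, h1, h2⟩ := h
    exact ⟨x, w * z, by simp only [mul_assoc], h1, h2.mul hz⟩

theorem StackRep.rep {n : ℕ} {y : AWord (Letter Sig)}
    {St : List (E Sig n × {u : AWord (Letter Sig) // Lead n u})} {b : E Sig n}
    (h : StackRep y St b) :
    Rep (n + 1) y (stackProd (St.map fun p => (up n p.1, cl (n + 1) p.2.1)) * up n b) := by
  induction St generalizing y b with
  | nil =>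
    simp only [List.map_nil, stackProd, one_mul]
    exact Rep.upTo n.le_succ h
  | cons p St ih =>
    obtain ⟨x, w, rfl, h1, h2⟩ := h
    have := ((ih h1).mul p.2.2.1.rep).mul (h2.upTo n.le_succ)
    simp only [List.map_cons, stackProd]
    rwa [← mul_assoc (stackProd _)]

/-- Rewriting imitates Britton reduction. A new stable letter either extends the stack or pinches
with its top. In a pinch the middle part has trivial class and rewrites to `1` by `ih`. The factor
`w.bar * w` that then arises is removed by a rule, as `w` has degree `n + 1` and so is infinite. -/
theorem exists_reduces_stackRep {n : ℕ}
    (ih : ∀ x : AWord (Letter Sig), Rep n x 1 → Reduces (bigSystem S₀) x 1)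
    (L : List (AWord (Letter Sig))) (hL : ∀ u ∈ L, Piece n u) :
    ∃ (y : AWord (Letter Sig)) (St : List (E Sig n × {u : AWord (Letter Sig) // Lead n u}))
      (b : E Sig n), Reduces (bigSystem S₀) L.prod y ∧ StackRep y St b ∧
        St.IsChain fun p q => ¬ Pinch n q.2.1 p.1 p.2.1 := by
  induction L using List.reverseRecOn with
  | nil => exact ⟨1, [], 1, .refl, rep_one n, List.isChain_nil⟩
  | append_singleton L v IH =>
    obtain ⟨y, St, b, h1, h2, h3⟩ := IH fun u hu => hL u (by simp [hu])
    have h1' : Reduces (bigSystem S₀) (L ++ [v]).prod (y * v) := by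
      have := h1.mul 1 v
      simpa using this
    rcases (hL v (by simp)).good_or_lead with hv | hv
    · exact ⟨y * v, St, _, h1', h2.mul hv.rep, h3⟩
    · by_cases hp : ∃ p ∈ St.head?, Pinch n p.2.1 b v
      · obtain ⟨p, hp, a, w, x, x', c, hu, rfl, hw, hx⟩ := hp
        cases St with
        | nil => simp at hp
        | cons q St =>
          rw [List.head?_cons, Option.mem_some_iff] at hp
          subst hp
          obtain ⟨y₀, z, rfl, h4, h5⟩ := h2
          have hq := q.2.2
          rw [hu] at hq
          have ha := hq.outer hw
          have hb := hv.outer hw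
          have hone : Rep n (x * z * x') 1 := by
            rw [← hx]
            exact (ha.2.2.rep.mul h5).mul hb.1.rep
          have hr1 : Reduces (bigSystem S₀) (y₀ * q.2.1 * z * (x' * w * c))
              (y₀ * a * w.bar * 1 * (w * c)) := by
            rw [hu]
            have := (ih _ hone).mul (y₀ * a * w.bar) (w * c)
            simpa only [mul_assoc] using this
          have hr2 : Step (bigSystem S₀) (y₀ * a * w.bar * 1 * (w * c)) (y₀ * (a * c)) := by
            refine ⟨y₀ * a, c, w.bar * w, 1, Or.inr ⟨w.bar, hb.2.1.1.1.bar, ?_, by simp⟩,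
              by simp [mul_assoc], by simp [mul_assoc]⟩
            rw [AWord.isFinite_iff]
            intro hdeg
            have hdeg' : w.deg ≤ n := hdeg.trans (by exact_mod_cast n.zero_le)
            rw [lc_eq_zero hdeg'] at hw
            exact absurd hw (by decide)
          refine ⟨y₀ * (a * c), St, _, (h1'.trans hr1).tail hr2,
            h4.mul (ha.1.rep.mul hb.2.2.rep), h3.tail⟩
      · refine ⟨y * v, (b, ⟨v, hv⟩) :: St, 1, h1', ⟨y, 1, by simp, h2, rep_one n⟩, ?_⟩
        cases St with
        | nil => exact List.isChain_singleton _
        | cons q St =>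
          exact List.isChain_cons_cons.2 ⟨fun h => hp ⟨q, rfl, h⟩, h3⟩

theorem Rep.exists_piece {n : ℕ} {x : AWord (Letter Sig)} {g : E Sig (n + 1)}
    (h : Rep (n + 1) x g) : ∃ L : List (AWord (Letter Sig)), (∀ u ∈ L, Piece n u) ∧
      L.prod = x := by
  obtain ⟨L, hL, rfl, -⟩ := h
  induction L with
  | nil => exact ⟨[], by simp, rfl⟩
  | cons a L ih =>
    simp only [List.mem_cons, forall_eq_or_imp] at hL
    obtain ⟨M, h1, h2⟩ := ih hL.2
    obtain ⟨A, h3, h4⟩ := exists_piece_factorization hL.1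
    refine ⟨A ++ M, ?_, by simp [h2, h4]⟩
    intro u hu
    rcases List.mem_append.1 hu with hu | hu
    exacts [h3 u hu, h1 u hu]

/-- The reduced stack has the class of `x`, which has no syllables, so the stack is empty and only a
word of degree at most `n` remains. -/
theorem exists_reduces_of_mem_range (hone : (1 : G) ∉ Sig) (hgen : Subgroup.closure Sig = ⊤)
    (hS₀ : IsBaseSystem S₀) {n : ℕ}
    (ih : ∀ x : AWord (Letter Sig), Rep n x 1 → Reduces (bigSystem S₀) x 1)
    {x : AWord (Letter Sig)} {b : E Sig n} (h : Rep (n + 1) x (up n b)) :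
    ∃ y, Reduces (bigSystem S₀) x y ∧ Rep n y b := by
  obtain ⟨L, hL, rfl⟩ := h.exists_piece
  obtain ⟨y, St, c, h1, h2, h3⟩ := exists_reduces_stackRep S₀ ih L hL
  have h4 := h2.rep.unique (h.reduces S₀ hone hgen hS₀ h1)
  have h5 := syl_stackProd (faithful n) h3 c
  rw [h4, syl_up] at h5
  obtain rfl := List.length_eq_zero_iff.1 h5.symm
  simp only [List.map_nil, stackProd, one_mul] at h4
  rw [← up_injective (faithful n) h4]
  exact ⟨y, h1, h2⟩

/-- In degree zero, confluence and irreducibility of `1` turn equivalence with `1` into a reduction.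
Higher degrees descend through the previous lemma. -/
theorem Rep.reduces_one (hone : (1 : G) ∉ Sig) (hgen : Subgroup.closure Sig = ⊤)
    (hS₀ : IsBaseSystem S₀) {n : ℕ} {x : AWord (Letter Sig)} (h : Rep n x 1) :
    Reduces (bigSystem S₀) x 1 := by
  induction n generalizing x with
  | zero =>
    obtain ⟨f, rfl⟩ := AWord.deg_le_zero_iff.1 h.deg_le
    obtain ⟨g, h1, h2⟩ := exists_rep_ofFinite hone f
    rw [h1.unique h, map_one] at h2
    rw [← map_one AWord.ofFinite]
    refine Reduces.map _ (ofFinite_mem_bigSystem S₀)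
      (reduces_one_of_equivalent hS₀.confluent hS₀.one_irreducible ((hS₀.presents _ _).2 ?_))
    rw [← h2, map_one]
  | succ n ih =>
    rw [← map_one (up (Sig := Sig) n)] at h
    obtain ⟨y, h1, h2⟩ := exists_reduces_of_mem_range S₀ hone hgen hS₀ (fun x hx => ih hx) h
    exact h1.trans (ih h2)

theorem Rep.exists_reduces (hone : (1 : G) ∉ Sig) (hgen : Subgroup.closure Sig = ⊤)
    (hS₀ : IsBaseSystem S₀) {m n : ℕ} (hmn : m ≤ n) {x : AWord (Letter Sig)} {b : E Sig m}
    (h : Rep n x (NonArch.upTo hmn b)) : ∃ y, Reduces (bigSystem S₀) x y ∧ Rep m y b := by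
  induction n, hmn using Nat.le_induction generalizing x with
  | base => exact ⟨x, .refl, by rwa [upTo_refl] at h⟩
  | succ n hmn ih =>
    rw [← upTo_upTo hmn n.le_succ] at h
    obtain ⟨y, h1, h2⟩ := exists_reduces_of_mem_range S₀ hone hgen hS₀
      (fun x hx => hx.reduces_one S₀ hone hgen hS₀) h
    obtain ⟨z, h3, h4⟩ := ih h2
    exact ⟨z, h1.trans h3, h4⟩

/-! ### The reduced degree -/

theorem rdeg_le {Γ : Type*} {S : Set (AWord Γ × AWord Γ)} {x y : AWord Γ} (h : Reduces S x y) :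
    rdeg S x ≤ y.deg :=
  not_lt.1 (WellFounded.not_lt_min _ {d | ∃ y, Reduces S x y ∧ y.deg = d} ⟨y, h, rfl⟩)

theorem exists_deg_eq_rdeg {Γ : Type*} (S : Set (AWord Γ × AWord Γ)) (x : AWord Γ) :
    ∃ y, Reduces S x y ∧ y.deg = rdeg S x :=
  WellFounded.min_mem (wellFounded_lt : WellFounded ((· < ·) : WithBot ℕ → WithBot ℕ → Prop))
    {d | ∃ y, Reduces S x y ∧ y.deg = d} ⟨x.deg, x, .refl, rfl⟩

/-- This replaces the minimum over all reductions by a membership problem. A word of small degree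
that is reached carries the same class, and a class in the smaller group can be reached by
reduction. -/
theorem Rep.rdeg_le_iff (hone : (1 : G) ∉ Sig) (hgen : Subgroup.closure Sig = ⊤)
    (hS₀ : IsBaseSystem S₀) {m n : ℕ} (hmn : m ≤ n) {x : AWord (Letter Sig)} {g : E Sig n}
    (h : Rep n x g) :
    rdeg (bigSystem S₀) x ≤ m ↔ g ∈ (NonArch.upTo (Sig := Sig) hmn).range := by
  constructor
  · intro hd
    obtain ⟨y, h1, h2⟩ := exists_deg_eq_rdeg (bigSystem S₀) x
    obtain ⟨b, -, h4⟩ := (h.reduces S₀ hone hgen hS₀ h1).mem_range hmn (h2.trans_le hd)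
    exact ⟨b, h4⟩
  · rintro ⟨b, rfl⟩
    obtain ⟨y, h1, h2⟩ := h.exists_reduces S₀ hone hgen hS₀ hmn
    exact (rdeg_le h1).trans h2.deg_le

theorem Rep.rdeg_eq_bot_iff (hone : (1 : G) ∉ Sig) (hgen : Subgroup.closure Sig = ⊤)
    (hS₀ : IsBaseSystem S₀) {n : ℕ} {x : AWord (Letter Sig)} {g : E Sig n}
    (h : Rep n x g) : rdeg (bigSystem S₀) x = ⊥ ↔ g = 1 := by
  constructor
  · intro hd
    obtain ⟨y, h1, h2⟩ := exists_deg_eq_rdeg (bigSystem S₀) x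
    rw [hd, AWord.deg_eq_bot] at h2
    subst h2
    exact (h.reduces S₀ hone hgen hS₀ h1).unique (rep_one n)
  · rintro rfl
    have := rdeg_le (h.reduces_one S₀ hone hgen hS₀)
    rwa [AWord.deg_one, le_bot_iff] at this

end Classes

/-! ## Computability on words -/

section Computability

variable {α β γ σ : Type*} [Primcodable α] [Primcodable β] [Primcodable γ] [Primcodable σ]

theorem _root_.ComputablePred.comp_computable {p : β → Prop} (hp : ComputablePred p) {f : α → β}
    (hf : Computable f) : ComputablePred fun a => p (f a) := by
  classical
  exact Computable.computablePred (hp.decide.comp hf)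

theorem _root_.ComputablePred.and' {p q : α → Prop} (hp : ComputablePred p)
    (hq : ComputablePred q) : ComputablePred fun a => p a ∧ q a := by
  classical
  refine Computable.computablePred
    ((Primrec.and.to_comp.comp hp.decide hq.decide).of_eq fun a => ?_)
  simp

theorem _root_.ComputablePred.or' {p q : α → Prop} (hp : ComputablePred p)
    (hq : ComputablePred q) : ComputablePred fun a => p a ∨ q a := by
  classical
  refine Computable.computablePred
    ((Primrec.or.to_comp.comp hp.decide hq.decide).of_eq fun a => ?_)
  simp

theorem computablePred_eq [DecidableEq β] {f g : α → β} (hf : Computable f) (hg : Computable g) :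
    ComputablePred fun a => f a = g a := by
  have h : ComputablePred fun p : β × β => p.1 = p.2 :=
    (Primrec.eq (α := β)).computablePred
  exact h.comp_computable (hf.pair hg)

/-- A predicate on optional values. -/
theorem computablePred_option {p : α → β → Prop} (hp : ComputablePred fun q : α × β => p q.1 q.2)
    {f : α → Option β} (hf : Computable f) : ComputablePred fun a => ∃ b, f a = some b ∧ p a b := by
  classical
  have h : Computable₂ fun (a : α) (b : β) => decide (p a b) := hp.decide
  refine Computable.computablePred
    ((Computable.option_casesOn hf (Computable.const false) h).of_eq fun a => ?_)
  cases f a <;> simp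

theorem _root_.Computable.ite' {p : α → Prop} [DecidablePred p] (hp : ComputablePred p)
    {f g : α → σ} (hf : Computable f) (hg : Computable g) :
    Computable fun a => if p a then f a else g a := by
  refine (Computable.cond hp.decide hf hg).of_eq fun a => ?_
  by_cases h : p a <;> simp [h]

/-- The fold is a recursion on the number of entries read; an index lookup supplies the next one. -/
theorem computable_list_foldl {f : α → List β} {g : α → σ} {h : α → σ × β → σ}
    (hf : Computable f) (hg : Computable g) (hh : Computable₂ h) :
    Computable fun a => (f a).foldl (fun s b => h a (s, b)) (g a) := by
  have key : ∀ a n, (n.rec (g a) fun i s => ((f a)[i]?.casesOn s fun b => h a (s, b) : σ) : σ) =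
      ((f a).take n).foldl (fun s b => h a (s, b)) (g a) := by
    intro a n
    induction n with
    | zero => simp
    | succ n ih =>
      simp only [ih]
      rw [List.take_add_one, List.foldl_append]
      cases (f a)[n]? <;> simp
  have hstep : Computable₂ fun (a : α) (p : ℕ × σ) =>
      ((f a)[p.1]?.casesOn p.2 fun b => h a (p.2, b) : σ) := by
    refine Computable.option_casesOn (o := fun q : α × (ℕ × σ) => (f q.1)[q.2.1]?)
      (f := fun q => q.2.2) (g := fun q b => h q.1 (q.2.2, b)) ?_ ?_ ?_
    · exact Computable.list_getElem?.comp (hf.comp Computable.fst)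
        (Computable.fst.comp Computable.snd)
    · exact Computable.snd.comp Computable.snd
    · exact hh.comp (Computable.fst.comp Computable.fst)
        ((Computable.snd.comp (Computable.snd.comp Computable.fst)).pair Computable.snd)
  refine (Computable.nat_rec (Computable.list_length.comp hf) hg hstep).of_eq fun a => ?_
  rw [key, List.take_length]

/-- A function with a finite parameter is computable if it is so for each parameter. -/
theorem computable_of_finite [Finite γ] {f : γ → α → σ} (hf : ∀ i, Computable (f i)) :
    Computable₂ f := by
  classical
  have key : ∀ l : List γ, Computable fun p : γ × α => if p.1 ∈ l then some (f p.1 p.2) else none := by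
    intro l
    induction l with
    | nil => simpa using Computable.const none
    | cons a l ih =>
      refine (Computable.ite' (p := fun p : γ × α => p.1 = a)
        (computablePred_eq Computable.fst (Computable.const a))
        (Computable.option_some.comp ((hf a).comp Computable.snd)) ih).of_eq fun p => ?_
      by_cases h : p.1 = a <;> simp [h]
  have := Fintype.ofFinite γ
  refine Computable.option_some_iff.1 ((key (Finset.univ : Finset γ).toList).of_eq fun p => ?_)
  simp

theorem computablePred_of_finite [Finite γ] {p : γ → α → Prop}
    (hp : ∀ i, ComputablePred (p i)) : ComputablePred fun q : γ × α => p q.1 q.2 := by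
  classical
  exact Computable.computablePred (computable_of_finite fun i => (hp i).decide)

/-- Unbounded search. -/
theorem exists_computable_of_forall_exists {R : α → β → Prop}
    (hR : ComputablePred fun q : α × β => R q.1 q.2) (h : ∀ a, ∃ b, R a b) :
    ∃ f : α → β, Computable f ∧ ∀ a, R a (f a) := by
  classical
  have hP : ComputablePred fun q : α × ℕ =>
      ∃ b, (Encodable.decode q.2 : Option β) = some b ∧ R q.1 b :=
    computablePred_option (p := fun (q : α × ℕ) b => R q.1 b)
      (hR.comp_computable ((Computable.fst.comp Computable.fst).pair Computable.snd))
      (Computable.decode.comp Computable.snd)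
  have hex : ∀ a, ∃ n, ∃ b, (Encodable.decode n : Option β) = some b ∧ R a b := fun a => by
    obtain ⟨b, hb⟩ := h a
    exact ⟨Encodable.encode b, b, by simp, hb⟩
  have hf := Computable.find (P := fun a n => ∃ b, (Encodable.decode n : Option β) = some b ∧ R a b)
    hP hex
  choose f hf1 hf2 using fun a => Nat.find_spec (hex a)
  refine ⟨f, Computable.option_some_iff.1 ((Computable.decode.comp hf).of_eq fun a => hf1 a), hf2⟩

/-- Unbounded search on a decidable domain. -/
theorem exists_computable_option {D : α → Prop} {R : α → β → Prop} (hD : ComputablePred D)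
    (hR : ComputablePred fun q : α × β => R q.1 q.2) (h : ∀ a, D a → ∃ b, R a b) :
    ∃ f : α → Option β, Computable f ∧ (∀ a, D a → ∃ b, f a = some b ∧ R a b) ∧
      ∀ a, ¬ D a → f a = none := by
  classical
  have hR' : ComputablePred fun q : α × Option β =>
      (∃ b, q.2 = some b ∧ (D q.1 ∧ R q.1 b)) ∨ (¬ D q.1 ∧ q.2 = none) := by
    refine ComputablePred.or' ?_ (ComputablePred.and' (hD.comp_computable Computable.fst).not
      (computablePred_eq Computable.snd (Computable.const none)))
    refine computablePred_option (p := fun (q : α × Option β) b => D q.1 ∧ R q.1 b) ?_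
      Computable.snd
    exact ComputablePred.and' (hD.comp_computable (Computable.fst.comp Computable.fst))
      (hR.comp_computable ((Computable.fst.comp Computable.fst).pair Computable.snd))
  obtain ⟨f, hf, hf'⟩ := exists_computable_of_forall_exists
    (R := fun a o => (∃ b, o = some b ∧ (D a ∧ R a b)) ∨ (¬ D a ∧ o = none)) hR' (by
      intro a
      by_cases ha : D a
      · obtain ⟨b, hb⟩ := h a ha
        exact ⟨some b, Or.inl ⟨b, rfl, ha, hb⟩⟩
      · exact ⟨none, Or.inr ⟨ha, rfl⟩⟩)
  refine ⟨f, hf, fun a ha => ?_, fun a ha => ?_⟩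
  · rcases hf' a with ⟨b, h1, -, h2⟩ | ⟨h1, -⟩
    exacts [⟨b, h1, h2⟩, absurd ha h1]
  · rcases hf' a with ⟨b, -, h1, -⟩ | ⟨-, h1⟩
    exacts [absurd h1 ha, h1]

theorem computable_list_map [Finite β] {f : α → List β} (hf : Computable f) (c : β → γ) :
    Computable fun a => (f a).map c :=
  (Primrec.list_map Primrec.id ((Primrec.dom_finite c).comp Primrec.snd).to₂).to_comp.comp hf

theorem computable_list_flatMap [Finite β] {f : α → List β} (hf : Computable f) (c : β → List γ) :
    Computable fun a => (f a).flatMap c :=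
  (Primrec.list_flatMap Primrec.id ((Primrec.dom_finite c).comp Primrec.snd).to₂).to_comp.comp hf

end Computability

/-! ## Locally decidable subsets of a group -/

section LocDec

variable {H : Type*} [Group H]

/-- The value of a word over a family of group elements. -/
def ev {α : Type*} (s : α → H) (w : List α) : H := (w.map s).prod

section ev

variable {α β : Type*}

@[simp] theorem ev_nil (s : α → H) : ev s [] = 1 := rfl

@[simp] theorem ev_cons (s : α → H) (a : α) (w : List α) : ev s (a :: w) = s a * ev s w := by
  simp [ev]

@[simp] theorem ev_append (s : α → H) (v w : List α) : ev s (v ++ w) = ev s v * ev s w := by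
  simp [ev]

theorem ev_map (s : β → H) (c : α → β) (w : List α) : ev s (w.map c) = ev (s ∘ c) w := by
  simp [ev]

theorem ev_flatMap (s : β → H) (c : α → List β) (w : List α) :
    ev s (w.flatMap c) = ev (fun a => ev s (c a)) w := by
  induction w with
  | nil => rfl
  | cons a w ih => simp [ih]

theorem ev_mem {F : Subgroup H} {s : α → H} (hs : ∀ i, s i ∈ F) (w : List α) : ev s w ∈ F :=
  Subgroup.list_prod_mem _ (by simp only [List.mem_map]; rintro _ ⟨i, -, rfl⟩; exact hs i)

theorem ev_reverse_inv (s : α → H) (w : List α) :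
    ev (fun a => (s a)⁻¹) w.reverse = (ev s w)⁻¹ := by
  induction w with
  | nil => simp
  | cons a w ih => simp [ih]

end ev

/-- Membership in `T` is decidable for words over any finite family of elements of `F`. -/
def LocDec (F : Subgroup H) (T : Set H) : Prop :=
  ∀ (k : ℕ) (s : Fin k → H), (∀ i, s i ∈ F) → ComputablePred fun w : List (Fin k) => ev s w ∈ T

variable {F B : Subgroup H} {T : Set H}

theorem LocDec.comp {α β : Type*} [Primcodable α] [Primcodable β] [Finite β] (hT : LocDec F T)
    {s : β → H} (hs : ∀ i, s i ∈ F) {h : α → List β} (hh : Computable h) :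
    ComputablePred fun a => ev s (h a) ∈ T := by
  obtain ⟨k, ⟨e⟩⟩ := Finite.exists_equiv_fin β
  have := (hT k (s ∘ e.symm) fun i => hs _).comp_computable (computable_list_map hh e)
  refine this.of_eq fun a => ?_
  rw [ev_map]
  simp [Function.comp_def]

theorem LocDec.congr {T' : Set H} (hT : LocDec F T) (h : ∀ g ∈ F, g ∈ T ↔ g ∈ T') :
    LocDec F T' :=
  fun k s hs => (hT k s hs).of_eq fun w => h _ (ev_mem hs w)

/-- The two fixed elements are added to the alphabet as extra letters. -/
theorem LocDec.translate (hT : LocDec F T) {c d : H} (hc : c ∈ F) (hd : d ∈ F) :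
    LocDec F {g | c * g * d ∈ T} := by
  intro k s hs
  have := hT.comp (s := Sum.elim s fun b : Bool => if b then c else d)
    (by rintro (i | (_ | _)) <;> simp [hs, hc, hd])
    (h := fun w : List (Fin k) => Sum.inr true :: (w.map Sum.inl ++ [Sum.inr false]))
    (Computable.list_cons.comp (Computable.const _)
      (Computable.list_append.comp (computable_list_map Computable.id _) (Computable.const _)))
  refine this.of_eq fun w => ?_
  rw [ev_cons, ev_append, ev_map]
  simp [mul_assoc, Function.comp_def]

/-- Appending the formal inverse of the second word reduces equality to the word problem. -/
theorem LocDec.eq {α β γ : Type*} [Primcodable α] [Primcodable β] [Primcodable γ] [Finite α]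
    [Finite β] (hT : LocDec F {1}) {s : α → H} {t : β → H} (hs : ∀ i, s i ∈ F)
    (ht : ∀ i, t i ∈ F) {f : γ → List α} {g : γ → List β} (hf : Computable f)
    (hg : Computable g) : ComputablePred fun a => ev s (f a) = ev t (g a) := by
  have := hT.comp (s := Sum.elim s fun b => (t b)⁻¹)
    (by rintro (i | i) <;> simp [hs, ht])
    (h := fun a => (f a).map Sum.inl ++ ((g a).reverse.map Sum.inr))
    (Computable.list_append.comp (computable_list_map hf _)
      (computable_list_map (Computable.list_reverse.comp hg) _))
  refine this.of_eq fun w => ?_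
  have h1 : (Sum.elim s fun b => (t b)⁻¹) ∘ Sum.inr = fun b => (t b)⁻¹ := rfl
  have h2 : (Sum.elim s fun b => (t b)⁻¹) ∘ Sum.inl = s := rfl
  rw [ev_append, ev_map, ev_map, h1, h2, ev_reverse_inv, Set.mem_singleton_iff, mul_inv_eq_one]

/-- The intersection of a finitely generated subgroup of `F` with `B` is contained in a finitely
generated submonoid of `B`. -/
def FinInter (F B : Subgroup H) : Prop :=
  ∀ (k : ℕ) (s : Fin k → H), (∀ i, s i ∈ F) → ∃ (n : ℕ) (t : Fin n → H), (∀ i, t i ∈ B) ∧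
    ∀ w, ev s w ∈ B → ∃ v, ev t v = ev s w

theorem FinInter.trans {C : Subgroup H} (h : FinInter F B) (h' : FinInter B C) (hCB : C ≤ B) :
    FinInter F C := by
  intro k s hs
  obtain ⟨n, t, ht, h1⟩ := h k s hs
  obtain ⟨m, r, hr, h2⟩ := h' n t ht
  refine ⟨m, r, hr, fun w hw => ?_⟩
  obtain ⟨v, hv⟩ := h1 w (hCB hw)
  obtain ⟨u, hu⟩ := h2 v (hv ▸ hw)
  exact ⟨u, hu.trans hv⟩

theorem FinInter.refl (F : Subgroup H) : FinInter F F := fun k s hs => ⟨k, s, hs, fun w _ => ⟨w, rfl⟩⟩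

/-- Words with values in `B` can be rewritten over a family of elements of `B`. -/
theorem exists_computable_rewrite (h1 : LocDec F {1}) (hB : LocDec F (B : Set H)) (hBF : B ≤ F)
    (hfg : FinInter F B) {k : ℕ} {s : Fin k → H} (hs : ∀ i, s i ∈ F) :
    ∃ (n : ℕ) (t : Fin n → H), (∀ i, t i ∈ B) ∧
      ∃ f : List (Fin k) → Option (List (Fin n)), Computable f ∧
        (∀ w, ev s w ∈ B → ∃ v, f w = some v ∧ ev t v = ev s w) ∧ ∀ w, ev s w ∉ B → f w = none := by
  obtain ⟨n, t, ht, h⟩ := hfg k s hs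
  refine ⟨n, t, ht, exists_computable_option (D := fun w => ev s w ∈ B)
    (R := fun w v => ev t v = ev s w) (hB k s hs) ?_ h⟩
  exact h1.eq (fun i => hBF (ht i)) hs Computable.snd Computable.fst

/-- Membership in `B` is tested first; a word that passes is rewritten over elements of `B`, where
`T` is decidable. -/
theorem LocDec.trans (h1 : LocDec F {1}) (hB : LocDec F (B : Set H)) (hBF : B ≤ F)
    (hfg : FinInter F B) (hT : LocDec B T) (hTB : T ⊆ B) : LocDec F T := by
  intro k s hs
  obtain ⟨n, t, ht, f, hf, h2, h3⟩ := exists_computable_rewrite h1 hB hBF hfg hs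
  have := computablePred_option (p := fun (_ : List (Fin k)) v => ev t v ∈ T)
    ((hT n t ht).comp_computable Computable.snd) hf
  refine this.of_eq fun w => ?_
  by_cases hw : ev s w ∈ B
  · obtain ⟨v, h4, h5⟩ := h2 w hw
    rw [h4, ← h5]
    simp
  · rw [h3 w hw]
    simp only [reduceCtorEq, false_and, exists_false, false_iff]
    exact fun h => hw (hTB h)

end LocDec

/-! ## Reduction of stacks is computable -/

section Britton

variable {H : Type*} [Group H]

/-- `F` is generated by `B` and a symmetric set `U`, and stacks without cancellation have a well
defined length. -/
structure BrittonPair (F B : Subgroup H) (U : Set H) (len : H → ℕ) : Prop where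
  inv : ∀ u ∈ U, u⁻¹ ∈ U
  gen : ∀ g ∈ F, g ∈ Subgroup.closure ((B : Set H) ∪ U)
  length : ∀ (St : List (H × H)) (b : H), (∀ p ∈ St, p.1 ∈ B ∧ p.2 ∈ U) → b ∈ B →
    (St.IsChain fun p q => q.2 * p.1 * p.2 ∉ B) → len (stackProd St * b) = St.length

variable {F B : Subgroup H} {U : Set H} {len : H → ℕ}

/-- The cancellation of two given stable letters is computable. -/
theorem exists_computable_cancel (hB : LocDec B {1}) {u v : H}
    (hA : LocDec B {b | u * b * u⁻¹ ∈ B})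
    (hfg : ∃ T : List H, (∀ x ∈ T, x ∈ B ∧ u * x * u⁻¹ ∈ B) ∧
      ∀ b ∈ B, u * b * u⁻¹ ∈ B → b ∈ Submonoid.closure {x | x ∈ T}) :
    ∃ T : List H, (∀ x ∈ T, x ∈ B) ∧ ∀ (n : ℕ) (t : Fin n → H), (∀ i, t i ∈ B) →
      (∀ x ∈ T, ∃ i, t i = x) →
      ∃ p : List (Fin n) → Option (List (Fin n)), Computable p ∧
        ∀ w, (∃ w', p w = some w' ∧ ev t w' = u * ev t w * v) ∨
          (p w = none ∧ u * ev t w * v ∉ B) := by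
  -- All solutions form a single coset: if `f₀` is one, then `b` is one exactly when `u` conjugates
  -- `b * f₀⁻¹` into `B`. The choice of `f₀` depends on `u` and `v` only and need not be effective.
  by_cases hex : ∃ f₀ ∈ B, u * f₀ * v ∈ B
  · obtain ⟨f₀, hf₀, hg₀⟩ := hex
    obtain ⟨T, hT, hT'⟩ := hfg
    -- Once `b` is spelled as a product of elements of `T` times `f₀`, the value `u * b * v` is the
    -- product of their conjugates times `u * f₀ * v`. The alphabet has to contain all of these.
    refine ⟨f₀ :: (u * f₀ * v) :: (T ++ T.map fun x => u * x * u⁻¹), ?_, ?_⟩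
    · intro x hx
      simp only [List.mem_cons, List.mem_append, List.mem_map] at hx
      rcases hx with rfl | rfl | hx | ⟨y, hy, rfl⟩
      exacts [hf₀, hg₀, (hT x hx).1, (hT y hy).2]
    · intro n t ht hcov
      obtain ⟨i₀, hi₀⟩ := hcov f₀ (by simp)
      obtain ⟨i₁, hi₁⟩ := hcov (u * f₀ * v) (by simp)
      have h1 : ∀ i : Fin T.length, ∃ j, t j = T.get i := fun i => hcov _ (by simp)
      have h2 : ∀ i : Fin T.length, ∃ j, t j = u * T.get i * u⁻¹ := fun i =>
        hcov _ (by
          simp only [List.mem_cons, List.mem_append, List.mem_map]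
          exact Or.inr (Or.inr (Or.inr ⟨T.get i, List.get_mem _ _, rfl⟩)))
      choose c hc using h1
      choose d hd using h2
      have hconj : ∀ a : List (Fin T.length),
          ev t (a.map d) = u * ev t (a.map c) * u⁻¹ := by
        intro a
        induction a with
        | nil => simp
        | cons i a ih => simp [ih, hc, hd, mul_assoc]
      have key : ∀ w : List (Fin n), u * ev t w * v ∈ B ↔
          u * (ev t w * f₀⁻¹) * u⁻¹ ∈ B := by
        intro w
        have : u * ev t w * v = u * (ev t w * f₀⁻¹) * u⁻¹ * (u * f₀ * v) := by group
        rw [this, B.mul_mem_cancel_right hg₀]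
      have hD : ComputablePred fun w : List (Fin n) => u * ev t w * v ∈ B := by
        refine ((hA.translate B.one_mem (B.inv_mem hf₀)) n t ht).of_eq fun w => ?_
        rw [key]
        simp
      obtain ⟨f, hf, hf1, hf2⟩ := exists_computable_option (D := fun w => u * ev t w * v ∈ B)
        (R := fun w (a : List (Fin T.length)) => ev t (a.map c ++ [i₀]) = ev t w) hD
        (hB.eq ht ht (Computable.list_append.comp (computable_list_map Computable.snd c)
          (Computable.const _)) Computable.fst) (by
          intro w hw
          obtain ⟨l, hl, hl2⟩ := Submonoid.exists_list_of_mem_closure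
            (hT' _ (B.mul_mem (ev_mem ht w) (B.inv_mem hf₀)) ((key w).1 hw))
          have hl3 : ∃ a : List (Fin T.length), a.map T.get = l := by
            have : l ∈ Set.range (List.map T.get) := by
              rw [Set.range_list_map]
              intro x hx
              obtain ⟨i, hi⟩ := List.get_of_mem (hl x hx)
              exact ⟨i, hi⟩
            exact this
          obtain ⟨a, rfl⟩ := hl3
          refine ⟨a, ?_⟩
          have h3 : ev t (a.map c) = (a.map T.get).prod := by
            rw [ev, List.map_map]
            congr 1
            exact List.map_congr_left fun i _ => hc i
          rw [ev_append, h3, hl2, ev_cons, ev_nil, hi₀]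
          group)
      refine ⟨fun w => (f w).map fun a => a.map d ++ [i₁],
        Computable.option_map hf (Computable.list_append.comp
          (computable_list_map Computable.snd d) (Computable.const _)).to₂, fun w => ?_⟩
      by_cases hw : u * ev t w * v ∈ B
      · obtain ⟨a, h3, h4⟩ := hf1 w hw
        refine Or.inl ⟨a.map d ++ [i₁], by simp [h3], ?_⟩
        rw [ev_append, ev_cons, ev_nil, hi₀] at h4
        rw [ev_append, ev_cons, ev_nil, hi₁, hconj, ← h4]
        group
      · exact Or.inr ⟨by simp [hf2 w hw], hw⟩
  · refine ⟨[], by simp, fun n t ht _ => ⟨fun _ => none, Computable.const _, fun w => Or.inr ⟨rfl, ?_⟩⟩⟩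
    exact fun h => hex ⟨_, ev_mem ht w, h⟩

/-! ### A stack machine that carries out Britton reduction. -/

section Machine

variable {m n : ℕ}

/-- One step of the stack machine, for a given cancellation function. -/
def pushStep (pin : Fin m × Fin m → List (Fin n) → Option (List (Fin n)))
    (q : List (List (Fin n) × Fin m) × List (Fin n)) :
    Fin m ⊕ Fin n → List (List (Fin n) × Fin m) × List (Fin n)
  | Sum.inr j => (q.1, q.2 ++ [j])
  | Sum.inl j =>
    (q.1.head?.bind fun p => (pin (p.2, j) q.2).map fun f => (q.1.tail, p.1 ++ f)).getD
      ((q.2, j) :: q.1, [])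

theorem computable_pushStep {pin : Fin m × Fin m → List (Fin n) → Option (List (Fin n))}
    (hpin : Computable₂ pin) : Computable₂ (pushStep pin) := by
  have h1 : Computable fun r : (List (List (Fin n) × Fin m) × List (Fin n)) × (Fin m ⊕ Fin n) =>
      (r.2.casesOn
        (fun j => (r.1.1.head?.bind fun p =>
          (pin (p.2, j) r.1.2).map fun f => (r.1.1.tail, p.1 ++ f)).getD
            ((r.1.2, j) :: r.1.1, []))
        (fun j => (r.1.1, r.1.2 ++ [j])) : List (List (Fin n) × Fin m) × List (Fin n)) := by
    refine Computable.sumCasesOn Computable.snd ?_ ?_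
    · refine Computable.option_getD ?_ ?_
      · refine Computable.option_bind (Primrec.list_head?.to_comp.comp
          (Computable.fst.comp (Computable.fst.comp Computable.fst))) ?_
        refine Computable.option_map (f := fun x :
          (((List (List (Fin n) × Fin m) × List (Fin n)) × (Fin m ⊕ Fin n)) × Fin m) ×
            (List (Fin n) × Fin m) => pin (x.2.2, x.1.2) x.1.1.1.2)
          (g := fun x f => (x.1.1.1.1.tail, x.2.1 ++ f)) ?_ ?_
        · exact hpin.comp ((Computable.snd.comp Computable.snd).pair
            (Computable.snd.comp Computable.fst))
            (Computable.snd.comp (Computable.fst.comp (Computable.fst.comp Computable.fst)))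
        · refine Computable.pair (Primrec.list_tail.to_comp.comp (Computable.fst.comp
            (Computable.fst.comp (Computable.fst.comp (Computable.fst.comp Computable.fst))))) ?_
          exact Computable.list_append.comp (Computable.fst.comp
            (Computable.snd.comp Computable.fst)) Computable.snd
      · refine Computable.pair (Computable.list_cons.comp (Computable.pair ?_ Computable.snd) ?_)
          (Computable.const _)
        · exact Computable.snd.comp (Computable.fst.comp Computable.fst)
        · exact Computable.fst.comp (Computable.fst.comp Computable.fst)
    · refine Computable.pair (Computable.fst.comp (Computable.fst.comp Computable.fst)) ?_
      exact Computable.list_concat.comp (Computable.snd.comp (Computable.fst.comp Computable.fst))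
        Computable.snd
  refine h1.of_eq fun r => ?_
  rcases r with ⟨q, j | j⟩ <;> rfl

/-- The group element of a state of the stack machine. -/
def stateVal (u : Fin m → H) (t : Fin n → H) (q : List (List (Fin n) × Fin m) × List (Fin n)) : H :=
  stackProd (q.1.map fun p => (ev t p.1, u p.2)) * ev t q.2

variable {u : Fin m → H} {t : Fin n → H}
  {pin : Fin m × Fin m → List (Fin n) → Option (List (Fin n))}

/-- The invariant of the machine: a step multiplies the value by the letter read and leaves no
cancelling neighbours. After a cancellation the word stored below the removed letter is joined with
the result and becomes the current word over `B`. -/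
theorem pushStep_spec
    (hpin : ∀ i j w, (∃ w', pin (i, j) w = some w' ∧ ev t w' = u i * ev t w * u j) ∨
      (pin (i, j) w = none ∧ u i * ev t w * u j ∉ B))
    (q : List (List (Fin n) × Fin m) × List (Fin n)) (x : Fin m ⊕ Fin n)
    (hq : q.1.IsChain fun p p' => u p'.2 * ev t p.1 * u p.2 ∉ B) :
    stateVal u t (pushStep pin q x) = stateVal u t q * Sum.elim u t x ∧
      (pushStep pin q x).1.IsChain fun p p' => u p'.2 * ev t p.1 * u p.2 ∉ B := by
  obtain ⟨St, w⟩ := q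
  rcases x with j | j
  · cases St with
    | nil =>
      refine ⟨?_, List.isChain_singleton _⟩
      simp [pushStep, stateVal, stackProd]
    | cons p St =>
      rcases hpin p.2 j w with ⟨w', h1, h2⟩ | ⟨h1, h2⟩
      · have h3 : pushStep pin (p :: St, w) (Sum.inl j) = (St, p.1 ++ w') := by
          simp [pushStep, h1]
        rw [h3]
        refine ⟨?_, hq.tail⟩
        simp [stateVal, stackProd, h2, mul_assoc]
      · have h3 : pushStep pin (p :: St, w) (Sum.inl j) = ((w, j) :: p :: St, []) := by
          simp [pushStep, h1]
        rw [h3]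
        refine ⟨?_, List.isChain_cons_cons.2 ⟨h2, hq⟩⟩
        simp [stateVal, stackProd, mul_assoc]
  · refine ⟨?_, hq⟩
    simp [pushStep, stateVal, mul_assoc]

theorem foldl_pushStep_spec
    (hpin : ∀ i j w, (∃ w', pin (i, j) w = some w' ∧ ev t w' = u i * ev t w * u j) ∨
      (pin (i, j) w = none ∧ u i * ev t w * u j ∉ B))
    (w : List (Fin m ⊕ Fin n)) (q : List (List (Fin n) × Fin m) × List (Fin n))
    (hq : q.1.IsChain fun p p' => u p'.2 * ev t p.1 * u p.2 ∉ B) :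
    stateVal u t (w.foldl (pushStep pin) q) = stateVal u t q * ev (Sum.elim u t) w ∧
      (w.foldl (pushStep pin) q).1.IsChain fun p p' => u p'.2 * ev t p.1 * u p.2 ∉ B := by
  induction w generalizing q with
  | nil => simpa using hq
  | cons x w ih =>
    obtain ⟨h1, h2⟩ := pushStep_spec hpin q x hq
    obtain ⟨h3, h4⟩ := ih _ h2
    exact ⟨by rw [List.foldl_cons, h3, h1, ev_cons, mul_assoc], h4⟩

end Machine

/-- The length of group elements, and words for the elements of length zero, are computable. -/
theorem BrittonPair.exists_computable (hp : BrittonPair F B U len) (hB : LocDec B {1})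
    (hA : ∀ u ∈ U, LocDec B {b | u * b * u⁻¹ ∈ B})
    (hfg : ∀ u ∈ U, ∃ T : List H, (∀ x ∈ T, x ∈ B ∧ u * x * u⁻¹ ∈ B) ∧
      ∀ b ∈ B, u * b * u⁻¹ ∈ B → b ∈ Submonoid.closure {x | x ∈ T})
    {k : ℕ} {s : Fin k → H} (hs : ∀ i, s i ∈ F) :
    ∃ (n : ℕ) (t : Fin n → H), (∀ i, t i ∈ B) ∧
      ∃ f : List (Fin k) → ℕ × List (Fin n), Computable f ∧ ∀ w, (f w).1 = len (ev s w) ∧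
        (ev s w ∈ B ↔ (f w).1 = 0) ∧ ((f w).1 = 0 → ev t (f w).2 = ev s w) := by
  have hfac : ∀ i, ∃ l : List H, (∀ x ∈ l, x ∈ U ∨ x ∈ B) ∧ l.prod = s i := by
    intro i
    have hmem : s i ∈ Submonoid.closure (((B : Set H) ∪ U) ∪ ((B : Set H) ∪ U)⁻¹) := by
      rw [← Subgroup.closure_toSubmonoid]
      exact hp.gen _ (hs i)
    obtain ⟨l, h1, h2⟩ := Submonoid.exists_list_of_mem_closure hmem
    refine ⟨l, fun x hx => ?_, h2⟩
    rcases h1 x hx with (h | h) | (h | h)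
    · exact Or.inr h
    · exact Or.inl h
    · exact Or.inr (inv_mem_iff.1 h)
    · exact Or.inl (by simpa using hp.inv _ h)
  choose l hl hls using hfac
  classical
  set all : List H := (List.ofFn l).flatten with hall
  set LU : List H := all.filter (· ∈ U) with hLU
  have hLU' : ∀ i : Fin LU.length, LU.get i ∈ U := fun i => by
    have h : ∀ x ∈ LU, x ∈ U := fun x hx => by
      rw [hLU, List.mem_filter] at hx
      simpa using hx.2
    exact h _ (List.get_mem LU i)
  choose T hT hT' using fun ij : Fin LU.length × Fin LU.length =>
    exists_computable_cancel hB (v := LU.get ij.2) (hA _ (hLU' ij.1)) (hfg _ (hLU' ij.1))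
  -- Besides the factors of the input letters, the alphabet includes every element that a
  -- cancellation may need. It is closed under all steps, so the machine never leaves it.
  set LB : List H := all.filter (· ∈ B) ++
    ((Finset.univ : Finset (Fin LU.length × Fin LU.length)).toList.map T).flatten with hLB
  have hLB' : ∀ i : Fin LB.length, LB.get i ∈ B := fun i => by
    have h : ∀ x ∈ LB, x ∈ B := fun x hx => by
      rw [hLB, List.mem_append] at hx
      rcases hx with h | h
      · simpa using (List.mem_filter.1 h).2
      · obtain ⟨l', h1, h2⟩ := List.mem_flatten.1 h
        obtain ⟨ij, -, rfl⟩ := List.mem_map.1 h1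
        exact hT ij _ h2
    exact h _ (List.get_mem LB i)
  choose p hpc hps using fun ij => hT' ij LB.length LB.get hLB' (fun x hx => by
    have : x ∈ LB := by
      rw [hLB, List.mem_append, List.mem_flatten]
      exact Or.inr ⟨T ij, List.mem_map.2 ⟨ij, by simp, rfl⟩, hx⟩
    exact List.get_of_mem this)
  have hword : ∀ i, ∃ c : List (Fin LU.length ⊕ Fin LB.length),
      ev (Sum.elim LU.get LB.get) c = s i := by
    intro i
    have : l i ∈ Set.range (List.map (Sum.elim LU.get LB.get)) := by
      rw [Set.range_list_map]
      intro x hx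
      have hxall : x ∈ all := by
        rw [hall, List.mem_flatten]
        exact ⟨l i, List.mem_ofFn.2 ⟨i, rfl⟩, hx⟩
      rcases hl i x hx with h | h
      · have : x ∈ LU := by rw [hLU, List.mem_filter]; simpa [hxall] using h
        obtain ⟨j, hj⟩ := List.get_of_mem this
        exact ⟨Sum.inl j, hj⟩
      · have : x ∈ LB := by
          rw [hLB, List.mem_append, List.mem_filter]; left; simpa [hxall] using h
        obtain ⟨j, hj⟩ := List.get_of_mem this
        exact ⟨Sum.inr j, hj⟩
    obtain ⟨c, hc⟩ := this
    exact ⟨c, by rw [ev, hc, hls]⟩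
  choose c hc using hword
  refine ⟨LB.length, LB.get, hLB', fun w =>
    (((w.flatMap c).foldl (pushStep p) ([], [])).1.length,
      ((w.flatMap c).foldl (pushStep p) ([], [])).2), ?_, fun w => ?_⟩
  · have h1 : Computable fun w : List (Fin k) => (w.flatMap c).foldl (pushStep p) ([], []) := by
      refine computable_list_foldl (h := fun _ q => pushStep p q.1 q.2)
        (computable_list_flatMap Computable.id c) (Computable.const _) ?_
      exact (computable_pushStep (computable_of_finite hpc)).comp
        (Computable.fst.comp Computable.snd) (Computable.snd.comp Computable.snd)
    exact (Computable.list_length.comp (Computable.fst.comp h1)).pair (Computable.snd.comp h1)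
  · obtain ⟨h1, h2⟩ := foldl_pushStep_spec (B := B) (u := LU.get) (t := LB.get) (pin := p)
      (fun i j w => hps (i, j) w) (w.flatMap c) ([], []) List.isChain_nil
    beta_reduce
    generalize (w.flatMap c).foldl (pushStep p) ([], []) = q at h1 h2 ⊢
    have h3 : stateVal LU.get LB.get q = ev s w := by
      rw [h1, ev_flatMap]
      simp only [hc]
      simp [stateVal, stackProd]
    have h4 : len (ev s w) = q.1.length := by
      rw [← h3, stateVal, hp.length, List.length_map]
      · intro r hr
        obtain ⟨r, -, rfl⟩ := List.mem_map.1 hr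
        exact ⟨ev_mem hLB' _, hLU' _⟩
      · exact ev_mem hLB' _
      · rwa [List.isChain_map]
    have h5 : q.1.length = 0 → ev LB.get q.2 = ev s w := by
      intro h
      rw [← h3, stateVal, List.length_eq_zero_iff.1 h]
      simp [stackProd]
    refine ⟨h4.symm, ⟨fun h => ?_, fun h => ?_⟩, h5⟩
    · rw [← h4]
      simpa [stackProd] using hp.length [] (ev s w) (by simp) h List.isChain_nil
    · rw [← h5 h]
      exact ev_mem hLB' _

section

variable (hp : BrittonPair F B U len) (hB : LocDec B {1})
    (hA : ∀ u ∈ U, LocDec B {b | u * b * u⁻¹ ∈ B})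
    (hfg : ∀ u ∈ U, ∃ T : List H, (∀ x ∈ T, x ∈ B ∧ u * x * u⁻¹ ∈ B) ∧
      ∀ b ∈ B, u * b * u⁻¹ ∈ B → b ∈ Submonoid.closure {x | x ∈ T})
include hp hB hA hfg

theorem BrittonPair.locDec : LocDec F (B : Set H) := by
  intro k s hs
  obtain ⟨n, t, ht, f, hf, h⟩ := hp.exists_computable hB hA hfg hs
  exact (computablePred_eq (Computable.fst.comp hf) (Computable.const 0)).of_eq
    fun w => (h w).2.1.symm

theorem BrittonPair.locDec_one : LocDec F {1} := by
  intro k s hs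
  obtain ⟨n, t, ht, f, hf, h⟩ := hp.exists_computable hB hA hfg hs
  refine ((computablePred_eq (Computable.fst.comp hf) (Computable.const 0)).and'
    ((hB n t ht).comp_computable (Computable.snd.comp hf))).of_eq fun w => ?_
  constructor
  · rintro ⟨h1, h2⟩
    rwa [(h w).2.2 h1] at h2
  · intro h1
    rw [Set.mem_singleton_iff] at h1
    have h2 : (f w).1 = 0 := (h w).2.1.1 (h1 ▸ B.one_mem)
    exact ⟨h2, by rw [(h w).2.2 h2, h1]; rfl⟩

theorem BrittonPair.finInter : FinInter F B := by
  intro k s hs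
  obtain ⟨n, t, ht, f, hf, h⟩ := hp.exists_computable hB hA hfg hs
  exact ⟨n, t, ht, fun w hw => ⟨(f w).2, (h w).2.2 ((h w).2.1.1 hw)⟩⟩

theorem BrittonPair.computable_len {k : ℕ} {s : Fin k → H} (hs : ∀ i, s i ∈ F) :
    Computable fun w => len (ev s w) := by
  obtain ⟨n, t, ht, f, hf, h⟩ := hp.exists_computable hB hA hfg hs
  exact (Computable.fst.comp hf).of_eq fun w => (h w).1

end

end Britton

/-! ## The filtration by degree -/

section Filtration

variable {G : Type*} [Group G] {Sig : Set G}

variable (Sig) in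
/-- The subgroup generated by the words of degree at most `n`. -/
noncomputable def Fil {n D : ℕ} (h : n ≤ D) : Subgroup (E Sig D) := (upTo h).range

theorem Good.cl_mem {n D : ℕ} (h : n ≤ D) {u : AWord (Letter Sig)} (hu : Good n u) :
    cl D u ∈ Fil Sig h :=
  ⟨cl n u, upTo_cl h hu⟩

theorem Fil.mono {m n D : ℕ} (hmn : m ≤ n) (h : n ≤ D) :
    Fil Sig (hmn.trans h) ≤ Fil Sig h := by
  rintro _ ⟨g, rfl⟩
  exact ⟨upTo hmn g, upTo_upTo _ _ _⟩

open Classical in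
/-- The number of syllables of degree `n + 1`, for elements of the group of words of degree at
most `n + 1`. -/
noncomputable def degLen {n D : ℕ} (h : n + 1 ≤ D) (g : E Sig D) : ℕ :=
  if hg : ∃ g', upTo h g' = g then syl (faithful n) hg.choose else 0

theorem degLen_upTo {n D : ℕ} (h : n + 1 ≤ D) (g : E Sig (n + 1)) :
    degLen h (upTo h g) = syl (faithful n) g := by
  have hg : ∃ g', upTo h g' = upTo h g := ⟨g, rfl⟩
  rw [degLen, dif_pos hg, upTo_injective h hg.choose_spec]

theorem degLen_cl_mul {n D : ℕ} (h : n + 1 ≤ D) {z : AWord (Letter Sig)} (hz : Good (n + 1) z)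
    {b : E Sig D} (hb : b ∈ Fil Sig (n.le_succ.trans h)) :
    (degLen h (cl D z * b) : ℤ) = lc n z := by
  obtain ⟨b, rfl⟩ := hb
  rw [← upTo_cl h hz, ← upTo_upTo n.le_succ h, ← map_mul, degLen_upTo, syl_cl_mul _ hz]

theorem stackProd_map {H K : Type*} [Group H] [Group K] (φ : H →* K) (St : List (H × H)) :
    stackProd (St.map fun p => (φ p.1, φ p.2)) = φ (stackProd St) := by
  induction St with
  | nil => simp [stackProd]
  | cons p St ih => simp [stackProd, ih]

/-- The classes of words of degree `n + 1` with leading coefficient one. -/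
def leadSet (Sig : Set G) (n D : ℕ) : Set (E Sig D) := cl D '' {u | Lead n u}

theorem mem_closure_of_good {n D : ℕ} (h : n + 1 ≤ D) {u : AWord (Letter Sig)}
    (hu : Good (n + 1) u) :
    cl D u ∈ Subgroup.closure ((Fil Sig (n.le_succ.trans h) : Set (E Sig D)) ∪ leadSet Sig n D) := by
  obtain ⟨L, hL, rfl⟩ := exists_piece_factorization hu
  rw [cl_prod (hu.mono h)]
  refine Subgroup.list_prod_mem _ fun x hx => ?_
  obtain ⟨v, hv, rfl⟩ := List.mem_map.1 hx
  apply Subgroup.subset_closure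
  rcases (hL v hv).good_or_lead with hv | hv
  · exact Or.inl (hv.cl_mem _)
  · exact Or.inr ⟨v, hv, rfl⟩

/-- The syllable count of `E (n + 1)` is transported along its embedding into `E D`, so that all
levels are subgroups of one group. A pinch would put the product of the two stable letters and the
element between them into the smaller subgroup, so the chain condition excludes it. -/
theorem brittonPair {n D : ℕ} (h : n + 1 ≤ D) :
    BrittonPair (Fil Sig h) (Fil Sig (n.le_succ.trans h)) (leadSet Sig n D) (degLen h) where
  inv := by
    rintro _ ⟨u, hu, rfl⟩
    exact ⟨u.bar, hu.bar, cl_bar (hu.1.mono h)⟩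
  gen := by
    rintro _ ⟨g, rfl⟩
    obtain ⟨L, hL, rfl⟩ := exists_list_eq g
    rw [map_list_prod]
    refine Subgroup.list_prod_mem _ fun x hx => ?_
    simp only [List.mem_map] at hx
    obtain ⟨_, ⟨u, hu, rfl⟩, rfl⟩ := hx
    rw [upTo_cl h (hL u hu)]
    exact mem_closure_of_good h (hL u hu)
  length := by
    intro St b hSt hb hchain
    obtain ⟨b, rfl⟩ := hb
    have hlift : St ∈ Set.range (List.map fun p : E Sig n × {u : AWord (Letter Sig) // Lead n u} =>
        (upTo (n.le_succ.trans h) p.1, cl D p.2.1)) := by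
      rw [Set.range_list_map]
      rintro ⟨x, y⟩ hp
      obtain ⟨⟨x', rfl⟩, u, hu, rfl⟩ := hSt _ hp
      exact ⟨(x', ⟨u, hu⟩), rfl⟩
    obtain ⟨St, rfl⟩ := hlift
    have hmap : (St.map fun p => (upTo (n.le_succ.trans h) p.1, cl D p.2.1)) =
        (St.map fun p => (up n p.1, cl (n + 1) p.2.1)).map fun p => (upTo h p.1, upTo h p.2) := by
      rw [List.map_map]
      refine List.map_congr_left fun p _ => ?_
      simp only [Function.comp]
      rw [upTo_upTo, upTo_cl h p.2.2.1]
    rw [hmap, stackProd_map, ← upTo_upTo n.le_succ h, ← map_mul, degLen_upTo,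
      syl_stackProd, List.length_map, List.length_map]
    rw [List.isChain_map] at hchain
    refine hchain.imp fun p q hpq hpinch => hpq ?_
    obtain ⟨c, hc⟩ := hpinch.mul_eq q.2.2 p.2.2
    refine ⟨c, ?_⟩
    rw [← upTo_upTo n.le_succ h, hc, map_mul, map_mul, upTo_upTo, upTo_cl h q.2.2.1,
      upTo_cl h p.2.2.1]

/-! ### Long suffixes -/

section LongSuffix

variable {n : ℕ} {u : AWord (Letter Sig)}

/-- A property holds for all sufficiently long suffixes of `u` of degree at most `n`. -/
def ForLong (n : ℕ) (u : AWord (Letter Sig)) (Q : AWord (Letter Sig) → Prop) : Prop :=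
  ∃ q y, u = q * y ∧ Good n y ∧ ∀ q z, u = q * (z * y) → Good n (z * y) → Q (z * y)

theorem ForLong.mono {Q Q' : AWord (Letter Sig) → Prop} (h : ForLong n u Q)
    (hQ : ∀ y, Q y → Q' y) : ForLong n u Q' := by
  obtain ⟨q, y, h1, h2, h3⟩ := h
  exact ⟨q, y, h1, h2, fun q z hq hz => hQ _ (h3 q z hq hz)⟩

theorem ForLong.exists {Q : AWord (Letter Sig) → Prop} (h : ForLong n u Q) :
    ∃ q y, u = q * y ∧ Good n y ∧ Q y := by
  obtain ⟨q, y, h1, h2, h3⟩ := h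
  exact ⟨q, y, h1, h2, by simpa using h3 q 1 (by simpa using h1) (by simpa using h2)⟩

theorem ForLong.and {Q Q' : AWord (Letter Sig) → Prop} (h : ForLong n u Q)
    (h' : ForLong n u Q') : ForLong n u fun y => Q y ∧ Q' y := by
  obtain ⟨q, y, h1, h2, h3⟩ := h
  obtain ⟨q', y', h1', h2', h3'⟩ := h'
  rcases le_total y.len y'.len with hl | hl
  · obtain ⟨v, rfl, -⟩ := AWord.levi_right (h1.symm.trans h1') hl
    refine ⟨q', v * y, h1', h2', fun q z hq hz => ⟨?_, h3' q z hq hz⟩⟩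
    rw [← mul_assoc z v y] at hq hz ⊢
    exact h3 q _ hq hz
  · obtain ⟨v, rfl, -⟩ := AWord.levi_right (h1'.symm.trans h1) hl
    refine ⟨q, v * y', h1, h2, fun q z hq hz => ⟨h3 q z hq hz, ?_⟩⟩
    rw [← mul_assoc z v y'] at hq hz ⊢
    exact h3' q _ hq hz

theorem ForLong.forall_list {α : Type*} {Q : α → AWord (Letter Sig) → Prop}
    (L : List α) (h : ∀ a ∈ L, ForLong n u (Q a)) : ForLong n u fun y => ∀ a ∈ L, Q a y := by
  induction L with
  | nil => exact ⟨u, 1, by simp, good_one n, by simp⟩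
  | cons a L ih =>
    refine ((h a (by simp)).and (ih fun b hb => h b (by simp [hb]))).mono fun y hy b hb => ?_
    rcases List.mem_cons.1 hb with rfl | hb
    exacts [hy.1, hy.2 b hb]

end LongSuffix

/-! ### Periods -/

/-- The suffixes `y` and `y'` of `u` are preceded by the same word of degree `n + 1`. -/
def Overlap (n : ℕ) (u y y' : AWord (Letter Sig)) : Prop :=
  ∃ x x' w, u = x * w * y ∧ u = x' * w * y' ∧ lc n w = 1

theorem Overlap.symm {n : ℕ} {u y y' : AWord (Letter Sig)} (h : Overlap n u y y') :
    Overlap n u y' y := by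
  obtain ⟨x, x', w, h1, h2, h3⟩ := h
  exact ⟨x', x, w, h2, h1, h3⟩

theorem Overlap.good {n : ℕ} {u y y' : AWord (Letter Sig)} (hu : Lead n u)
    (h : Overlap n u y y') : Good n y ∧ Good n y' := by
  obtain ⟨x, x', w, h1, h2, h3⟩ := h
  exact ⟨((h1 ▸ hu).outer h3).2.2, ((h2 ▸ hu).outer h3).2.2⟩

/-- The word `z` is a suffix of the common `w`. Moving it to the right of both cuts leaves a shorter
common word, still with leading coefficient one because `z` has degree at most `n`. -/
theorem Overlap.extend {n : ℕ} {u y y' q z : AWord (Letter Sig)} (hu : Lead n u)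
    (h : Overlap n u y y') (hq : u = q * (z * y)) (hz : z.deg ≤ n) :
    Overlap n u (z * y) (z * y') := by
  obtain ⟨x, x', w, h1, h2, h3⟩ := h
  have hw := ((h1 ▸ hu).outer h3).2.1
  have h4 : x * w = q * z := by
    apply AWord.mul_right_cancel' (q := y)
    rw [← h1, hq, mul_assoc]
  obtain ⟨v, rfl, -, h5⟩ := exists_suffix hw hz h4
  exact ⟨x, x', v, by simp only [h1, mul_assoc], by simp only [h2, mul_assoc], h5⟩

/-- The two common words both end where the suffix `y'` begins, so one is a suffix of the other and
the shorter one serves. -/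
theorem Overlap.trans {n : ℕ} {u y y' y'' : AWord (Letter Sig)}
    (h : Overlap n u y y') (h' : Overlap n u y' y'') : Overlap n u y y'' := by
  obtain ⟨x, x', w, h1, h2, h3⟩ := h
  obtain ⟨x₂, x₂', w₂, h4, h5, h6⟩ := h'
  have h7 := AWord.mul_right_cancel' (h2.symm.trans h4)
  rcases le_total w.len w₂.len with hl | hl
  · obtain ⟨v, rfl, -⟩ := AWord.levi_right h7 hl
    exact ⟨x, x₂' * v, w, h1, by rw [h5]; simp only [mul_assoc], h3⟩
  · obtain ⟨v, rfl, -⟩ := AWord.levi_right h7.symm hl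
    exact ⟨x * v, x₂', w₂, by rw [h1]; simp only [mul_assoc], h5, h6⟩

theorem overlap_refl {n : ℕ} {u q y : AWord (Letter Sig)} (hu : Lead n u) (hq : u = q * y)
    (hy : y.deg ≤ n) : Overlap n u y y := by
  refine ⟨1, 1, q, by simpa using hq, by simpa using hq, ?_⟩
  have := hu.2
  rwa [hq, lc_mul, lc_eq_zero hy, add_zero] at this

/-- `b` is the element of the group given by the period `h` at the end of `u`. -/
def Period (D n : ℕ) (u : AWord (Letter Sig)) (b : E Sig D) (h : ℤ[X]) : Prop :=
  ∃ y y', Overlap n u y y' ∧ b = (cl D y)⁻¹ * cl D y' ∧ h = y'.len - y.len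

section Period

variable {D n : ℕ} {u : AWord (Letter Sig)} {b b' : E Sig D} {h h' : ℤ[X]}

theorem Period.inv (hb : Period D n u b h) : Period D n u b⁻¹ (-h) := by
  obtain ⟨y, y', h1, rfl, rfl⟩ := hb
  exact ⟨y', y, h1.symm, by group, by ring⟩

theorem period_one (hu : Lead n u) : Period D n u 1 0 :=
  ⟨1, 1, overlap_refl (q := u) hu (by simp) (by simp), by simp, by simp⟩

/-- Suffixes of `u` of equal length coincide. -/
theorem Period.eq_one (hb : Period D n u b 0) : b = 1 := by
  obtain ⟨y, y', ⟨x, x', w, h1, h2, h3⟩, rfl, h4⟩ := hb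
  have := (AWord.eq_of_mul_eq_mul_right (h1.symm.trans h2) (sub_eq_zero.1 h4.symm).symm).2
  rw [this, inv_mul_cancel]

theorem cl_inv_mul_cl (hD : n ≤ D) {y y' z : AWord (Letter Sig)} (hy : Good n (z * y))
    (hy' : Good n (z * y')) : (cl D (z * y))⁻¹ * cl D (z * y') = (cl D y)⁻¹ * cl D y' := by
  rw [cl_mul (hy.mono hD), cl_mul (hy'.mono hD)]
  group

theorem Period.degree_le (hu : Lead n u) (hb : Period D n u b h) : h.degree ≤ n := by
  obtain ⟨y, y', h1, rfl, rfl⟩ := hb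
  have := h1.good hu
  exact (degree_sub_le _ _).trans (max_le this.2.2 this.1.2)

theorem Period.mem (hD : n ≤ D) (hu : Lead n u) (hb : Period D n u b h) : b ∈ Fil Sig hD := by
  obtain ⟨y, y', h1, rfl, rfl⟩ := hb
  have := h1.good hu
  exact mul_mem (inv_mem (this.1.cl_mem hD)) (this.2.cl_mem hD)

/-- One pair of suffixes is lengthened by a common word until `y'` and `y₂` agree. This changes
neither the group element nor the period, and then the overlaps compose. -/
theorem Period.mul (hD : n ≤ D) (hu : Lead n u) (hb : Period D n u b h)
    (hb' : Period D n u b' h') : Period D n u (b * b') (h + h') := by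
  obtain ⟨y, y', h1, rfl, rfl⟩ := hb
  obtain ⟨y₂, y₂', h2, rfl, rfl⟩ := hb'
  have hg := h1.good hu
  have hg' := h2.good hu
  have hsuf : ∃ q, u = q * y' := by
    obtain ⟨x, x', w, -, h3, -⟩ := h1
    exact ⟨_, h3⟩
  have hsuf' : ∃ q, u = q * y₂ := by
    obtain ⟨x, x', w, h3, -, -⟩ := h2
    exact ⟨_, h3⟩
  obtain ⟨q, hq⟩ := hsuf
  obtain ⟨q', hq'⟩ := hsuf'
  rcases le_total y'.len y₂.len with hl | hl
  · obtain ⟨z, rfl, -⟩ := AWord.levi_right (hq.symm.trans hq') hl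
    have h3 := (h1.symm.extend hu hq' hg'.1.left.2).symm
    have hg3 := h3.good hu
    refine ⟨z * y, y₂', h3.trans h2, ?_, ?_⟩
    · rw [← cl_inv_mul_cl hD hg3.1 hg3.2]
      group
    · simp only [AWord.mul_len]; ring
  · obtain ⟨z, rfl, -⟩ := AWord.levi_right (hq'.symm.trans hq) hl
    have h3 := h2.extend hu hq hg.2.left.2
    have hg3 := h3.good hu
    refine ⟨y, z * y₂', h1.trans h3, ?_, ?_⟩
    · rw [← cl_inv_mul_cl hD hg3.1 hg3.2]
      group
    · simp only [AWord.mul_len]; ring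

theorem Period.pow (hD : n ≤ D) (hu : Lead n u) (hb : Period D n u b h) (j : ℕ) :
    Period D n u (b ^ j) (j * h) := by
  induction j with
  | zero => simpa using period_one hu
  | succ j ih =>
    have := ih.mul hD hu hb
    rw [pow_succ]
    convert this using 1
    push_cast
    ring

theorem Period.zpow (hD : n ≤ D) (hu : Lead n u) (hb : Period D n u b h) (j : ℤ) :
    Period D n u (b ^ j) (j * h) := by
  obtain ⟨k, rfl | rfl⟩ := j.eq_nat_or_neg
  · simpa using hb.pow hD hu k
  · simpa using (hb.pow hD hu k).inv

/-- After conjugation by a long suffix, a period is a word all powers of which are `G`-reduced. -/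
theorem Period.forLong_conj (hD : n ≤ D) (hu : Lead n u) (hb : Period D n u b h) (h0 : 0 ≤ h)
    {e : ℕ} (he : h.degree ≤ e) :
    ForLong n u fun y => ∃ s : AWord (Letter Sig), s.len = h ∧ (∀ j : ℕ, Good e (s ^ j)) ∧
      cl D y * b * (cl D y)⁻¹ = cl D s := by
  obtain ⟨y, y', h1, rfl, rfl⟩ := hb
  have hg := h1.good hu
  obtain ⟨q₀, hq₀⟩ : ∃ q, u = q * y := by
    obtain ⟨x, x', w, h3, -, -⟩ := h1
    exact ⟨_, h3⟩
  refine ⟨q₀, y, hq₀, hg.1, fun q z hq hz => ?_⟩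
  have h2 := h1.extend hu hq hz.left.2
  have hg2 := h2.good hu
  rw [← cl_inv_mul_cl hD hg2.1 hg2.2]
  obtain ⟨x, x', w, h3, h4, h5⟩ := h2
  have hle : (z * y).len ≤ (z * y').len := by
    simpa using h0
  obtain ⟨s, h6, h7⟩ := AWord.levi_right (h3.symm.trans h4) hle
  have hs : s.len = y'.len - y.len := by
    have := congrArg AWord.len h6
    simp only [AWord.mul_len] at this
    linear_combination -this
  rw [mul_assoc] at h7
  have hxl : x'.len ≤ x.len := by
    have := congrArg AWord.len h7
    simp only [AWord.mul_len] at this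
    have h8 : x.len = x'.len + s.len := by linear_combination this
    rw [h8]
    exact le_add_of_nonneg_right s.len_nonneg
  obtain ⟨r, rfl, h9⟩ := AWord.levi h7.symm hxl
  -- The two positions of `w` in `u` give `r * w = w * s`. Each power of `s` has degree at most `n`,
  -- so it is a suffix of `w` and inherits reducedness.
  have hpow : ∀ j : ℕ, r ^ j * w = w * s ^ j := by
    intro j
    induction j with
    | zero => simp
    | succ j ih => rw [pow_succ, mul_assoc, ← h9, ← mul_assoc, ih, mul_assoc, ← pow_succ]
  have hsdeg : s.deg ≤ e := by rw [AWord.deg, hs]; exact he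
  have hsdeg' : s.deg ≤ n := by
    have := hg2.2.2
    rw [h6] at this
    exact (AWord.deg_of_mul_le this).1
  have hdegpow : ∀ {m : ℕ}, s.deg ≤ m → ∀ j : ℕ, (s ^ j).deg ≤ m := by
    intro m hm j
    induction j with
    | zero => simp
    | succ j ih => rw [pow_succ]; exact AWord.deg_mul_le ih hm
  have hw := ((h3 ▸ hu).outer h5).2.1
  refine ⟨s, hs, fun j => ⟨?_, hdegpow hsdeg j⟩, ?_⟩
  · obtain ⟨v, hv, -⟩ := exists_suffix hw (hdegpow hsdeg' j) (hpow j)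
    have := hw.1.1
    rw [hv] at this
    exact this.right
  · have h10 : cl D (z * y') = cl D s * cl D (z * y) := by
      rw [h6]
      exact cl_mul ((h6 ▸ hg2.2).mono hD)
    rw [mul_inv_cancel_left, h10, mul_inv_cancel_right]

end Period

/-- The elements of the stabilizer of a stable letter are given by periods. -/
theorem exists_period_iff {n D : ℕ} (h : n + 1 ≤ D) {u : AWord (Letter Sig)} (hu : Lead n u)
    {b : E Sig D} (hb : b ∈ Fil Sig (n.le_succ.trans h)) :
    cl D u * b * (cl D u)⁻¹ ∈ Fil Sig (n.le_succ.trans h) ↔ ∃ p, Period D n u b p := by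
  constructor
  · rintro ⟨c, hc⟩
    obtain ⟨b, rfl⟩ := hb
    rw [← upTo_upTo n.le_succ h, ← upTo_upTo n.le_succ h, ← upTo_cl h hu.1, ← map_inv,
      ← map_mul, ← map_mul, ← cl_bar hu.1] at hc
    -- Membership forces a pinch between `u` and `u.bar`. Read backwards, its second half is another
    -- occurrence of `w.bar` in `u`, and the two suffixes that follow the occurrences give the
    -- period.
    obtain ⟨a, w, x, x', y, h1, h2, h3, h4⟩ := pinch_of_mem (faithful n) hu hu.bar
      ⟨c, upTo_injective h hc⟩
    have h5 : u = y.bar * w.bar * x'.bar := by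
      rw [← AWord.bar_bar u, h2]; simp [mul_assoc]
    have hx := ((h1 ▸ hu).outer (w := w.bar) h3).2.2
    have hx' := ((h5 ▸ hu).outer (w := w.bar) h3).2.2
    refine ⟨_, x, x'.bar, ⟨a, y.bar, w.bar, h1, h5, h3⟩, ?_, rfl⟩
    have hx2 : Good n x' := by simpa using hx'.bar
    rw [← upTo_cl (n.le_succ.trans h) hx, ← upTo_cl (n.le_succ.trans h) hx', ← map_inv,
      ← map_mul, cl_bar hx2]
    congr 1
    rw [eq_inv_mul_iff_mul_eq]
    exact eq_inv_of_mul_eq_one_left h4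
  · rintro ⟨p, y, y', ⟨x, x', w, h1, h2, h3⟩, rfl, -⟩
    have hx := (h1 ▸ hu).outer h3
    have hx' := (h2 ▸ hu).outer h3
    have e1 : cl D u = cl D x * cl D w * cl D y := by
      have hD := hu.1.mono h
      rw [h1] at hD ⊢
      rw [cl_mul hD, cl_mul hD.left]
    have e2 : cl D u = cl D x' * cl D w * cl D y' := by
      have hD := hu.1.mono h
      rw [h2] at hD ⊢
      rw [cl_mul hD, cl_mul hD.left]
    have e3 : cl D u * ((cl D y)⁻¹ * cl D y') * (cl D u)⁻¹ = cl D x * (cl D x')⁻¹ := by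
      nth_rewrite 1 [e1]
      rw [e2]
      group
    rw [e3]
    exact mul_mem (hx.1.cl_mem _) (inv_mem (hx'.1.cl_mem _))

end Filtration

/-! ## Stabilizers of stable letters are decidable -/

section Powers

variable {H : Type*} [Group H]

theorem computable_replicate {α β : Type*} [Primcodable α] [Primcodable β] (b : β) {f : α → ℕ}
    (hf : Computable f) : Computable fun a => List.replicate (f a) b := by
  have h : Computable fun m : ℕ => (List.range m).map fun _ => b :=
    (Primrec.list_map Primrec.list_range (Primrec.const b).to₂).to_comp
  refine (h.comp hf).of_eq fun a => ?_
  simp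

theorem ev_replicate {α : Type*} (s : α → H) (a : α) (m : ℕ) :
    ev s (List.replicate m a) = s a ^ m := by
  simp [ev]

/-- Cosets of a cyclic group are decidable if the exponent can be read off from a length. -/
theorem LocDec.zpow_mul {B C : Subgroup H} (h1 : LocDec B {1}) (hC : LocDec B (C : Set H))
    (hCB : C ≤ B) (hfg : FinInter B C) {len : H → ℕ}
    (hlen : ∀ (k : ℕ) (s : Fin k → H), (∀ i, s i ∈ C) → Computable fun w => len (ev s w))
    {A : Set H} (hA : LocDec B A) {σ p : H} (hσ : σ ∈ B) (hp : p ∈ B) {c : ℕ} (hc : 0 < c)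
    (h : ∀ (j : ℤ), ∀ a ∈ A, p * (σ ^ j * a) * p⁻¹ ∈ C ∧
      len (p * (σ ^ j * a) * p⁻¹) = c * j.natAbs) :
    LocDec B {g | ∃ j : ℤ, ∃ a ∈ A, g = σ ^ j * a} := by
  -- Conjugation by `p` brings the problem into `C`, where the length divided by `c` is the only
  -- possible value of `|j|`.
  have hT : LocDec C {g | ∃ j : ℤ, ∃ a ∈ A, p⁻¹ * g * p = σ ^ j * a} := by
    intro k s hs
    have hs' : ∀ σ' ∈ B, ∀ i, Sum.elim s (fun i : Fin 3 => ![σ', p⁻¹, p] i) i ∈ B := by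
      rintro σ' hσ' (i | i)
      · exact hCB (hs i)
      · fin_cases i
        exacts [hσ', B.inv_mem hp, hp]
    have hcomp : Computable fun w : List (Fin k) =>
        (List.replicate (len (ev s w) / c) (Sum.inr 0) ++ (Sum.inr 1 ::
          (w.map Sum.inl ++ [Sum.inr 2])) : List (Fin k ⊕ Fin 3)) :=
      Computable.list_append.comp
        (computable_replicate _ (Primrec.nat_div.to_comp.comp (hlen k s hs) (Computable.const c)))
        (Computable.list_cons.comp (Computable.const _)
          (Computable.list_append.comp (computable_list_map Computable.id _) (Computable.const _)))
    have h2 := fun σ' hσ' => hA.comp (hs' σ' hσ') hcomp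
    -- The length does not show the sign of the exponent, so both are tried. A successful test
    -- exhibits the exponent, hence there are no false positives.
    refine ((h2 σ hσ).or' (h2 σ⁻¹ (B.inv_mem hσ))).of_eq fun w => ?_
    have h3 : ∀ σ' : H, ev (Sum.elim s (fun i : Fin 3 => ![σ', p⁻¹, p] i))
        (List.replicate (len (ev s w) / c) (Sum.inr 0) ++ (Sum.inr 1 ::
          (w.map Sum.inl ++ [Sum.inr 2]))) =
        σ' ^ (len (ev s w) / c) * (p⁻¹ * ev s w * p) := by
      intro σ'
      rw [ev_append, ev_replicate, ev_cons, ev_append, ev_map]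
      simp [Function.comp_def, mul_assoc]
    rw [h3, h3]
    constructor
    · rintro (h4 | h4)
      · exact ⟨-((len (ev s w) / c : ℕ) : ℤ), _, h4, by
          rw [zpow_neg, zpow_natCast, inv_mul_cancel_left]⟩
      · exact ⟨((len (ev s w) / c : ℕ) : ℤ), _, h4, by
          rw [zpow_natCast, inv_pow, mul_inv_cancel_left]⟩
    · rintro ⟨j, a, ha, h4⟩
      have h5 : ev s w = p * (σ ^ j * a) * p⁻¹ := by rw [← h4]; group
      have h6 : len (ev s w) / c = j.natAbs := by
        rw [h5, (h j a ha).2, Nat.mul_div_cancel_left _ hc]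
      rw [h6, h4]
      obtain ⟨i, rfl | rfl⟩ := j.eq_nat_or_neg
      · right
        simpa using ha
      · left
        simpa using ha
  have hT' : LocDec B {g | ∃ j : ℤ, ∃ a ∈ A, p⁻¹ * g * p = σ ^ j * a} := by
    refine LocDec.trans h1 hC hCB hfg hT ?_
    rintro g ⟨j, a, ha, h2⟩
    have h5 : g = p * (σ ^ j * a) * p⁻¹ := by rw [← h2]; group
    rw [h5]
    exact (h j a ha).1
  refine (hT'.translate hp (B.inv_mem hp)).congr fun g _ => ?_
  simp [mul_assoc]

end Powers

/-! ### The filtration of the period groups by degree. -/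

section PeriodSet

variable {G : Type*} [Group G] {Sig : Set G} {n D : ℕ} {u : AWord (Letter Sig)}

/-- The group elements given by periods of degree less than `e`. -/
def periodSet (D n : ℕ) (u : AWord (Letter Sig)) (e : ℕ) : Set (E Sig D) :=
  {g | ∃ h, Period D n u g h ∧ h.degree < e}

theorem periodSet_mono {e e' : ℕ} (he : e ≤ e') : periodSet D n u e ⊆ periodSet D n u e' := by
  rintro g ⟨h, h1, h2⟩
  exact ⟨h, h1, h2.trans_le (by exact_mod_cast he)⟩

theorem periodSet_zero (hu : Lead n u) : periodSet D n u 0 = {1} := by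
  ext g
  constructor
  · rintro ⟨h, h1, h2⟩
    rw [Nat.cast_zero, Nat.WithBot.lt_zero_iff, degree_eq_bot] at h2
    rw [h2] at h1
    exact h1.eq_one
  · rintro rfl
    exact ⟨0, period_one hu, by simp⟩

theorem exists_period_iff_mem_periodSet (hu : Lead n u) {g : E Sig D} :
    (∃ h, Period D n u g h) ↔ g ∈ periodSet D n u (n + 1) := by
  constructor
  · rintro ⟨h, h1⟩
    exact ⟨h, h1, (h1.degree_le hu).trans_lt (by exact_mod_cast n.lt_succ_self)⟩
  · rintro ⟨h, h1, -⟩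
    exact ⟨h, h1⟩

theorem degree_le_of_degree_lt_succ {p : ℤ[X]} {e : ℕ} (h : p.degree < (e + 1 : ℕ)) :
    p.degree ≤ e := by
  rw [degree_lt_iff_coeff_zero] at h
  rw [degree_le_iff_coeff_zero]
  intro m hm
  exact h m (by exact_mod_cast hm)

/-- The coefficients of `t ^ e` in the periods of degree at most `e` form a subgroup of `ℤ`, which
is cyclic. If it is trivial, nothing new appears. Otherwise `σ` realizes its positive generator, and
a suitable power of `σ` lowers the degree of any other period. -/
theorem periodSet_succ (hD : n ≤ D) (hu : Lead n u) (e : ℕ) :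
    periodSet D n u (e + 1) = periodSet D n u e ∨ ∃ σ h, Period D n u σ h ∧ h.degree ≤ e ∧
      0 < h.coeff e ∧
        periodSet D n u (e + 1) = {g | ∃ j : ℤ, ∃ a ∈ periodSet D n u e, g = σ ^ j * a} := by
  let K : AddSubgroup ℤ :=
    { carrier := {k | ∃ b h, Period D n u b h ∧ h.degree < (e + 1 : ℕ) ∧ h.coeff e = k}
      zero_mem' := ⟨1, 0, period_one hu, by simp, by simp⟩
      add_mem' := by
        rintro _ _ ⟨b, h, h1, h2, rfl⟩ ⟨b', h', h1', h2', rfl⟩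
        exact ⟨b * b', h + h', h1.mul hD hu h1',
          (degree_add_le _ _).trans_lt (max_lt h2 h2'), by simp⟩
      neg_mem' := by
        rintro _ ⟨b, h, h1, h2, rfl⟩
        exact ⟨b⁻¹, -h, h1.inv, by rwa [degree_neg], by simp⟩ }
  have hlow : ∀ {h : ℤ[X]}, h.degree < (e + 1 : ℕ) → h.coeff e = 0 → h.degree < e := by
    intro h h1 h2
    rw [degree_lt_iff_coeff_zero] at h1 ⊢
    intro m hm
    rcases hm.eq_or_lt with rfl | hm
    exacts [h2, h1 m hm]
  obtain ⟨c, hc⟩ := Int.subgroup_cyclic K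
  have hcK : c ∈ K := by
    rw [hc]
    exact AddSubgroup.subset_closure rfl
  by_cases hc0 : c = 0
  · left
    refine subset_antisymm ?_ (periodSet_mono e.le_succ)
    rintro g ⟨h, h1, h2⟩
    have h3 : h.coeff e ∈ K := ⟨g, h, h1, h2, rfl⟩
    rw [hc, hc0, AddSubgroup.mem_closure_singleton] at h3
    obtain ⟨m, hm⟩ := h3
    exact ⟨h, h1, hlow h2 (by simpa using hm.symm)⟩
  · right
    obtain ⟨σ, h, h1, h2, h3, h4⟩ : ∃ σ h, Period D n u σ h ∧ h.degree < (e + 1 : ℕ) ∧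
        0 < h.coeff e ∧ ∀ k ∈ K, ∃ m : ℤ, k = m * h.coeff e := by
      have hgen : ∀ k ∈ K, ∃ m : ℤ, k = m * c := by
        intro k hk
        rw [hc, AddSubgroup.mem_closure_singleton] at hk
        obtain ⟨m, hm⟩ := hk
        exact ⟨m, by rw [← hm, smul_eq_mul]⟩
      obtain ⟨b, h, h1, h2, rfl⟩ := hcK
      rcases lt_or_gt_of_ne hc0 with h3 | h3
      · refine ⟨b⁻¹, -h, h1.inv, by rwa [degree_neg], by simpa using h3, fun k hk => ?_⟩
        obtain ⟨m, hm⟩ := hgen k hk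
        exact ⟨-m, by simp [hm]⟩
      · exact ⟨b, h, h1, h2, h3, hgen⟩
    refine ⟨σ, h, h1, degree_le_of_degree_lt_succ h2, h3, ?_⟩
    ext g
    constructor
    · rintro ⟨h', h5, h6⟩
      obtain ⟨m, hm⟩ := h4 (h'.coeff e) ⟨g, h', h5, h6, rfl⟩
      refine ⟨m, σ ^ (-m) * g, ⟨_, (h1.zpow hD hu (-m)).mul hD hu h5, hlow ?_ ?_⟩, by simp⟩
      · refine (degree_add_le _ _).trans_lt (max_lt ?_ h6)
        refine (degree_mul_le _ _).trans_lt ?_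
        refine lt_of_le_of_lt (add_le_add_left (?_ : _ ≤ (0 : WithBot ℕ)) _) (by simpa using h2)
        exact degree_intCast_le _
      · rw [coeff_add, coeff_intCast_mul, hm]
        simp
    · rintro ⟨j, a, ⟨h', h5, h6⟩, rfl⟩
      refine ⟨_, (h1.zpow hD hu j).mul hD hu h5, ?_⟩
      refine (degree_add_le _ _).trans_lt (max_lt ?_ (h6.trans (by exact_mod_cast e.lt_succ_self)))
      refine (degree_mul_le _ _).trans_lt ?_
      refine lt_of_le_of_lt (add_le_add_left (?_ : _ ≤ (0 : WithBot ℕ)) _) (by simpa using h2)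
      exact degree_intCast_le _

/-- The groups of periods are finitely generated. -/
theorem exists_generators_periodSet (hD : n ≤ D) (hu : Lead n u) (e : ℕ) :
    ∃ T : List (E Sig D), (∀ x ∈ T, x ∈ periodSet D n u e) ∧
      ∀ g ∈ periodSet D n u e, g ∈ Submonoid.closure {x | x ∈ T} := by
  induction e with
  | zero =>
    refine ⟨[], by simp, fun g hg => ?_⟩
    rw [periodSet_zero hu] at hg
    rw [Set.mem_singleton_iff.1 hg]
    exact Submonoid.one_mem _
  | succ e ih =>
    rcases periodSet_succ (D := D) hD hu e with h | ⟨σ, h, h1, h2, -, h3⟩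
    · rwa [h]
    · obtain ⟨T, hT, hT'⟩ := ih
      have hσ : h.degree < (e + 1 : ℕ) := h2.trans_lt (by exact_mod_cast e.lt_succ_self)
      refine ⟨σ :: σ⁻¹ :: T, ?_, ?_⟩
      · intro x hx
        simp only [List.mem_cons] at hx
        rcases hx with rfl | rfl | hx
        · exact ⟨h, h1, hσ⟩
        · exact ⟨-h, h1.inv, by rwa [degree_neg]⟩
        · exact periodSet_mono e.le_succ (hT x hx)
      · intro g hg
        rw [h3] at hg
        obtain ⟨j, a, ha, rfl⟩ := hg
        refine Submonoid.mul_mem _ ?_ (Submonoid.closure_mono (fun x hx =>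
          List.mem_cons_of_mem _ (List.mem_cons_of_mem _ hx)) (hT' a ha))
        obtain ⟨i, rfl | rfl⟩ := j.eq_nat_or_neg
        · rw [zpow_natCast]
          exact Submonoid.pow_mem _ (Submonoid.subset_closure (by simp)) _
        · rw [zpow_neg, zpow_natCast, ← inv_pow]
          exact Submonoid.pow_mem _ (Submonoid.subset_closure (by simp)) _

/-- A suffix may have degree up to `n`, but after conjugation only the degree of the period itself
counts. A negative period is handled through its inverse. -/
theorem Period.forLong_mem_fil (hD : n ≤ D) (hu : Lead n u) {b : E Sig D} {h : ℤ[X]}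
    (hb : Period D n u b h) {e : ℕ} (he : h.degree ≤ e) (heD : e ≤ D) :
    ForLong n u fun y => cl D y * b * (cl D y)⁻¹ ∈ Fil Sig heD := by
  rcases le_total 0 h with h0 | h0
  · refine ForLong.mono (hb.forLong_conj hD hu h0 he) ?_
    rintro y ⟨s, -, hs, h1⟩
    rw [h1]
    exact Good.cl_mem heD (by simpa using hs 1)
  · refine ForLong.mono (hb.inv.forLong_conj hD hu (by simpa using h0) (by rwa [degree_neg])) ?_
    rintro y ⟨s, -, hs, h1⟩
    rw [← inv_mem_iff]
    have : (cl D y * b * (cl D y)⁻¹)⁻¹ = cl D s := by rw [← h1]; group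
    rw [this]
    exact Good.cl_mem heD (by simpa using hs 1)

theorem cl_pow {s : AWord (Letter Sig)} (hs : ∀ j : ℕ, Good D (s ^ j)) (j : ℕ) :
    cl D (s ^ j) = cl D s ^ j := by
  induction j with
  | zero => simp
  | succ j ih =>
    have := hs (j + 1)
    rw [pow_succ] at this
    rw [pow_succ, cl_mul this, ih, pow_succ]

theorem lc_pow (m : ℕ) (s : AWord (Letter Sig)) (j : ℕ) : lc m (s ^ j) = j * lc m s := by
  induction j with
  | zero => simp [lc]
  | succ j ih =>
    rw [pow_succ, lc_mul, ih]
    push_cast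
    ring

/-- As the powers of `s` are reduced, their syllables add up without cancellation. Negative
exponents use the reversed word. -/
theorem degLen_zpow_mul {e : ℕ} (he : e + 1 ≤ D) {s : AWord (Letter Sig)}
    (hs : ∀ j : ℕ, Good (e + 1) (s ^ j)) (j : ℤ) {b : E Sig D}
    (hb : b ∈ Fil Sig (e.le_succ.trans he)) :
    (degLen he (cl D s ^ j * b) : ℤ) = lc e s * j.natAbs := by
  have hs' : ∀ j : ℕ, Good D (s ^ j) := fun j => (hs j).mono he
  obtain ⟨i, rfl | rfl⟩ := j.eq_nat_or_neg
  · rw [zpow_natCast, ← cl_pow hs', degLen_cl_mul he (hs i) hb, lc_pow, mul_comm]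
    simp
  · rw [zpow_neg, zpow_natCast, ← cl_pow hs', ← cl_bar (hs' i), degLen_cl_mul he (hs i).bar hb]
    rw [lc_bar, lc_pow, mul_comm]
    simp

/-- The groups of periods are decidable. -/
theorem locDec_periodSet (hD : n ≤ D) (hu : Lead n u) (h1 : LocDec (Fil Sig hD) {1})
    (hdec : ∀ i (hi : i ≤ n), LocDec (Fil Sig hD) (Fil Sig (hi.trans hD) : Set (E Sig D)))
    (hfin : ∀ i (hi : i ≤ n), FinInter (Fil Sig hD) (Fil Sig (hi.trans hD)))
    (hlen : ∀ i (hi : i + 1 ≤ n) (k : ℕ) (s : Fin k → E Sig D),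
      (∀ j, s j ∈ Fil Sig (hi.trans hD)) → Computable fun w => degLen (hi.trans hD) (ev s w))
    (hz : ∀ g ∈ Fil Sig D.zero_le,
      LocDec (Fil Sig D.zero_le) (Subgroup.zpowers g : Set (E Sig D)))
    (e : ℕ) (he : e ≤ n + 1) : LocDec (Fil Sig hD) (periodSet D n u e) := by
  induction e with
  | zero => rwa [periodSet_zero hu]
  | succ e ih =>
    rcases periodSet_succ (D := D) hD hu e with h | ⟨σ, h, hσ, hdeg, hpos, h3⟩
    · rw [h]
      exact ih (by omega)
    have h0 : 0 ≤ h := by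
      by_contra hneg
      have := coeff_nonneg_of_degree_le (p := -h) (n := e)
        (by simpa using (lt_of_not_ge hneg).le) (by rwa [degree_neg])
      rw [coeff_neg] at this
      omega
    have hconj := hσ.forLong_conj hD hu h0 hdeg
    cases e with
    | zero =>
      obtain ⟨q, y, -, hy, s, -, hs, h4⟩ := ForLong.exists hconj
      have hs1 : cl D s ∈ Fil Sig D.zero_le := Good.cl_mem D.zero_le (by simpa using hs 1)
      have hp := hy.cl_mem hD
      -- The bottom layer consists of finite periods. A conjugate of it is the cyclic group
      -- generated by a finite word, which `hz` decides.
      have := (LocDec.trans h1 (hdec 0 n.zero_le) (Fil.mono n.zero_le hD) (hfin 0 n.zero_le)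
        (hz _ hs1) (fun g hg => Subgroup.zpowers_le.2 hs1 hg)).translate hp (inv_mem hp)
      refine this.congr fun g _ => ?_
      rw [h3, ← h4]
      simp only [Set.mem_ofPred_eq, SetLike.mem_coe, Subgroup.mem_zpowers_iff,
        periodSet_zero hu, Set.mem_singleton_iff, exists_eq_left, mul_one, conj_zpow,
        mul_left_inj, mul_right_inj, eq_comm]
    | succ e =>
      obtain ⟨T, hT, hT'⟩ := exists_generators_periodSet (D := D) hD hu (e + 1)
      have heD : e + 1 ≤ D := by omega
      -- Finite generation of the lower layer lets one sufficiently long suffix lower the degree of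
      -- all its elements at once, while also serving `σ`.
      have hlong : ForLong n u fun y => ∀ x ∈ T,
          cl D y * x * (cl D y)⁻¹ ∈ Fil Sig (e.le_succ.trans heD) := by
        refine ForLong.forall_list T fun x hx => ?_
        obtain ⟨h', h5, h6⟩ := hT x hx
        exact h5.forLong_mem_fil hD hu (degree_le_of_degree_lt_succ h6) _
      obtain ⟨q, y, -, hy, ⟨s, hsl, hs, h4⟩, h5⟩ := ForLong.exists (ForLong.and hconj hlong)
      have hconjA : ∀ a ∈ periodSet D n u (e + 1),
          cl D y * a * (cl D y)⁻¹ ∈ Fil Sig (e.le_succ.trans heD) := by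
        intro a ha
        have h6 : Submonoid.closure {x | x ∈ T} ≤
            ((Fil Sig (e.le_succ.trans heD)).comap
              (MulAut.conj (cl D y)).toMonoidHom).toSubmonoid := by
          rw [Submonoid.closure_le]
          intro x hx
          exact h5 x hx
        exact h6 (hT' a ha)
      have hen : e + 1 ≤ n := by omega
      rw [h3]
      obtain ⟨c, hc⟩ := Int.eq_ofNat_of_zero_le hpos.le
      refine LocDec.zpow_mul h1 (hdec (e + 1) hen) (Fil.mono hen hD) (hfin (e + 1) hen)
        (len := degLen heD) (hlen e hen) (ih (by omega)) (σ := σ) (p := cl D y) (c := c)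
        (hσ.mem hD hu) (hy.cl_mem hD) (by omega) fun j a ha => ?_
      have h6 : cl D y * (σ ^ j * a) * (cl D y)⁻¹ =
          cl D s ^ j * (cl D y * a * (cl D y)⁻¹) := by
        rw [← h4, conj_zpow]
        group
      have h7 := hconjA a ha
      rw [h6]
      refine ⟨mul_mem (zpow_mem (Good.cl_mem heD (by simpa using hs 1)) j)
        (Fil.mono e.le_succ heD h7), ?_⟩
      have h8 := degLen_zpow_mul heD hs j h7
      have h9 : lc e s = c := by rw [lc, hsl, hc]
      rw [h9] at h8
      exact_mod_cast h8

end PeriodSet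

/-! ## The membership problems for the filtration -/

section Decide

theorem _root_.ComputablePred.const {α : Type*} [Primcodable α] (p : Prop) :
    ComputablePred fun _ : α => p := by
  classical
  exact Computable.computablePred (Computable.const (decide p))

theorem _root_.ComputablePred.forall_finite {α ι : Type*} [Primcodable α] [Finite ι]
    {p : ι → α → Prop} (hp : ∀ i, ComputablePred (p i)) : ComputablePred fun a => ∀ i, p i a := by
  have key : ∀ l : List ι, ComputablePred fun a => ∀ i ∈ l, p i a := by
    intro l
    induction l with
    | nil => simpa using ComputablePred.const True
    | cons i l ih => simpa using (hp i).and' ih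
  have := Fintype.ofFinite ι
  simpa using key (Finset.univ : Finset ι).toList

theorem computablePred_forall_mem {α β : Type*} [Primcodable α] [Primcodable β] [Finite β]
    (p : β → Prop) {f : α → List β} (hf : Computable f) :
    ComputablePred fun a => ∀ b ∈ f a, p b := by
  classical
  refine (computablePred_eq (computable_list_flatMap hf fun b => if p b then [] else [b])
    (Computable.const [])).of_eq fun a => ?_
  rw [List.flatMap_eq_nil_iff]
  refine forall₂_congr fun b _ => ?_
  by_cases h : p b <;> simp [h]

theorem LocDec.refl {H : Type*} [Group H] (F : Subgroup H) : LocDec F (F : Set H) :=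
  fun _ _ hs => (ComputablePred.const True).of_eq fun w => iff_of_true trivial (ev_mem hs w)

theorem map_ev {H K ι : Type*} [Group H] [Group K] (φ : H →* K) (s : ι → H) (w : List ι) :
    φ (ev s w) = ev (φ ∘ s) w := by
  simp [ev, map_list_prod]

variable {G : Type*} [Group G] {Sig : Set G}

/-- Membership in cyclic subgroups of the group of finite words is decidable. -/
theorem locDec_zpowers (hgen : Subgroup.closure Sig = ⊤)
    (hcyc : ∀ v : FreeMonoid (Letter Sig), IsDecidable fun u : List (Letter Sig) =>
      toGroup (FreeMonoid.ofList u) ∈ Subgroup.zpowers (toGroup v))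
    {D : ℕ} {g : E Sig D} (hg : g ∈ Fil Sig D.zero_le) :
    LocDec (Fil Sig D.zero_le) (Subgroup.zpowers g : Set (E Sig D)) := by
  intro k s hs
  obtain ⟨g, rfl⟩ := hg
  choose s' hs' using hs
  choose f hf hsf using fun i => exists_eq_cl_zero hgen (s' i)
  obtain ⟨v, hv, rfl⟩ := exists_eq_cl_zero hgen g
  obtain ⟨m, e, hdec⟩ := hcyc v
  refine (hdec.comp_computable (computable_list_flatMap Computable.id
    fun i => (f i).toList.map e)).of_eq fun w => ?_
  have h1 : ev s w = upTo D.zero_le (ev s' w) := by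
    rw [map_ev]
    congr 1
    funext i
    exact (hs' i).symm
  have h2 : ∀ w, toGroup (FreeMonoid.ofList ((w.flatMap fun i => (f i).toList.map e).map e.symm)) =
      zeroToG Sig (ev s' w) := by
    intro w
    induction w with
    | nil => rfl
    | cons i w ih =>
      have h3 : (zeroToG Sig) (s' i) = toGroup (f i) := by rw [hsf i, zeroToG_cl (hf i)]
      rw [ev_cons, map_mul, h3, List.flatMap_cons, List.map_append, FreeMonoid.ofList_append,
        map_mul, ih, List.map_map]
      simp
  simp only [id]
  rw [h2, h1, ← zeroToG_cl hv, SetLike.mem_coe, ← MonoidHom.map_zpowers, ← MonoidHom.map_zpowers,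
    Subgroup.mem_map_iff_mem (zeroToG_injective hgen),
    Subgroup.mem_map_iff_mem (upTo_injective D.zero_le)]

/-- The word problem, the membership problems for the filtration, and the syllable length are
computable. -/
theorem locDec_fil {D : ℕ}
    (hz : ∀ g ∈ Fil Sig D.zero_le,
      LocDec (Fil Sig D.zero_le) (Subgroup.zpowers g : Set (E Sig D)))
    (d : ℕ) (hd : d ≤ D) :
    LocDec (Fil Sig hd) {1} ∧
    (∀ i (hi : i ≤ d), LocDec (Fil Sig hd) (Fil Sig (hi.trans hd) : Set (E Sig D))) ∧
    (∀ i (hi : i ≤ d), FinInter (Fil Sig hd) (Fil Sig (hi.trans hd))) ∧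
    ∀ i (hi : i + 1 ≤ d) (k : ℕ) (s : Fin k → E Sig D),
      (∀ j, s j ∈ Fil Sig (hi.trans hd)) →
        Computable fun w => degLen (hi.trans hd) (ev s w) := by
  induction d with
  | zero =>
    refine ⟨?_, fun i hi => ?_, fun i hi => ?_, fun i hi => ?_⟩
    -- The word problem is membership in the cyclic subgroup generated by `1`.
    · simpa using hz 1 (one_mem _)
    · obtain rfl : i = 0 := by omega
      exact LocDec.refl _
    · obtain rfl : i = 0 := by omega
      exact FinInter.refl _
    · omega
  | succ d ih =>
    have hd' : d ≤ D := d.le_succ.trans hd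
    obtain ⟨h1, h2, h3, h4⟩ := ih hd'
    -- Periods of `u` have degree at most `d`, so the layer with bound `d + 1` is the whole
    -- stabilizer.
    have hA : ∀ u ∈ leadSet Sig d D, LocDec (Fil Sig hd') {b | u * b * u⁻¹ ∈ Fil Sig hd'} := by
      rintro _ ⟨u, hu, rfl⟩
      refine (locDec_periodSet hd' hu h1 h2 h3 h4 hz (d + 1) le_rfl).congr fun b hb => ?_
      rw [← exists_period_iff_mem_periodSet hu, ← exists_period_iff hd hu hb]
      rfl
    have hfg : ∀ u ∈ leadSet Sig d D, ∃ T : List (E Sig D),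
        (∀ x ∈ T, x ∈ Fil Sig hd' ∧ u * x * u⁻¹ ∈ Fil Sig hd') ∧
          ∀ b ∈ Fil Sig hd', u * b * u⁻¹ ∈ Fil Sig hd' → b ∈ Submonoid.closure {x | x ∈ T} := by
      rintro _ ⟨u, hu, rfl⟩
      obtain ⟨T, hT, hT'⟩ := exists_generators_periodSet hd' hu (d + 1)
      refine ⟨T, fun x hx => ?_, fun b hb hub => ?_⟩
      · obtain ⟨p, hp, -⟩ := hT x hx
        exact ⟨hp.mem hd' hu, (exists_period_iff hd hu (hp.mem hd' hu)).2 ⟨p, hp⟩⟩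
      · exact hT' b ((exists_period_iff_mem_periodSet hu).1 ((exists_period_iff hd hu hb).1 hub))
    have bp := brittonPair (Sig := Sig) hd
    have g1 := bp.locDec_one h1 hA hfg
    have g2 := bp.locDec h1 hA hfg
    have g3 := bp.finInter h1 hA hfg
    refine ⟨g1, fun i hi => ?_, fun i hi => ?_, fun i hi k s hs => ?_⟩
    · rcases hi.eq_or_lt with rfl | hi'
      · exact LocDec.refl _
      · exact LocDec.trans g1 g2 (Fil.mono d.le_succ hd) g3 (h2 i (by omega))
          (Fil.mono (by omega) hd')
    · rcases hi.eq_or_lt with rfl | hi'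
      · exact FinInter.refl _
      · exact g3.trans (h3 i (by omega)) (Fil.mono (by omega) hd')
    · rcases hi.eq_or_lt with h | hi'
      · obtain rfl : i = d := by omega
        exact bp.computable_len h1 hA hfg hs
      · exact h4 i (by omega) k s hs

/-- The elements of degree at most `d` of a finitely generated subgroup are represented by words
over a finite set of `G`-reduced words of degree at most `d`. -/
theorem FinInter.exists_words {D d : ℕ} (hd : d ≤ D) {F : Subgroup (E Sig D)}
    (h : FinInter F (Fil Sig hd)) {k : ℕ} {s : Fin k → E Sig D} (hs : ∀ i, s i ∈ F) :
    ∃ W : Finset (AWord (Letter Sig)), (∀ u ∈ W, Good d u) ∧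
      ∀ w, ev s w ∈ Fil Sig hd → ∃ L : List (AWord (Letter Sig)), (∀ u ∈ L, u ∈ W) ∧
        (L.map (cl D)).prod = ev s w := by
  classical
  obtain ⟨n, t, ht, h1⟩ := h k s hs
  have h2 : ∀ i, ∃ L : List (AWord (Letter Sig)), (∀ u ∈ L, Good d u) ∧
      (L.map (cl D)).prod = t i := by
    intro i
    obtain ⟨g, hg⟩ := ht i
    obtain ⟨L, hL, rfl⟩ := exists_list_eq g
    refine ⟨L, hL, ?_⟩
    rw [← hg, map_list_prod, List.map_map]
    congr 1
    exact List.map_congr_left fun u hu => (upTo_cl hd (hL u hu)).symm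
  choose L hL hLt using h2
  refine ⟨Finset.univ.biUnion fun i => (L i).toFinset, fun u hu => ?_, fun w hw => ?_⟩
  · simp only [Finset.mem_biUnion, Finset.mem_univ, List.mem_toFinset, true_and] at hu
    obtain ⟨i, hi⟩ := hu
    exact hL i u hi
  · obtain ⟨v, hv⟩ := h1 w hw
    refine ⟨v.flatMap L, fun u hu => ?_, ?_⟩
    · obtain ⟨i, -, hi⟩ := List.mem_flatMap.1 hu
      simp only [Finset.mem_biUnion, Finset.mem_univ, List.mem_toFinset, true_and]
      exact ⟨i, hi⟩
    · rw [← hv]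
      exact (ev_flatMap (cl D) L v).trans (congrArg (fun r => ev r v) (funext hLt))

end Decide

/-! ## The reduced degree -/

section ReducedDegree

variable {G : Type*} [Group G] {Sig : Set G}

theorem eval_eq {Γ : Type*} {Δ : Finset (AWord Γ)} (w : List Δ) :
    eval w = (w.map Subtype.val).prod := by
  rw [eval, List.map_id']
  congr 1
  exact List.flatMap_pure_eq_map _ _

theorem rep_eval {Δ : Finset (AWord (Letter Sig))} {D : ℕ} (hΔ : ∀ u ∈ Δ, Good D u) (w : List Δ) :
    Rep D (eval w) (ev (fun u : Δ => cl D u) w) := by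
  refine ⟨w.map Subtype.val, ?_, (eval_eq w).symm, ?_⟩
  · intro u hu
    obtain ⟨v, -, rfl⟩ := List.mem_map.1 hu
    exact hΔ _ v.2
  · rw [List.map_map]
    rfl

theorem exists_forall_deg_le (Δ : Finset (AWord (Letter Sig))) :
    ∃ D : ℕ, ∀ u ∈ Δ, u.deg ≤ D :=
  ⟨Δ.sup fun u => u.len.natDegree, fun u hu => degree_le_natDegree.trans (by
    exact_mod_cast Finset.le_sup (f := fun u : AWord (Letter Sig) => u.len.natDegree) hu)⟩

variable {S₀ : Set (FreeMonoid (Letter Sig) × FreeMonoid (Letter Sig))}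

theorem Rep.rdeg_eq (hone : (1 : G) ∉ Sig) (hgen : Subgroup.closure Sig = ⊤)
    (hS₀ : IsBaseSystem S₀) {D : ℕ} {x : AWord (Letter Sig)} {g : E Sig D} (h : Rep D x g)
    (h1 : g ≠ 1) {d : ℕ} (hd : d ≤ D) (h2 : g ∈ Fil Sig hd)
    (h3 : ∀ i (hi : i < d), g ∉ Fil Sig (hi.le.trans hd)) :
    rdeg (bigSystem S₀) x = d := by
  have h4 := (h.rdeg_le_iff S₀ hone hgen hS₀ hd).2 h2
  cases h5 : rdeg (bigSystem S₀) x with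
  | bot => exact absurd ((h.rdeg_eq_bot_iff S₀ hone hgen hS₀).1 h5) h1
  | coe a =>
    rw [h5] at h4
    have h6 : a ≤ d := WithBot.coe_le_coe.1 h4
    rcases h6.eq_or_lt with rfl | h6
    · rfl
    · exact absurd ((h.rdeg_le_iff S₀ hone hgen hS₀ (h6.le.trans hd)).1 h5.le) (h3 a h6)

theorem Rep.deg_eq {D : ℕ} {x : AWord (Letter Sig)} {g : E Sig D} (h : Rep D x g)
    (h1 : g ≠ 1) {d : ℕ} (hd : d ≤ D) (h2 : x.deg ≤ d)
    (h3 : ∀ i (hi : i < d), g ∉ Fil Sig (hi.le.trans hd)) : x.deg = d := by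
  cases h5 : x.deg with
  | bot =>
    rw [AWord.deg_eq_bot] at h5
    subst h5
    exact absurd (h.unique (rep_one D)) h1
  | coe a =>
    rw [h5] at h2
    have h6 : a ≤ d := WithBot.coe_le_coe.1 h2
    rcases h6.eq_or_lt with rfl | h6
    · rfl
    · obtain ⟨b, -, hb⟩ := h.mem_range (h6.le.trans hd) h5.le
      exact absurd ⟨b, hb⟩ (h3 a h6)

end ReducedDegree
end NonArch

/-! ### The algorithm for the reduced degree. -/

theorem mainTheorem4 {G : Type*} [Group G] (Sig : Set G) (hfin : Sig.Finite)
    (hone : (1 : G) ∉ Sig) (hgen : Subgroup.closure Sig = ⊤)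
    (S₀ : Set (FreeMonoid (NonArch.Letter Sig) × FreeMonoid (NonArch.Letter Sig)))
    (hS₀ : NonArch.IsBaseSystem S₀)
    (hcyc : ∀ v : FreeMonoid (NonArch.Letter Sig),
      NonArch.IsDecidable fun u : List (NonArch.Letter Sig) =>
        NonArch.toGroup (FreeMonoid.ofList u) ∈ Subgroup.zpowers (NonArch.toGroup v))
    (Δ : Finset (NonArch.AWord (NonArch.Letter Sig)))
    (hΔ : ∀ g ∈ Δ, NonArch.IsGReduced g) :
    ∃ Δ' : Finset (NonArch.AWord (NonArch.Letter Sig)), (∀ g ∈ Δ', NonArch.IsGReduced g) ∧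
      ∃ f : List Δ → List Δ',
        NonArch.IsComputable
          (fun w => NonArch.rdeg (NonArch.bigSystem S₀) (NonArch.eval w)) f ∧
        ∀ w : List Δ,
          NonArch.Equivalent (NonArch.bigSystem S₀) (NonArch.eval w) (NonArch.eval (f w)) ∧
          (NonArch.eval (f w)).deg =
            NonArch.rdeg (NonArch.bigSystem S₀) (NonArch.eval w) := by
  classical
  open NonArch in
  obtain ⟨D, hD⟩ := exists_forall_deg_le Δ
  have hΔD : ∀ u ∈ Δ, Good D u := fun u hu => ⟨hΔ u hu, hD u hu⟩
  obtain ⟨hword, hmem, hfg, -⟩ := locDec_fil (Sig := Sig) (D := D)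
    (fun g hg => locDec_zpowers hgen hcyc hg) D le_rfl
  let s : Fin Δ.card → E Sig D := fun i => cl D (Δ.equivFin.symm i : AWord (Letter Sig))
  have hs : ∀ i, s i ∈ Fil Sig le_rfl := fun i => Good.cl_mem le_rfl (hΔD _ (Subtype.prop _))
  -- For each degree, finitely many words suffice to represent the elements of that degree. This
  -- fixes the output alphabet before any input is seen.
  choose W hW hWs using fun d : Fin (D + 1) => (hfg d d.is_le).exists_words d.is_le hs
  set Δ' := (Finset.univ : Finset (Fin (D + 1))).biUnion W with hΔ'
  have hΔD' : ∀ u ∈ Δ', Good D u := by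
    intro u hu
    obtain ⟨d, -, hd⟩ := Finset.mem_biUnion.1 hu
    exact (hW d u hd).mono d.is_le
  let t : Fin Δ'.card → E Sig D := fun i => cl D (Δ'.equivFin.symm i : AWord (Letter Sig))
  have ht : ∀ i, t i ∈ Fil Sig le_rfl := fun i => Good.cl_mem le_rfl (hΔD' _ (Subtype.prop _))
  -- A decidable certificate: `none` stands for the trivial class, where the output must be empty,
  -- and `some d` requires `d` to be the least level containing the class, with all output letters
  -- of degree at most `d`.
  let R : List (Fin Δ.card) → Option (Fin (D + 1)) × List (Fin Δ'.card) → Prop := fun v o =>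
    ev t o.2 = ev s v ∧ o.1.elim (ev s v = 1 ∧ o.2 = []) fun d =>
      ev s v ≠ 1 ∧ ev s v ∈ Fil Sig d.is_le ∧ (∀ i : Fin (D + 1), i < d → ev s v ∉ Fil Sig i.is_le) ∧
        ∀ j ∈ o.2, (Δ'.equivFin.symm j : AWord (Letter Sig)).deg ≤ (d : ℕ)
  have hR : ComputablePred fun q : List (Fin Δ.card) × Option (Fin (D + 1)) × List (Fin Δ'.card) =>
      R q.1 q.2 := by
    have hv : Computable fun q : List (Fin Δ.card) × List (Fin Δ'.card) => q.1 := Computable.fst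
    refine ComputablePred.and' (hword.eq ht hs (Computable.snd.comp Computable.snd) Computable.fst)
      (ComputablePred.comp_computable (computablePred_of_finite (γ := Option (Fin (D + 1)))
        (p := fun o (q : List (Fin Δ.card) × List (Fin Δ'.card)) =>
          o.elim (ev s q.1 = 1 ∧ q.2 = []) fun d =>
            ev s q.1 ≠ 1 ∧ ev s q.1 ∈ Fil Sig d.is_le ∧
              (∀ i : Fin (D + 1), i < d → ev s q.1 ∉ Fil Sig i.is_le) ∧
              ∀ j ∈ q.2, (Δ'.equivFin.symm j : AWord (Letter Sig)).deg ≤ (d : ℕ)) ?_)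
        (f := fun q : List (Fin Δ.card) × Option (Fin (D + 1)) × List (Fin Δ'.card) =>
          (q.2.1, (q.1, q.2.2))) ((Computable.fst.comp Computable.snd).pair
            (Computable.fst.pair (Computable.snd.comp Computable.snd))))
    rintro (_ | d)
    · exact (hword.comp hs hv).and' (computablePred_eq Computable.snd (Computable.const []))
    · refine (hword.comp hs hv).not.and' (((hmem d d.is_le).comp hs hv).and'
        (ComputablePred.and' (ComputablePred.forall_finite fun i => ?_)
          (computablePred_forall_mem _ Computable.snd)))
      by_cases hi : i < d
      · simpa [hi] using ((hmem i i.is_le).comp hs hv).not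
      · simpa [hi] using ComputablePred.const True
  -- Every input has a certificate, so the unbounded search terminates.
  have hex : ∀ v, ∃ o, R v o := by
    intro v
    by_cases h1 : ev s v = 1
    · exact ⟨(none, []), h1.symm, h1, rfl⟩
    · have hfil : ∃ d : Fin (D + 1), ev s v ∈ Fil Sig d.is_le :=
        ⟨Fin.last D, ev_mem hs v⟩
      obtain ⟨d, hd, hmin⟩ := WellFounded.has_min (wellFounded_lt (α := Fin (D + 1)))
        {d | ev s v ∈ Fil Sig d.is_le} hfil
      obtain ⟨L, hL, hLv⟩ := hWs d v hd
      have hL' : L ∈ Set.range (List.map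
          fun j => (Δ'.equivFin.symm j : AWord (Letter Sig))) := by
        rw [Set.range_list_map]
        intro u hu
        exact ⟨Δ'.equivFin ⟨u, Finset.mem_biUnion.2 ⟨d, Finset.mem_univ _, hL u hu⟩⟩, by simp⟩
      obtain ⟨w, rfl⟩ := hL'
      refine ⟨(some d, w), ?_, h1, hd, fun i hi h => hmin i h hi, fun j hj => ?_⟩
      · rw [← hLv, List.map_map]
        rfl
      · exact (hW d _ (hL _ (List.mem_map_of_mem hj))).2
  obtain ⟨F, hF, hFR⟩ := exists_computable_of_forall_exists hR hex
  have hkey : ∀ w : List Δ, ∀ y : List Δ', R (w.map Δ.equivFin) (F (w.map Δ.equivFin)) →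
      y = (F (w.map Δ.equivFin)).2.map Δ'.equivFin.symm →
      Equivalent (bigSystem S₀) (eval w) (eval y) ∧
      (eval y).deg = rdeg (bigSystem S₀) (eval w) ∧
      (WithBot.recBotCoe none some (rdeg (bigSystem S₀) (eval w)) : Option ℕ) =
        (F (w.map Δ.equivFin)).1.map Fin.val := by
    intro w y hRw hy
    generalize F (w.map Δ.equivFin) = o at hRw hy ⊢
    obtain ⟨o, v⟩ := o
    have hx : Rep D (eval w) (ev s (w.map Δ.equivFin)) := by
      have := rep_eval hΔD w
      rw [ev_map]
      simpa [s, Function.comp_def] using this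
    have hy' : Rep D (eval y) (ev t v) := by
      have := rep_eval hΔD' y
      rw [hy, ev_map] at this
      rw [hy]
      exact this
    obtain ⟨h1, h2⟩ := hRw
    rw [h1] at hy'
    refine ⟨hx.equivalent S₀ hS₀ hy', ?_⟩
    cases o with
    | none =>
      obtain ⟨h3, h4⟩ := h2
      have h5 := (hx.rdeg_eq_bot_iff S₀ hone hgen hS₀).2 h3
      have h6 : v = [] := h4
      rw [h5, hy, h6]
      refine ⟨?_, rfl⟩
      simp [eval_eq]
    | some d =>
      obtain ⟨h3, h4, h5, h6⟩ := h2
      have h7 : ∀ i (hi : i < (d : ℕ)),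
          ev s (w.map Δ.equivFin) ∉ Fil Sig (hi.le.trans d.is_le) :=
        fun i hi => h5 ⟨i, hi.trans d.2⟩ hi
      have h8 := hx.rdeg_eq hone hgen hS₀ h3 d.is_le h4 h7
      have h9 : (eval y).deg = (d : ℕ) := by
        refine hy'.deg_eq h3 d.is_le ?_ h7
        rw [eval_eq, hy, List.map_map]
        refine AWord.deg_prod_le fun u hu => ?_
        obtain ⟨j, hj, rfl⟩ := List.mem_map.1 hu
        exact h6 j hj
      rw [h8, h9]
      exact ⟨rfl, rfl⟩
  have hkey' := fun w => hkey w _ (hFR _) rfl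
  refine ⟨Δ', fun u hu => (hΔD' u hu).1,
    fun w => (F (w.map Δ.equivFin)).2.map Δ'.equivFin.symm,
    ⟨_, _, Δ.equivFin, Δ'.equivFin, ?_⟩, fun w => ⟨(hkey' w).1, (hkey' w).2.1⟩⟩
  refine ((Computable.option_map (Computable.fst.comp hF)
    ((Primrec.dom_finite Fin.val).to_comp.comp Computable.snd).to₂).pair
      (Computable.snd.comp hF)).of_eq fun v => ?_
  rw [(hkey' _).2.2]
  simp [List.map_map, Function.comp_def]
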